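/- Let $k$ be a number field, let $S$ be a finite set of places of $k$ containing all archimedean places, and let $\mathcal{O}_{k,S}=\{\alpha\in k : v(\alpha)\ge 0 \text{ for all } v\notin S\}$ be the ring of $S$-integers. Let $C$ be a smooth projective curve of genus $0$ over $k$, and let $D$ be a reduced effective divisor on $C$ of degree at most $2$. Let $\mathcal{C}$ be a normal projective model of $C$ over $\mathcal{O}_{k,S}$, that is, a normal flat projective scheme over $\mathcal{O}_{k,S}$ together with an identification of its generic fibre with $C$, and let $\mathcal{D}$ be the closure of $D$ in $\mathcal{C}$. Write $C^\circ=C\setminus D$, and let $C^\circ(\mathcal{O}_{k,S}) := (\mathcal{C}\setminus\mathcal{D})(\mathcal{O}_{k,S})$ be the set of sections of $\mathcal{C}\to\mathrm{Spec}(\mathcal{O}_{k,S})$ which do not meet $\mathcal{D}$ over any point of $\mathrm{Spec}(\mathcal{O}_{k,S})$; via the generic fibre and the inclusion $k \subset k_v$ each such section gives a point of $C(k_v)$ for every place $v$ of $k$, where $k_v$ is the completion of $k$ at $v$. Assume that $C^\circ(\mathcal{O}_{k,S})$ is infinite. Let $v\in S$ be such that $D(k_v)\neq\emptyset$, and let $W\subset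 C(k_v)$ be an open neighbourhood of $D(k_v)$ for the $v$-adic topology. Then $C^\circ(\mathcal{O}_{k,S})\cap W$ is infinite. -/

import Mathlib

open CategoryTheory Limits AlgebraicGeometry TopologicalSpace NumberField IsDedekindDomain

universe u

noncomputable section

/-! ### Places, completions and `S`-integers of a number field -/

/-- The places of a number field `k`: the archimedean places, and the non-archimedean ones, which
are given by the nonzero primes of the ring of integers. -/
inductive NFPlace (k : Type u) [Field k] [NumberField k] : Type u
  | infinite (w : InfinitePlace k) : NFPlace k
  | finite (p : HeightOneSpectrum (𝓞 k)) : NFPlace k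

namespace NFPlace

variable {k : Type u} [Field k] [NumberField k]

/-- The completion `k_v` of `k` at the place `v`. -/
def Completion : NFPlace k → Type u
  | infinite w => w.Completion
  | finite p => p.adicCompletion k

instance (v : NFPlace k) : Field v.Completion :=
  match v with
  | infinite w => inferInstanceAs (Field w.Completion)
  | finite p => inferInstanceAs (Field (p.adicCompletion k))

instance (v : NFPlace k) : TopologicalSpace v.Completion :=
  match v with
  | infinite w => inferInstanceAs (TopologicalSpace w.Completion)
  | finite p => inferInstanceAs (TopologicalSpace (p.adicCompletion k))

instance (v : NFPlace k) : Algebra k v.Completion :=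
  match v with
  | infinite w => inferInstanceAs (Algebra k w.Completion)
  | finite p => inferInstanceAs (Algebra k (p.adicCompletion k))

end NFPlace

/-- The ring `𝒪_{k,S}` of `S`-integers: the elements of `k` that are integral at every
non-archimedean place outside `S`. -/
abbrev SIntegers (k : Type u) [Field k] [NumberField k] (S : Set (NFPlace k)) :
    Subalgebra (𝓞 k) k :=
  Set.integer {p : HeightOneSpectrum (𝓞 k) | NFPlace.finite p ∈ S} k

/-! ### Schemes: projective morphisms, normality, genus zero -/

namespace AlgebraicGeometry

/-- A morphism `f : X ⟶ Spec R` is projective if `X` is, over `R`, a closed subscheme of some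
projective space `ℙⁿ_R = Proj R[x₀, …, xₙ]`. -/
def IsProjectiveOver {R : Type u} [CommRing R] {X : Scheme.{u}}
    (f : X ⟶ Spec (CommRingCat.of R)) : Prop :=
  letI (n : ℕ) : GradedAlgebra (MvPolynomial.homogeneousSubmodule (Fin (n + 1)) R) :=
    MvPolynomial.gradedAlgebra
  ∃ (n : ℕ) (j : X ⟶ Proj (MvPolynomial.homogeneousSubmodule (Fin (n + 1)) R)),
    IsClosedImmersion j ∧
      j ≫ Proj.toSpecZero (MvPolynomial.homogeneousSubmodule (Fin (n + 1)) R) ≫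
        Spec.map (CommRingCat.ofHom
          (algebraMap R (MvPolynomial.homogeneousSubmodule (Fin (n + 1)) R 0))) = f

/-- A scheme is normal if all its local rings are integrally closed domains. -/
def IsNormalScheme (X : Scheme.{u}) : Prop :=
  ∀ x : X, IsDomain (X.presheaf.stalk x) ∧ IsIntegrallyClosed (X.presheaf.stalk x)

/-- The structure sheaf of a scheme, as a sheaf of abelian groups. -/
def Scheme.structureSheafAb (X : Scheme.{u}) :
    Sheaf (Opens.grothendieckTopology X) AddCommGrpCat.{u} :=
  (sheafCompose _ (forget₂ CommRingCat.{u} RingCat.{u} ⋙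
    forget₂ RingCat.{u} AddCommGrpCat.{u})).obj X.sheaf

/-- A smooth projective curve `C` has genus `0` if the cohomology group `H¹(C, 𝒪_C)`, whose
dimension is the genus, vanishes. -/
def HasGenusZero (C : Scheme.{u}) : Prop :=
  Subsingleton (Sheaf.H.{u} C.structureSheafAb 1)

/-- The degree over a field `k` of a finite `k`-scheme `D`: the dimension of its ring of
functions. -/
def degreeOver {k : Type u} [Field k] {D : Scheme.{u}} (d : D ⟶ Spec (CommRingCat.of k)) : ℕ :=
  letI : Algebra k Γ(D, ⊤) :=
    (d.appTop.hom.comp (Scheme.ΓSpecIso (CommRingCat.of k)).inv.hom).toAlgebra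
  Module.finrank k Γ(D, ⊤)

/-! ### Points over a topological field -/

section Points

variable {k : Type u} [Field k]

/-- The set `X(F)` of `F`-valued points of a `k`-scheme `X`, for a field extension `F` of `k`. -/
def FieldPoints {X : Scheme.{u}} (f : X ⟶ Spec (CommRingCat.of k)) (F : Type u) [Field F]
    [Algebra k F] : Type u :=
  {x : Spec (CommRingCat.of F) ⟶ X // x ≫ f = Spec.map (CommRingCat.ofHom (algebraMap k F))}

namespace FieldPoints

variable {X Y : Scheme.{u}} {f : X ⟶ Spec (CommRingCat.of k)} {F : Type u} [Field F] [Algebra k F]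

/-- The map `Y(F) → X(F)` induced by a morphism `i : Y ⟶ X` over `k`. -/
def map (i : Y ⟶ X) (y : FieldPoints (i ≫ f) F) : FieldPoints f F :=
  ⟨y.1 ≫ i, by rw [Category.assoc]; exact y.2⟩

/-- The value `s(x) ∈ F` of a function `s` on the open `U` at an `F`-point `x` of `U`. -/
def eval (U : X.Opens) (s : Γ(X, U)) (x : {x : FieldPoints f F // ⊤ ≤ x.1 ⁻¹ᵁ U}) : F :=
  (Scheme.ΓSpecIso (CommRingCat.of F)).hom.hom ((x.1.1.appLE U ⊤ x.2).hom s)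

/-- The topology on `X(F)` defined by the topology of `F`. For an affine open `U` of `X`, the set
`U(F)` has the coarsest topology for which all the functions in `Γ(X, U)` are continuous on it
(the one induced by any closed embedding of `U` into an affine space); these are glued, so that a
set `W` is open in `X(F)` if and only if `W ∩ U(F)` is open in `U(F)` for all `U`. -/
instance [TopologicalSpace F] : TopologicalSpace (FieldPoints f F) :=
  ⨆ U : X.affineOpens, TopologicalSpace.coinduced
    (Subtype.val : {x : FieldPoints f F // ⊤ ≤ x.1 ⁻¹ᵁ U.1} → FieldPoints f F)
    (⨅ s : Γ(X, U.1), TopologicalSpace.induced (eval U.1 s) inferInstance)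

end FieldPoints

end Points

/-! ### Integral points -/

section IntegralPoints

variable {O k : Type u} [CommRing O] [Field k] [Algebra O k]

/-- Let `g : X ⟶ Spec O` be a scheme over `O` and `Z` a set of points of `X`. An integral point of
`X` minus the closure of `Z` is a section of `g` that avoids the closure of `Z` over each point of
`Spec O`. -/
def IntegralPoints {X : Scheme.{u}} (g : X ⟶ Spec (CommRingCat.of O)) (Z : Set X) : Type u :=
  {s : Spec (CommRingCat.of O) ⟶ X // s ≫ g = 𝟙 _ ∧
    ∀ p : Spec (CommRingCat.of O), s p ∉ closure Z}

/-- If `C` is the generic fibre `X ×_O k` of `X`, then a section of `X` over `O` defines a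
`k`-point of `C`, and so an `F`-point of `C` for each extension `F` of `k`. -/
def IntegralPoints.toFieldPoint {X C : Scheme.{u}} {g : X ⟶ Spec (CommRingCat.of O)} {Z : Set X}
    {f : C ⟶ Spec (CommRingCat.of k)} {ι : C ⟶ X}
    (h : IsPullback ι f g (Spec.map (CommRingCat.ofHom (algebraMap O k))))
    (F : Type u) [Field F] [Algebra k F] (P : IntegralPoints g Z) : FieldPoints f F :=
  ⟨h.lift (Spec.map (CommRingCat.ofHom ((algebraMap k F).comp (algebraMap O k))) ≫ P.1)
      (Spec.map (CommRingCat.ofHom (algebraMap k F)))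
      (by rw [Category.assoc, P.2.1, Category.comp_id, CommRingCat.ofHom_comp, Spec.map_comp]),
    h.lift_snd _ _ _⟩

end IntegralPoints

end AlgebraicGeometry

end

/-!
An integral point `P₀` exists, and its generic point is a rational point `x₀` of `C`, not on `D`.
As `H¹(C, 𝒪) = 0`, the principal part of the inverse of a local parameter at `x₀` is that of a
function on `C` whose only pole is simple and at `x₀`. Its polynomials are all the functions on the
complement of `x₀`, which is affine by Zariski's main theorem; so this complement is the affine line
(`nonempty_lineChart`), with `x₀` as the point at infinity. The divisor `D` is the zero set there of
a monic squarefree polynomial `q` of degree at most two, and the points of `D(k_v)` are given by the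
roots of `q` in `k_v`.

Integral points are produced as follows (`LineChart.exists_section`). Let `τ = a / b` with
`S`-integers `a` and `b` such that `b ^ deg q * q(a / b)` is a unit and `b` is divisible by a certain
`N` that depends on the model only. At a prime that contains `b`, the point `τ` is so close to
infinity that its reduction on the model is that of `P₀`, which avoids the closure of `D`. At the
other primes, where the model is the affine line because they do not contain `N`, `q(τ)` is a unit,
so that the reduction of `τ` is not on the closure of `D`. Hence `τ` extends to an integral point.
The local extensions are glued along `Spec` of the `S`-integers.

It remains to approximate a root `θ` of `q` in `k_v` by such fractions, different from `θ`
(`SIntegers.exists_div_mem`). If `q = X - θ`, the fractions `θ + (N c)⁻¹ z ^ n` serve, where `c` is a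
denominator of `θ`, for some `z` that is small at `v` and inverse to an `S`-integer. If `q` is
quadratic with roots `θ = θ₁` and `θ₂`, one solves `a - θ₁ b = w₁ ^ n` and `a - θ₂ b = w₂ ^ n`, where
`w₁` and `w₂` are `S`-units in the field of the roots with `w₁ / w₂` small at `v`, and conjugate to
each other if `q` is irreducible. For suitable exponents `n`, these powers are congruent to `1` modulo
any given integer, so that `b` is divisible by `N`. The `S`-units come from Dirichlet's unit theorem
and from the finiteness of the class group.

There is one case in which they need not exist: `v` is the only infinite place, there are no finite
places in `S`, and `θ₁` and `θ₂` are in `k`. Here the hypothesis that there are infinitely many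
integral points is needed once more. The values of `(X - θ₁) / (X - θ₂)` and of its inverse at
integral points have a common denominator, so they are divisors of a fixed number up to a constant
factor, and since this number is in finitely many ideals there are infinitely many units
(`LineChart.infinite_units`); but by the product formula units have absolute value `1` at `v`, so that
there are finitely many (`SIntegers.finite_units`), and this case does not occur.
-/

noncomputable section

/-! ### Vanishing cohomology and sections over an intersection -/

namespace CategoryTheory.Sheaf

open Opposite Abelian

variable {C : Type u} [SmallCategory C] {J : GrothendieckTopology C}

section

/-- The free abelian sheaf `ℤ[U]` generated by an object `U` of a site. -/
abbrev freeAb (J : GrothendieckTopology C) [HasSheafify J AddCommGrpCat.{u}] (U : C) :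
    Sheaf J AddCommGrpCat.{u} :=
  (presheafToSheaf J _).obj (yoneda.obj U ⋙ AddCommGrpCat.free)

variable [HasSheafify J AddCommGrpCat.{u}]

/-- The section over `U` corresponding to a morphism `ℤ[U] ⟶ F`. -/
def sectionOfHom {F : Sheaf J AddCommGrpCat.{u}} {U : C} (φ : freeAb J U ⟶ F) :
    F.obj.obj (op U) :=
  ((toSheafify J (yoneda.obj U ⋙ AddCommGrpCat.free) ≫ φ.hom).app (op U)).hom
    (FreeAbelianGroup.of (𝟙 U))

lemma sectionOfHom_map {F : Sheaf J AddCommGrpCat.{u}} {U V : C} (i : U ⟶ V)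
    (φ : freeAb J V ⟶ F) :
    sectionOfHom ((presheafToSheaf J _).map (Functor.whiskerRight (yoneda.map i) _) ≫ φ) =
      F.obj.map i.op (sectionOfHom φ) := by
  have h1 : toSheafify J (yoneda.obj U ⋙ AddCommGrpCat.free) ≫
      ((presheafToSheaf J _).map (Functor.whiskerRight (yoneda.map i) AddCommGrpCat.free)).hom =
      Functor.whiskerRight (yoneda.map i) AddCommGrpCat.free ≫
        toSheafify J (yoneda.obj V ⋙ AddCommGrpCat.free) :=
    (toSheafify_naturality J _).symm
  have h2 := (toSheafify J (yoneda.obj V ⋙ AddCommGrpCat.free) ≫ φ.hom).naturality i.op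
  have h3 := congrArg (fun f => f.hom (FreeAbelianGroup.of (𝟙 V))) h2
  unfold sectionOfHom
  rw [ObjectProperty.FullSubcategory.comp_hom, reassoc_of% h1]
  refine Eq.trans ?_ h3
  have h4 : ((Functor.whiskerRight (yoneda.map i) AddCommGrpCat.free).app (op U)).hom
      (FreeAbelianGroup.of (𝟙 U)) =
      ((yoneda.obj V ⋙ AddCommGrpCat.free).map i.op).hom (FreeAbelianGroup.of (𝟙 V)) := by
    change FreeAbelianGroup.map _ _ = FreeAbelianGroup.map _ _
    rw [FreeAbelianGroup.map_of_apply, FreeAbelianGroup.map_of_apply]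
    simp
  exact congrArg (fun z => ((toSheafify J (yoneda.obj V ⋙ AddCommGrpCat.free) ≫ φ.hom).app
    (op U)).hom z) h4

lemma sectionOfHom_neg {F : Sheaf J AddCommGrpCat.{u}} {U : C} (φ : freeAb J U ⟶ F) :
    sectionOfHom (-φ) = - sectionOfHom φ := by
  rfl

lemma sectionOfHom_add {F : Sheaf J AddCommGrpCat.{u}} {U : C} (φ ψ : freeAb J U ⟶ F) :
    sectionOfHom (φ + ψ) = sectionOfHom φ + sectionOfHom ψ := by
  rfl

lemma sectionOfHom_surjective (F : Sheaf J AddCommGrpCat.{u}) (U : C) :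
    Function.Surjective (sectionOfHom (F := F) (U := U)) := by
  intro x
  let η : yoneda.obj U ⋙ AddCommGrpCat.free ⟶ F.obj :=
    { app := fun W => AddCommGrpCat.ofHom
        (FreeAbelianGroup.lift fun i : W.unop ⟶ U => (F.obj.map i.op).hom x)
      naturality := by
        intro V W i
        apply AddCommGrpCat.hom_ext
        refine FreeAbelianGroup.lift_ext _ _ fun j => ?_
        change FreeAbelianGroup.lift _ (FreeAbelianGroup.map _ _) =
          (F.obj.map i).hom (FreeAbelianGroup.lift _ (FreeAbelianGroup.of j))
        rw [FreeAbelianGroup.map_of_apply]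
        simp }
  refine ⟨⟨sheafifyLift J η F.property⟩, ?_⟩
  unfold sectionOfHom
  rw [toSheafify_sheafifyLift]
  change FreeAbelianGroup.lift _ (FreeAbelianGroup.of (𝟙 U)) = x
  simp

end

/-- Over a terminal object, `ℤ[T]` is the constant sheaf. -/
def freeAbIso [HasSheafify J AddCommGrpCat.{u}] {T : C} (hT : IsTerminal T) :
    freeAb J T ≅ (constantSheaf J AddCommGrpCat.{u}).obj (AddCommGrpCat.of (ULift ℤ)) :=
  (presheafToSheaf J _).mapIso (NatIso.ofComponents (fun W =>
    letI : Unique (W.unop ⟶ T) := ⟨⟨hT.from _⟩, fun _ => hT.hom_ext _ _⟩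
    ((FreeAbelianGroup.uniqueEquiv (W.unop ⟶ T)).trans AddEquiv.ulift.symm).toAddCommGrpIso)
    (by
      intro V W i
      apply AddCommGrpCat.hom_ext
      exact FreeAbelianGroup.lift_ext _ _ fun j => rfl))

end CategoryTheory.Sheaf

namespace CategoryTheory

open Opposite Abelian

lemma biprod_lift_neg_comp {A : Type*} [Category A] [Preadditive A] [HasBinaryBiproducts A]
    {X Y Z T : A} (a : X ⟶ Y) (b : X ⟶ Z) (ψ : Y ⊞ Z ⟶ T) :
    biprod.lift a (-b) ≫ ψ = a ≫ biprod.inl ≫ ψ + -(b ≫ biprod.inr ≫ ψ) := by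
  simp [biprod.lift_eq]

open Sheaf in
/-- If `H¹(X, F) = 0` and `X` is the union of two opens `U` and `V`, then every section of `F` over
`U ∩ V` is a difference of sections over `U` and `V`. -/
lemma exists_sub_of_subsingleton_H {X : Type u} [TopologicalSpace X]
    (F : Sheaf (Opens.grothendieckTopology X) AddCommGrpCat.{u}) (hF : Subsingleton (F.H 1))
    (U V : Opens X) (hUV : U ⊔ V = ⊤) (x : F.obj.obj (op (U ⊓ V))) :
    ∃ (a : F.obj.obj (op U)) (b : F.obj.obj (op V)),
      x = F.obj.map (homOfLE inf_le_left).op a - F.obj.map (homOfLE inf_le_right).op b := by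
  let S := Opens.mayerVietorisSquare'
    { X₁ := U ⊓ V
      X₂ := U
      X₃ := V
      X₄ := ⊤
      f₁₂ := homOfLE inf_le_left
      f₁₃ := homOfLE inf_le_right
      f₂₄ := homOfLE le_top
      f₃₄ := homOfLE le_top
      fac := Subsingleton.elim _ _ } hUV.symm rfl
  obtain ⟨φ, hφ⟩ := sectionOfHom_surjective F (U ⊓ V) x
  have hS := S.shortComplex_shortExact
  have h0 : hS.extClass.comp (Ext.mk₀ φ) (add_zero 1) = 0 := by
    let e := freeAbIso (J := Opens.grothendieckTopology X) (T := (⊤ : Opens X)) isTerminalTop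
    let z : Ext (freeAb (Opens.grothendieckTopology X) ⊤) F 1 :=
      hS.extClass.comp (Ext.mk₀ φ) (add_zero 1)
    change z = 0
    have h1 : (Ext.mk₀ e.hom).comp ((Ext.mk₀ e.inv).comp z (zero_add 1)) (zero_add 1) = z := by
      rw [← Ext.comp_assoc_of_second_deg_zero, Ext.mk₀_comp_mk₀, e.hom_inv_id, Ext.mk₀_id_comp]
    rw [← h1, Subsingleton.elim ((Ext.mk₀ e.inv).comp z (zero_add 1)) 0, Ext.comp_zero]
  obtain ⟨ψ', hψ'⟩ := Ext.contravariant_sequence_exact₁ hS F (Ext.mk₀ φ) (add_zero 1) h0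
  obtain ⟨ψ, rfl⟩ := (Ext.mk₀_bijective _ _).2 ψ'
  rw [Ext.mk₀_comp_mk₀] at hψ'
  have hψ := (Ext.mk₀_bijective _ _).1 hψ'
  refine ⟨sectionOfHom (biprod.inl ≫ ψ), sectionOfHom (biprod.inr ≫ ψ), ?_⟩
  rw [← sectionOfHom_map, ← sectionOfHom_map, sub_eq_add_neg, ← sectionOfHom_neg,
    ← sectionOfHom_add, ← hφ, ← hψ]
  congr 1
  exact biprod_lift_neg_comp _ _ ψ

end CategoryTheory

namespace AlgebraicGeometry

/-- On a curve of genus zero, a function on `U ∩ V`, where `U` and `V` cover the curve, is a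
difference of functions on `U` and `V`. -/
lemma HasGenusZero.exists_sub {C : Scheme.{u}} (hC : HasGenusZero C) (U V : C.Opens)
    (hUV : U ⊔ V = ⊤) (x : Γ(C, U ⊓ V)) :
    ∃ (a : Γ(C, U)) (b : Γ(C, V)),
      x = C.presheaf.map (homOfLE inf_le_left).op a - C.presheaf.map (homOfLE inf_le_right).op b :=
  CategoryTheory.exists_sub_of_subsingleton_H C.structureSheafAb hC U V hUV x

end AlgebraicGeometry

/-! ### Points of a scheme with values in a ring -/

namespace AlgebraicGeometry

section Eval

variable {X Y : Scheme.{u}} {R S : CommRingCat.{u}}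

/-- The value in `R` of a function on the open `U` at an `R`-valued point of `U`. -/
def evalAt (a : Spec R ⟶ X) (U : X.Opens) (h : ⊤ ≤ a ⁻¹ᵁ U) : Γ(X, U) →+* R :=
  (a.appLE U ⊤ h ≫ (Scheme.ΓSpecIso R).hom).hom

lemma le_preimage_iff_range_subset {a : Y ⟶ X} {U : X.Opens} :
    ⊤ ≤ a ⁻¹ᵁ U ↔ Set.range a ⊆ U := by
  constructor
  · rintro h _ ⟨y, rfl⟩
    exact h (Set.mem_univ y)
  · intro h y _
    exact h ⟨y, rfl⟩

lemma le_preimage_SpecMap_comp {a : Spec R ⟶ X} {U : X.Opens} (h : ⊤ ≤ a ⁻¹ᵁ U) (φ : Y ⟶ Spec R) :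
    ⊤ ≤ (φ ≫ a) ⁻¹ᵁ U := by
  intro y _
  exact h (Set.mem_univ (φ y))

lemma evalAt_SpecMap_comp (a : Spec R ⟶ X) (U : X.Opens) (h : ⊤ ≤ a ⁻¹ᵁ U) (φ : R ⟶ S)
    (h' : ⊤ ≤ (Spec.map φ ≫ a) ⁻¹ᵁ U) :
    evalAt (Spec.map φ ≫ a) U h' = φ.hom.comp (evalAt a U h) := by
  unfold evalAt
  have h1 : (Spec.map φ).appLE ⊤ ⊤ le_top ≫ (Scheme.ΓSpecIso S).hom =
      (Scheme.ΓSpecIso R).hom ≫ φ := by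
    rw [← Scheme.ΓSpecIso_naturality]
    exact congrArg (· ≫ _) (Scheme.Hom.app_eq_appLE (Spec.map φ)).symm
  rw [← Scheme.Hom.appLE_comp_appLE (Spec.map φ) a U ⊤ ⊤ h le_top, Category.assoc, h1]
  rfl

lemma evalAt_congr {a b : Spec R ⟶ X} (hab : a = b) (U : X.Opens) (h : ⊤ ≤ a ⁻¹ᵁ U) :
    evalAt a U h = evalAt b U (hab ▸ h) := by
  subst hab; rfl

lemma evalAt_res (a : Spec R ⟶ X) {U V : X.Opens} (hUV : V ≤ U) (h : ⊤ ≤ a ⁻¹ᵁ V) (s : Γ(X, U)) :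
    evalAt a V h (X.presheaf.map (homOfLE hUV).op s) =
      evalAt a U (h.trans fun _ hx => hUV hx) s := by
  unfold evalAt
  rw [← Scheme.Hom.map_appLE a h (homOfLE hUV).op]
  rfl

lemma evalAt_comp (a : Spec R ⟶ Y) (j : Y ⟶ X) (U : X.Opens) (h : ⊤ ≤ (a ≫ j) ⁻¹ᵁ U)
    (s : Γ(X, U)) : evalAt (a ≫ j) U h s = evalAt a (j ⁻¹ᵁ U) h (j.app U s) := by
  unfold evalAt
  have := Scheme.Hom.appLE_comp_appLE a j U (j ⁻¹ᵁ U) ⊤ le_rfl h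
  rw [← this, Scheme.Hom.app_eq_appLE]
  rfl

lemma eq_SpecMap_evalAt (a : Spec R ⟶ X) {U : X.Opens} (hU : IsAffineOpen U) (h : ⊤ ≤ a ⁻¹ᵁ U) :
    a = Spec.map (CommRingCat.ofHom (evalAt a U h)) ≫ hU.fromSpec := by
  unfold evalAt
  have h1 := IsAffineOpen.SpecMap_appLE_fromSpec a hU (isAffineOpen_top (Spec R)) h
  rw [CommRingCat.ofHom_hom, Spec.map_comp, Category.assoc, h1, ← Category.assoc]
  have h2 : Spec.map (Scheme.ΓSpecIso R).hom ≫ (isAffineOpen_top (Spec R)).fromSpec = 𝟙 _ := by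
    rw [IsAffineOpen.fromSpec_top, Scheme.isoSpec_Spec_inv, ← Spec.map_comp]
    simp
  rw [h2]
  exact (Category.id_comp a).symm

lemma hom_ext_of_evalAt {a b : Spec R ⟶ X} {U : X.Opens} (hU : IsAffineOpen U)
    (ha : ⊤ ≤ a ⁻¹ᵁ U) (hb : ⊤ ≤ b ⁻¹ᵁ U) (h : evalAt a U ha = evalAt b U hb) : a = b := by
  rw [eq_SpecMap_evalAt a hU ha, eq_SpecMap_evalAt b hU hb, h]

/-- The `R`-valued point of an affine open `U` given by a ring homomorphism from `Γ(X, U)`. -/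
def pointOf {U : X.Opens} (hU : IsAffineOpen U) (ρ : Γ(X, U) →+* R) : Spec R ⟶ X :=
  Spec.map (CommRingCat.ofHom ρ) ≫ hU.fromSpec

lemma le_preimage_pointOf {U : X.Opens} (hU : IsAffineOpen U) (ρ : Γ(X, U) →+* R) :
    ⊤ ≤ (pointOf hU ρ) ⁻¹ᵁ U := by
  apply le_preimage_SpecMap_comp
  rw [le_preimage_iff_range_subset, hU.range_fromSpec]

lemma evalAt_pointOf {U : X.Opens} (hU : IsAffineOpen U) (ρ : Γ(X, U) →+* R) :
    evalAt (pointOf hU ρ) U (le_preimage_pointOf hU ρ) = ρ := by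
  have h := eq_SpecMap_evalAt (pointOf hU ρ) hU (le_preimage_pointOf hU ρ)
  have h2 := (cancel_mono hU.fromSpec).1 h
  have h3 := Spec.map_injective h2
  exact (congrArg CommRingCat.Hom.hom h3).symm

lemma apply_mem_basicOpen_iff (a : Spec R ⟶ X) {U : X.Opens} (h : ⊤ ≤ a ⁻¹ᵁ U) (s : Γ(X, U))
    (p : Spec R) : a p ∈ X.basicOpen s ↔ evalAt a U h s ∉ p.asIdeal := by
  have h1 : a p ∈ X.basicOpen s ↔ p ∈ (Spec R).basicOpen (a.appLE U ⊤ h s) := by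
    have := Scheme.basicOpen_appLE a ⊤ U h s
    rw [this]
    exact ⟨fun h => ⟨trivial, h⟩, fun h => h.2⟩
  have h2 : a.appLE U ⊤ h s = (Scheme.ΓSpecIso R).inv (evalAt a U h s) := by
    simp [evalAt]
  rw [h1, h2, basicOpen_eq_of_affine]
  rfl

end Eval

end AlgebraicGeometry

/-! ### Smooth curves over a field -/

lemma under_ne_bot_of_etale (B : Type*) {A : Type*} [CommRing B] [CommRing A] [IsDomain A]
    [Algebra B A] [Algebra.Etale B A] (P : Ideal A) [P.IsPrime] (hP : P ≠ ⊥) : P.under B ≠ ⊥ := by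
  intro h
  apply hP
  symm
  apply Algebra.QuasiFinite.eq_of_le_of_under_eq (R := B) _ _ bot_le
  exact le_antisymm (Ideal.comap_mono bot_le) (h ▸ bot_le)

lemma dimensionLEOne_of_etale (B : Type*) {A : Type*} [CommRing B] [IsDomain B]
    [IsPrincipalIdealRing B] [CommRing A] [IsDomain A] [Algebra B A] [Algebra.Etale B A] :
    Ring.DimensionLEOne A := by
  refine ⟨fun {P} hP hP' => ?_⟩
  obtain ⟨Q, hQ, hPQ⟩ := P.exists_le_maximal hP'.ne_top
  have h1 := under_ne_bot_of_etale (B := B) P hP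
  have h2 : (P.under B).IsMaximal := Ring.DimensionLEOne.maximalOfPrime h1 inferInstance
  have h3 : P.under B = Q.under B := h2.eq_of_le (Ideal.IsPrime.ne_top inferInstance)
    (Ideal.comap_mono hPQ)
  rwa [Algebra.QuasiFinite.eq_of_le_of_under_eq (R := B) P Q hPQ h3]

lemma isDiscreteValuationRing_of_etale (B : Type*) {A : Type*} [CommRing B] [IsDomain B]
    [IsPrincipalIdealRing B] [CommRing A] [IsDomain A] [Algebra B A] [Algebra.Etale B A]
    (P : Ideal A) [P.IsPrime] (hP : P ≠ ⊥) :
    IsDiscreteValuationRing (Localization.AtPrime P) := by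
  have h1 := under_ne_bot_of_etale (B := B) P hP
  have : IsNoetherianRing A := Algebra.FiniteType.isNoetherianRing B A
  let p := P.under B
  let _ := Localization.AtPrime.algebraOfLiesOver p P
  have h2 := ((Algebra.isUnramifiedAt_iff_map_eq B p P).1 inferInstance).2
  obtain ⟨g, hg⟩ := IsPrincipalIdealRing.principal p
  have h3 : (IsLocalRing.maximalIdeal (Localization.AtPrime P)).IsPrincipal := by
    rw [← h2, hg]
    change (Ideal.map _ (Ideal.span {g})).IsPrincipal
    rw [Ideal.map_span, Set.image_singleton]
    exact ⟨_, rfl⟩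
  have h4 : ¬ IsField (Localization.AtPrime P) := IsLocalization.AtPrime.not_isField A hP _
  exact ((IsDiscreteValuationRing.TFAE (Localization.AtPrime P) h4).out 4 0).1 h3

/-- If `A` is a one-dimensional domain of finite type over a field `k`, then any `t` in `A` that is
transcendental over `k` defines a quasi-finite morphism from `Spec A` to the affine line. -/
lemma quasiFinite_of_transcendental {k A : Type*} [Field k] [CommRing A] [IsDomain A]
    [Algebra k A] [Algebra.FiniteType k A] [Ring.DimensionLEOne A] (t : A)
    (ht : Transcendental k t) : (Polynomial.aeval (R := k) t).toRingHom.QuasiFinite := by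
  algebraize [(Polynomial.aeval (R := k) t).toRingHom]
  have : IsScalarTower k (Polynomial k) A := IsScalarTower.of_algebraMap_eq' (by
    ext x; simp [RingHom.algebraMap_toAlgebra])
  have : Algebra.FiniteType (Polynomial k) A := Algebra.FiniteType.of_restrictScalars_finiteType k _ _
  have : IsNoetherianRing A := Algebra.FiniteType.isNoetherianRing k A
  change Algebra.QuasiFinite (Polynomial k) A
  rw [Algebra.QuasiFinite.iff_finite_comap_preimage_singleton]
  intro P
  by_cases hP : P.asIdeal = ⊥
  · refine (Set.finite_singleton (⊥ : PrimeSpectrum A)).subset fun Q hQ => ?_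
    rw [Set.mem_singleton_iff]
    by_contra hQ0
    have hQ1 : Q.asIdeal ≠ ⊥ := fun h => hQ0 (PrimeSpectrum.ext h)
    have hQ2 : Q.asIdeal.IsMaximal := Ring.DimensionLEOne.maximalOfPrime hQ1 inferInstance
    have : Module.Finite k (A ⧸ Q.asIdeal) := by
      let _ := Ideal.Quotient.field Q.asIdeal
      exact finite_of_finite_type_of_isJacobsonRing _ _
    obtain ⟨p, hp, hp0⟩ := Algebra.IsAlgebraic.isAlgebraic (R := k) (Ideal.Quotient.mk Q.asIdeal t)
    have h1 : p ∈ P.asIdeal := by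
      rw [← hQ]
      change Polynomial.aeval t p ∈ Q.asIdeal
      rw [← Ideal.Quotient.eq_zero_iff_mem, ← hp0]
      exact (Polynomial.aeval_algHom_apply (Ideal.Quotient.mkₐ k Q.asIdeal) t p).symm
    rw [hP] at h1
    exact hp h1
  · obtain ⟨p, hpP, hp⟩ := Submodule.exists_mem_ne_zero_of_ne_bot hP
    have h1 : Polynomial.aeval t p ≠ 0 := fun h => hp ((transcendental_iff.1 ht) p h)
    have h2 := (Ideal.finite_minimalPrimes_of_isNoetherianRing A
      (Ideal.span {Polynomial.aeval t p}))
    refine (h2.preimage (f := PrimeSpectrum.asIdeal)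
      (fun _ _ _ _ h => PrimeSpectrum.ext h)).subset fun Q hQ => ?_
    have h3 : Polynomial.aeval t p ∈ Q.asIdeal := by
      rw [← hQ] at hpP
      exact hpP
    refine ⟨⟨inferInstance, by rwa [Ideal.span_singleton_le_iff_mem]⟩, fun J hJ hJQ => ?_⟩
    have hJ0 : J ≠ ⊥ := by
      rintro rfl
      exact h1 (by simpa using hJ.2)
    have := hJ.1
    exact ((Ring.DimensionLEOne.maximalOfPrime hJ0 hJ.1).eq_of_le (Ideal.IsPrime.ne_top inferInstance) hJQ).ge

namespace AlgebraicGeometry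

lemma le_preimage_top {X Y : Scheme.{u}} (f : X ⟶ Y) (U : X.Opens) : U ≤ f ⁻¹ᵁ ⊤ := le_top

/-- The ring homomorphism `k → Γ(C, U)` for an open `U` of a `k`-scheme `C`. -/
def constMap {k : Type u} [CommRing k] {C : Scheme.{u}} (f : C ⟶ Spec (CommRingCat.of k))
    (U : C.Opens) : k →+* Γ(C, U) :=
  ((Scheme.ΓSpecIso (CommRingCat.of k)).inv ≫ f.appLE ⊤ U (le_preimage_top f U)).hom

section

variable {k : Type u} [CommRing k] {C : Scheme.{u}} (f : C ⟶ Spec (CommRingCat.of k))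

lemma map_constMap {U V : C.Opens} (h : V ≤ U) (c : k) :
    C.presheaf.map (homOfLE h).op (constMap f U c) = constMap f V c := by
  unfold constMap
  rw [← Scheme.Hom.appLE_map f (le_preimage_top f U) (homOfLE h).op]
  rfl

lemma evalAt_constMap {R : CommRingCat.{u}} (a : Spec R ⟶ C) (φ : CommRingCat.of k ⟶ R)
    (ha : a ≫ f = Spec.map φ) (U : C.Opens) (h : ⊤ ≤ a ⁻¹ᵁ U) (c : k) :
    evalAt a U h (constMap f U c) = φ.hom c := by
  have h1 : (Scheme.ΓSpecIso (CommRingCat.of k)).inv ≫ (f.appLE ⊤ U (le_preimage_top f U) ≫ a.appLE U ⊤ h) ≫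
      (Scheme.ΓSpecIso R).hom = φ := by
    rw [Scheme.Hom.appLE_comp_appLE]
    simp only [ha]
    rw [Iso.inv_comp_eq, ← Scheme.ΓSpecIso_naturality]
    exact congrArg (· ≫ _) (Scheme.Hom.app_eq_appLE (Spec.map φ)).symm
  exact congrArg (fun z => z.hom c) h1

end

section

variable {k : Type u} [Field k] {C : Scheme.{u}} (f : C ⟶ Spec (CommRingCat.of k))

lemma exists_etale_chart [SmoothOfRelativeDimension 1 f] (x : C) :
    ∃ (U : C.Opens) (_ : IsAffineOpen U) (_ : x ∈ U) (ρ : Polynomial k →+* Γ(C, U)),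
      ρ.Etale ∧ ρ.comp Polynomial.C = constMap f U := by
  obtain ⟨V, hV, U, hU, hxU, e, h⟩ :=
    SmoothOfRelativeDimension.exists_isStandardSmoothOfRelativeDimension (n := 1) (f := f) x
  obtain rfl : V = ⊤ := by
    rw [eq_top_iff]
    intro y _
    rw [Subsingleton.elim (α := PrimeSpectrum k) y (f x)]
    exact e hxU
  have h2 : (constMap f U).IsStandardSmoothOfRelativeDimension 1 := by
    have h3 : (Scheme.ΓSpecIso (CommRingCat.of k)).inv.hom.IsStandardSmoothOfRelativeDimension 0 :=
      RingHom.IsStandardSmoothOfRelativeDimension.equiv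
        (Scheme.ΓSpecIso (CommRingCat.of k)).symm.commRingCatIsoToRingEquiv
    exact RingHom.IsStandardSmoothOfRelativeDimension.comp h h3
  obtain ⟨g, hg, hg'⟩ := h2.exists_etale_mvPolynomial
  let e : Polynomial k ≃ₐ[k] MvPolynomial (Fin 1) k := (MvPolynomial.uniqueAlgEquiv k (Fin 1)).symm
  refine ⟨U, hU, hxU, g.comp e.toRingEquiv.toRingHom, ?_, ?_⟩
  · exact RingHom.Etale.stableUnderComposition _ _ (RingHom.Etale.of_bijective e.bijective) hg'
  · rw [← hg]
    ext c
    exact congrArg g (e.commutes c)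

/-- The affine charts of a smooth curve: finitely generated algebras that are étale over `k[X]`, so
that their dimension is at most one and their local rings at nonzero primes are discrete valuation
rings. -/
lemma exists_dimensionLEOne_chart [IsIntegral C] [SmoothOfRelativeDimension 1 f] (x : C) :
    ∃ (U : C.Opens) (_ : IsAffineOpen U) (_ : x ∈ U) (_ : Nonempty U),
      (constMap f U).FiniteType ∧ Ring.DimensionLEOne Γ(C, U) ∧
      ∀ P : Ideal Γ(C, U), ∀ _ : P.IsPrime, P ≠ ⊥ →
        IsDiscreteValuationRing (Localization.AtPrime P) := by
  obtain ⟨U, hU, hxU, ρ, hρ, hρC⟩ := exists_etale_chart f x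
  have : Nonempty U := ⟨⟨x, hxU⟩⟩
  algebraize [ρ]
  refine ⟨U, hU, hxU, this, ?_, dimensionLEOne_of_etale (Polynomial k),
    fun P _ hP => isDiscreteValuationRing_of_etale (Polynomial k) P hP⟩
  rw [← hρC]
  refine RingHom.FiniteType.comp ?_ ?_
  · change Algebra.FiniteType (Polynomial k) Γ(C, U)
    infer_instance
  · rw [← Polynomial.algebraMap_eq, RingHom.finiteType_algebraMap]
    infer_instance

lemma isDiscreteValuationRing_stalk [IsIntegral C] [SmoothOfRelativeDimension 1 f] (x : C)
    (hx : x ≠ genericPoint C) : IsDiscreteValuationRing (C.presheaf.stalk x) := by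
  obtain ⟨U, hU, hxU, _, -, -, h⟩ := exists_dimensionLEOne_chart f x
  let x' : U := ⟨x, hxU⟩
  let _ := TopCat.Presheaf.algebra_section_stalk C.presheaf x'
  have := hU.isLocalization_stalk x'
  have h1 : (hU.primeIdealOf x').asIdeal ≠ ⊥ := by
    intro h0
    apply hx
    have h2 := hU.primeIdealOf_genericPoint
    have h3 : hU.primeIdealOf x' = genericPoint (Spec Γ(C, U)) := by
      rw [genericPoint_eq_bot_of_affine]
      exact PrimeSpectrum.ext h0
    have h4 := congrArg hU.fromSpec (h3.trans h2.symm)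
    rw [hU.fromSpec_primeIdealOf, hU.fromSpec_primeIdealOf] at h4
    exact h4
  have h2 := h _ inferInstance h1
  let e := IsLocalization.algEquiv (hU.primeIdealOf x').asIdeal.primeCompl
    (Localization.AtPrime (hU.primeIdealOf x').asIdeal) (C.presheaf.stalk x'.1)
  exact IsDiscreteValuationRing.RingEquivClass.isDiscreteValuationRing e

end

end AlgebraicGeometry

/-! ### Maps from a curve to the affine line -/

namespace AlgebraicGeometry

/-- The ring homomorphism `k[X] → Γ(Y, U)` that sends `X` to `t`. -/
def polyMap {k : Type u} [Field k] {Y : Scheme.{u}} (f : Y ⟶ Spec (CommRingCat.of k))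
    {U : Y.Opens} (t : Γ(Y, U)) : Polynomial k →+* Γ(Y, U) :=
  Polynomial.eval₂RingHom (constMap f U) t

section

variable {k : Type u} [Field k] {Y : Scheme.{u}} (f : Y ⟶ Spec (CommRingCat.of k))

lemma map_polyMap {U V : Y.Opens} (h : V ≤ U) (t : Γ(Y, U)) (p : Polynomial k) :
    Y.presheaf.map (homOfLE h).op (polyMap f t p) =
      polyMap f (Y.presheaf.map (homOfLE h).op t) p := by
  have : (Y.presheaf.map (homOfLE h).op).hom.comp (polyMap f t) =
      polyMap f (Y.presheaf.map (homOfLE h).op t) := by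
    ext c
    · simp [polyMap]
      exact map_constMap f h c
    · simp [polyMap]
  exact congrArg (fun z => z p) this

/-- The morphism to the affine line defined by a function `t`. -/
def toAffineLine (t : Γ(Y, ⊤)) : Y ⟶ Spec (CommRingCat.of (Polynomial k)) :=
  Y.toSpecΓ ≫ Spec.map (CommRingCat.ofHom (polyMap f t))

lemma toAffineLine_comp (t : Γ(Y, ⊤)) :
    toAffineLine f t ≫ Spec.map (CommRingCat.ofHom Polynomial.C) = f := by
  have h1 : CommRingCat.ofHom (Polynomial.C (R := k)) ≫ CommRingCat.ofHom (polyMap f t) =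
      CommRingCat.ofHom (constMap f ⊤) := by
    ext c
    simp [polyMap]
  rw [toAffineLine, Category.assoc, ← Spec.map_comp, h1, constMap, CommRingCat.ofHom_hom,
    Spec.map_comp]
  have h2 : f.appLE ⊤ ⊤ (le_preimage_top f ⊤) = f.appTop := (Scheme.Hom.app_eq_appLE f).symm
  rw [h2, ← Category.assoc, ← Scheme.toSpecΓ_naturality, Category.assoc, ← SpecMap_ΓSpecIso_hom]
  rw [← Spec.map_comp]
  simp

/-- A non-constant function on a smooth curve defines a quasi-finite morphism to the affine line. -/
lemma locallyQuasiFinite_toAffineLine [IsIntegral Y] [SmoothOfRelativeDimension 1 f] (t : Γ(Y, ⊤))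
    (ht : Function.Injective (polyMap f t)) : LocallyQuasiFinite (toAffineLine f t) := by
  have hst : RingHom.StableUnderCompositionWithLocalizationAwaySource RingHom.QuasiFinite :=
    (RingHom.StableUnderComposition.stableUnderCompositionWithLocalizationAway
      RingHom.QuasiFinite.stableUnderComposition RingHom.QuasiFinite.holdsForLocalizationAway).left
  rw [HasRingHomProperty.iff_exists_appLE (P := @LocallyQuasiFinite) hst]
  intro x
  obtain ⟨W, hW, hxW, _, hft, hdim, -⟩ := exists_dimensionLEOne_chart f x
  refine ⟨⟨⊤, isAffineOpen_top _⟩, ⟨W, hW⟩, hxW, le_preimage_top _ _, ?_⟩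
  let t' := Y.presheaf.map (homOfLE (le_top : W ≤ ⊤)).op t
  have h1 : (polyMap f t').QuasiFinite := by
    algebraize [constMap f W]
    have h2 : Transcendental k t' := by
      rw [transcendental_iff]
      intro p hp
      apply ht
      rw [map_zero]
      have h3 : Function.Injective (Y.presheaf.map (homOfLE (le_top : W ≤ ⊤)).op) :=
        map_injective_of_isIntegral Y (homOfLE le_top)
      apply h3
      rw [map_zero]
      exact (map_polyMap f le_top t p).trans hp
    exact quasiFinite_of_transcendental t' h2
  have h3 : (toAffineLine f t).appLE ⊤ W (le_preimage_top _ _) =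
      (Scheme.ΓSpecIso (CommRingCat.of (Polynomial k))).hom ≫
        CommRingCat.ofHom (polyMap f t') := by
    have h4 : (toAffineLine f t).appTop = (Scheme.ΓSpecIso (CommRingCat.of (Polynomial k))).hom ≫
        CommRingCat.ofHom (polyMap f t) := by
      rw [toAffineLine, Scheme.Hom.comp_appTop, Scheme.toSpecΓ_appTop, Scheme.ΓSpecIso_naturality]
    have h5 : (toAffineLine f t).appLE ⊤ W (le_preimage_top _ _) =
      (toAffineLine f t).appTop ≫ Y.presheaf.map (homOfLE (le_top : W ≤ ⊤)).op := rfl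
    rw [h5, h4, Category.assoc]
    congr 1
    refine CommRingCat.hom_ext (RingHom.ext fun p => ?_)
    exact map_polyMap f le_top t p
  rw [h3]
  exact h1.comp (RingHom.QuasiFinite.of_finite (RingHom.Finite.of_surjective _
    (ConcreteCategory.bijective_of_isIso (Scheme.ΓSpecIso (CommRingCat.of (Polynomial k))).hom).2))

/-- A smooth curve whose functions form the polynomial ring in one of them, `t`, is affine: by
Zariski's main theorem it is quasi-affine, and no closed point of the spectrum of its ring of
functions is missing since the ideal of such a point is principal. -/
lemma isAffine_of_polyMap_bijective [IsIntegral Y] [SmoothOfRelativeDimension 1 f]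
    [IsSeparated f] [CompactSpace Y] (t : Γ(Y, ⊤))
    (ht : Function.Bijective (polyMap f t)) : IsAffine Y := by
  have := locallyQuasiFinite_toAffineLine f t ht.1
  have : LocallyOfFiniteType (toAffineLine f t) := by
    have : LocallyOfFiniteType (toAffineLine f t ≫
        Spec.map (CommRingCat.ofHom (Polynomial.C (R := k)))) := by
      have := SmoothOfRelativeDimension.smooth 1 f
      rw [toAffineLine_comp]; infer_instance
    exact locallyOfFiniteType_of_comp _ (Spec.map (CommRingCat.ofHom (Polynomial.C (R := k))))
  have : IsSeparated (toAffineLine f t) := by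
    have : IsSeparated (toAffineLine f t ≫
        Spec.map (CommRingCat.ofHom (Polynomial.C (R := k)))) := by
      rw [toAffineLine_comp]; infer_instance
    exact IsSeparated.of_comp _ (Spec.map (CommRingCat.ofHom (Polynomial.C (R := k))))
  have : QuasiCompact (toAffineLine f t) := inferInstance
  have h1 : IsAffine (toAffineLine f t).normalization :=
    isAffine_of_isAffineHom (toAffineLine f t).fromNormalization
  have h2 : Y.IsQuasiAffine := Scheme.IsQuasiAffine.of_isImmersion (toAffineLine f t).toNormalization
  have h3 : Surjective Y.toSpecΓ := by
    have : IsPrincipalIdealRing Γ(Y, ⊤) := IsPrincipalIdealRing.of_surjective _ ht.2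
    refine ⟨fun P => ?_⟩
    by_contra hP
    obtain ⟨g, hg⟩ := IsPrincipalIdealRing.principal (PrimeSpectrum.asIdeal P)
    have h4 : ∀ y : Y, y ∈ Y.basicOpen g := by
      intro y
      rw [← Scheme.toSpecΓ_preimage_basicOpen]
      by_contra hy
      have hy' : g ∈ (Y.toSpecΓ y).asIdeal := by
        by_contra h
        exact hy h
      have h6 : P.asIdeal ≤ (Y.toSpecΓ y).asIdeal := by
        rw [hg]; exact (Ideal.span_singleton_le_iff_mem _).2 hy'
      have h7 : P ⤳ Y.toSpecΓ y := (PrimeSpectrum.le_iff_specializes P _).1 h6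
      exact hP (h7.mem_open Y.toSpecΓ.isOpenEmbedding.isOpen_range ⟨y, rfl⟩)
    have h5 : IsUnit g :=
      RingedSpace.isUnit_of_isUnit_germ Y.toLocallyRingedSpace.toRingedSpace ⊤ g
        fun y hy => (Scheme.mem_basicOpen_top Y g y).1 (h4 y)
    refine P.isPrime.ne_top ?_
    rw [hg]
    exact Ideal.span_singleton_eq_top.2 h5
  have h4 : IsIso Y.toSpecΓ := (isIso_iff_isOpenImmersion_and_surjective _).mpr ⟨inferInstance, h3⟩
  exact ⟨h4⟩

end

end AlgebraicGeometry

/-! ### Rational points and local parameters -/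

namespace AlgebraicGeometry

section

variable {k : Type u} [Field k] {C : Scheme.{u}}

/-- The point of `C` underlying a `k`-rational point. -/
def closedPt (x₀ : Spec (CommRingCat.of k) ⟶ C) : C := x₀ (IsLocalRing.closedPoint k)

lemma apply_eq_closedPt (x₀ : Spec (CommRingCat.of k) ⟶ C) (p : Spec (CommRingCat.of k)) :
    x₀ p = closedPt x₀ := by
  rw [closedPt, Subsingleton.elim (α := PrimeSpectrum k) p (IsLocalRing.closedPoint k)]

lemma range_eq_closedPt (x₀ : Spec (CommRingCat.of k) ⟶ C) : Set.range x₀ = {closedPt x₀} := by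
  ext x
  constructor
  · rintro ⟨p, rfl⟩
    exact apply_eq_closedPt x₀ p
  · rintro rfl
    exact ⟨_, rfl⟩

lemma le_preimage_of_closedPt_mem (x₀ : Spec (CommRingCat.of k) ⟶ C) {U : C.Opens}
    (h : closedPt x₀ ∈ U) : ⊤ ≤ x₀ ⁻¹ᵁ U := by
  rw [le_preimage_iff_range_subset, range_eq_closedPt]
  simpa using h

lemma closedPt_mem_of_le_preimage (x₀ : Spec (CommRingCat.of k) ⟶ C) {U : C.Opens}
    (h : ⊤ ≤ x₀ ⁻¹ᵁ U) : closedPt x₀ ∈ U := h (Set.mem_univ _)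

lemma closedPt_mem_basicOpen_iff (x₀ : Spec (CommRingCat.of k) ⟶ C) {U : C.Opens}
    (h : ⊤ ≤ x₀ ⁻¹ᵁ U) (s : Γ(C, U)) : closedPt x₀ ∈ C.basicOpen s ↔ evalAt x₀ U h s ≠ 0 := by
  have : (IsLocalRing.closedPoint k).asIdeal = ⊥ := IsLocalRing.maximalIdeal_eq_bot
  exact (apply_mem_basicOpen_iff x₀ h s _).trans
    (not_congr ((Ideal.ext_iff.1 this _).trans Ideal.mem_bot))

lemma germ_map {U V : C.Opens} (h : V ≤ U) {x : C} (hx : x ∈ V) (s : Γ(C, U)) :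
    C.presheaf.germ V x hx (C.presheaf.map (homOfLE h).op s) = C.presheaf.germ U x (h hx) s :=
  TopCat.Presheaf.germ_res_apply _ _ _ _ _

lemma genericPoint_mem_of_mem [IsIntegral C] {U : C.Opens} {x : C} (hx : x ∈ U) :
    genericPoint C ∈ U :=
  ((genericPoint_spec C).mem_open_set_iff U.isOpen).2 ⟨x, trivial, hx⟩

lemma genericPoint_mem_basicOpen [IsIntegral C] (U : C.Opens) {m : Γ(C, U)} (hm : m ≠ 0) :
    genericPoint C ∈ C.basicOpen m := by
  have h : C.basicOpen m ≠ ⊥ := fun h => hm ((basicOpen_eq_bot_iff m).1 h)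
  obtain ⟨x, hx⟩ := (Opens.ne_bot_iff_nonempty _).1 h
  exact genericPoint_mem_of_mem hx

variable (f : C ⟶ Spec (CommRingCat.of k)) (x₀ : Spec (CommRingCat.of k) ⟶ C)

lemma isClosed_closedPt [IsSeparated f] (hx₀ : x₀ ≫ f = 𝟙 _) : IsClosed {closedPt x₀} := by
  have : IsClosedImmersion (x₀ ≫ f) := by rw [hx₀]; infer_instance
  have : IsClosedImmersion x₀ := IsClosedImmersion.of_comp x₀ f
  rw [← range_eq_closedPt]
  exact x₀.isClosedEmbedding.isClosed_range

lemma evalAt_constMap_self (hx₀ : x₀ ≫ f = 𝟙 _) {U : C.Opens} (h : ⊤ ≤ x₀ ⁻¹ᵁ U) (c : k) :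
    evalAt x₀ U h (constMap f U c) = c :=
  evalAt_constMap f x₀ (𝟙 _) (by rw [hx₀, Spec.map_id]) U h c

lemma closedPt_ne_genericPoint [IsIntegral C] [SmoothOfRelativeDimension 1 f]
    (hx₀ : x₀ ≫ f = 𝟙 _) : closedPt x₀ ≠ genericPoint C := by
  obtain ⟨U, hU, hxU, ρ, hρ, hρC⟩ := exists_etale_chart f (closedPt x₀)
  have : Nonempty U := ⟨⟨_, hxU⟩⟩
  have hle := le_preimage_of_closedPt_mem x₀ hxU
  have hinj : Function.Injective ρ := by
    algebraize [ρ]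
    exact FaithfulSMul.algebraMap_injective _ _
  let c := evalAt x₀ U hle (ρ Polynomial.X)
  let m := ρ (Polynomial.X - Polynomial.C c)
  have hm0 : m ≠ 0 := (map_ne_zero_iff ρ hinj).2 (Polynomial.X_sub_C_ne_zero c)
  have hm : closedPt x₀ ∉ C.basicOpen m := by
    rw [closedPt_mem_basicOpen_iff x₀ hle, not_not]
    have h1 : ρ (Polynomial.C c) = constMap f U c := congrArg (fun z => z c) hρC
    simp only [m]
    rw [map_sub, map_sub, h1, evalAt_constMap_self f x₀ hx₀]
    exact sub_self _
  intro h
  apply hm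
  rw [h]
  exact genericPoint_mem_basicOpen U hm0

/-- A local parameter at a rational point `x₀` of a smooth curve, on a neighbourhood of `x₀` so
small that `x₀` is its only zero. -/
lemma exists_localParameter [IsIntegral C] [SmoothOfRelativeDimension 1 f] [IsSeparated f]
    (hx₀ : x₀ ≫ f = 𝟙 _) :
    ∃ (U : C.Opens) (hU : closedPt x₀ ∈ U) (a : Γ(C, U)),
      Irreducible (C.presheaf.germ U (closedPt x₀) hU a) ∧
        ∀ x ∈ U, x ≠ closedPt x₀ → x ∈ C.basicOpen a := by
  have := isDiscreteValuationRing_stalk f _ (closedPt_ne_genericPoint f x₀ hx₀)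
  have : Smooth f := SmoothOfRelativeDimension.smooth 1 f
  have := LocallyOfFiniteType.isLocallyNoetherian f
  obtain ⟨ϖ, hϖ⟩ := IsDiscreteValuationRing.exists_irreducible (C.presheaf.stalk (closedPt x₀))
  obtain ⟨U₁, hU₁, a₁, rfl⟩ := C.presheaf.exists_germ_eq ϖ
  obtain ⟨W, hW, hxW, hWU⟩ := exists_isAffineOpen_mem_and_subset hU₁
  have hle : W ≤ U₁ := hWU
  obtain ⟨a, ha⟩ : ∃ a : Γ(C, W), a = C.presheaf.map (homOfLE hle).op a₁ := ⟨_, rfl⟩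
  have hirr : Irreducible (C.presheaf.germ W (closedPt x₀) hxW a) := by
    rw [ha, TopCat.Presheaf.germ_res_apply]
    exact hϖ
  have : IsNoetherianRing Γ(C, W) := IsLocallyNoetherian.component_noetherian ⟨W, hW⟩
  let P : Ideal Γ(C, W) := (IsLocalRing.maximalIdeal (C.presheaf.stalk (closedPt x₀))).comap
    (C.presheaf.germ W (closedPt x₀) hxW).hom
  have hP (g : Γ(C, W)) : g ∈ P ↔ closedPt x₀ ∉ C.basicOpen g := by
    rw [Scheme.mem_basicOpen C g _ hxW]
    exact Iff.rfl
  obtain ⟨T, hT⟩ := (inferInstance : IsNoetherianRing Γ(C, W)).noetherian P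
  -- near `x₀`, the functions that vanish at `x₀` are multiples of the local parameter
  have key : ∀ g ∈ T, ∀ᶠ x in nhds (closedPt x₀), x ∈ C.basicOpen g → x ∈ C.basicOpen a := by
    intro g hg
    have hgP : g ∈ P := by rw [← hT]; exact Ideal.subset_span hg
    have h1 : C.presheaf.germ W _ hxW g ∈
        IsLocalRing.maximalIdeal (C.presheaf.stalk (closedPt x₀)) := hgP
    rw [hirr.maximalIdeal_eq, Ideal.mem_span_singleton] at h1
    obtain ⟨c, hc⟩ := h1
    obtain ⟨U₂, hU₂, c, rfl⟩ := C.presheaf.exists_germ_eq c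
    have hxWU : closedPt x₀ ∈ W ⊓ U₂ := ⟨hxW, hU₂⟩
    have h2 : C.presheaf.germ W (closedPt x₀) hxW g = C.presheaf.germ (W ⊓ U₂) (closedPt x₀) hxWU
        (C.presheaf.map (homOfLE inf_le_left).op a * C.presheaf.map (homOfLE inf_le_right).op c) := by
      rw [map_mul]
      exact hc.trans (congrArg₂ (· * ·) (germ_map inf_le_left hxWU a).symm
        (germ_map inf_le_right hxWU c).symm)
    obtain ⟨U₃, hU₃, i₁, i₂, h3⟩ := C.presheaf.germ_eq _ _ _ _ _ h2
    filter_upwards [U₃.isOpen.mem_nhds hU₃] with x hx hxg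
    have hx' := i₁.le hx
    rw [Scheme.mem_basicOpen C _ _ hx'] at hxg ⊢
    have h4 := congrArg (C.presheaf.germ U₃ x hx) h3
    rw [TopCat.Presheaf.germ_res_apply, TopCat.Presheaf.germ_res_apply, map_mul] at h4
    replace h4 := h4.trans (congrArg (· * _) (germ_map inf_le_left (i₂.le hx) a))
    rw [h4] at hxg
    exact isUnit_of_mul_isUnit_left hxg
  have key' := (Filter.eventually_all_finset T).2 key
  obtain ⟨U, hU1, hUo, hU2⟩ := mem_nhds_iff.1 (Filter.inter_mem key' (W.isOpen.mem_nhds hxW))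
  refine ⟨⟨U, hUo⟩, hU2, C.presheaf.map (homOfLE fun x hx => (hU1 hx).2).op a, ?_, ?_⟩
  · rw [TopCat.Presheaf.germ_res_apply]
    exact hirr
  · intro x hx hne
    rw [Scheme.basicOpen_res]
    refine ⟨hx, ?_⟩
    by_contra hxa
    have hxW' : x ∈ W := (hU1 hx).2
    let V : C.Opens := ⟨{closedPt x₀}ᶜ, (isClosed_closedPt f x₀ hx₀).isOpen_compl⟩
    obtain ⟨g, hg, hxg⟩ := hW.exists_basicOpen_le (V := V) ⟨x, hne⟩ hxW'
    have hgP : g ∈ P := (hP g).2 fun h => hg h rfl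
    have hPx : P ≤ (IsLocalRing.maximalIdeal (C.presheaf.stalk x)).comap
        (C.presheaf.germ W x hxW').hom := by
      rw [← hT, Submodule.span_le]
      intro g hg
      have := mt ((hU1 hx).1 g hg) hxa
      rw [Scheme.mem_basicOpen C _ _ hxW'] at this
      exact this
    have := hPx hgP
    rw [Scheme.mem_basicOpen C _ _ hxW'] at hxg
    exact this hxg

/-- Modulo the maximal ideal, every germ at a rational point is a constant. -/
lemma exists_germ_sub_const_mem (hx₀ : x₀ ≫ f = 𝟙 _) (r : C.presheaf.stalk (closedPt x₀)) :
    ∃ c : k, r - C.presheaf.germ ⊤ (closedPt x₀) trivial (constMap f ⊤ c) ∈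
      IsLocalRing.maximalIdeal (C.presheaf.stalk (closedPt x₀)) := by
  obtain ⟨U, hU, g, rfl⟩ := C.presheaf.exists_germ_eq r
  have hle := le_preimage_of_closedPt_mem x₀ hU
  refine ⟨evalAt x₀ U hle g, ?_⟩
  have h1 : C.presheaf.germ ⊤ (closedPt x₀) trivial (constMap f ⊤ (evalAt x₀ U hle g)) =
      C.presheaf.germ U (closedPt x₀) hU (constMap f U (evalAt x₀ U hle g)) := by
    rw [← map_constMap f (le_top : U ≤ ⊤), TopCat.Presheaf.germ_res_apply]
  rw [h1, ← map_sub, IsLocalRing.mem_maximalIdeal, mem_nonunits_iff,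
    ← Scheme.mem_basicOpen C _ _ hU, closedPt_mem_basicOpen_iff x₀ hle, not_not, map_sub,
    evalAt_constMap_self f x₀ hx₀, sub_self]

end

end AlgebraicGeometry

/-! ### The coordinate on the complement of a rational point -/

/-- A polynomial in the inverse `t` of an element `y` of the maximal ideal of a local ring has a
pole of order its degree. -/
lemma Polynomial.exists_eval₂_mul_pow_eq {k R K : Type*} [Field k] [CommRing R] [IsLocalRing R]
    [Field K] [Algebra R K] (σ : k →+* R) {y : R} (hy : y ∈ IsLocalRing.maximalIdeal R) {t : K}
    (hyt : algebraMap R K y * t = 1) {P : Polynomial k} (hP : P ≠ 0) :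
    ∃ u : Rˣ, P.eval₂ ((algebraMap R K).comp σ) t * algebraMap R K y ^ P.natDegree =
      algebraMap R K u := by
  have hu : IsUnit (P.reverse.eval₂ σ y) := by
    rw [Polynomial.eval₂_eq_sum_range, Finset.sum_range_succ']
    have h0 : IsUnit (σ (P.reverse.coeff 0) * y ^ 0) := by
      rw [pow_zero, mul_one, Polynomial.coeff_zero_reverse]
      exact (IsUnit.mk0 _ (Polynomial.leadingCoeff_ne_zero.2 hP)).map σ
    have h1 : ∑ i ∈ Finset.range P.reverse.natDegree, σ (P.reverse.coeff (i + 1)) * y ^ (i + 1) ∈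
        IsLocalRing.maximalIdeal R :=
      Ideal.sum_mem _ fun i _ => Ideal.mul_mem_left _ _ (Ideal.pow_mem_of_mem _ hy _ i.succ_pos)
    by_contra h
    rw [← mem_nonunits_iff, ← IsLocalRing.mem_maximalIdeal] at h
    exact (IsLocalRing.mem_maximalIdeal _).1 ((Ideal.add_mem_iff_right _ h1).1 h) h0
  refine ⟨hu.unit, ?_⟩
  let _ : Invertible t := ⟨algebraMap R K y, hyt, by rw [mul_comm, hyt]⟩
  have h1 := Polynomial.eval₂_reverse_mul_pow ((algebraMap R K).comp σ) t P
  have h2 : ⅟t = algebraMap R K y := rfl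
  rw [h2, ← Polynomial.hom_eval₂] at h1
  rw [IsUnit.unit_spec, ← h1, mul_assoc, ← mul_pow, mul_comm t, hyt, one_pow, mul_one]

/-- The order of the pole of `P(t)` is at most its degree, `n * deg r` for `r(t) ^ n`; so, if
`P(t) / r(t) ^ n` vanishes at the pole of `t`, then `deg P < n * deg r`. -/
lemma Polynomial.natDegree_lt_of_eval₂ {k R K : Type*} [Field k] [CommRing R] [IsDomain R]
    [IsLocalRing R] [Field K] [Algebra R K] [FaithfulSMul R K] (σ : k →+* R) {y : R}
    (hy : y ∈ IsLocalRing.maximalIdeal R) {t : K} (hyt : algebraMap R K y * t = 1)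
    {P r : Polynomial k} (hP : P ≠ 0) (hr : r ≠ 0) {n : ℕ} {γ : R}
    (hγ : γ ∈ IsLocalRing.maximalIdeal R)
    (h : algebraMap R K γ * r.eval₂ ((algebraMap R K).comp σ) t ^ n =
      P.eval₂ ((algebraMap R K).comp σ) t) :
    P.natDegree < n * r.natDegree := by
  obtain ⟨u, hu⟩ := P.exists_eval₂_mul_pow_eq σ hy hyt hP
  obtain ⟨w, hw⟩ := r.exists_eval₂_mul_pow_eq σ hy hyt hr
  by_contra! hd
  obtain ⟨e, he⟩ := Nat.exists_eq_add_of_le hd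
  have h1 : algebraMap R K (γ * w ^ n * y ^ e) = algebraMap R K u := by
    rw [← hu, ← h, he, map_mul, map_mul, map_pow, map_pow, ← hw]
    ring
  have h2 := FaithfulSMul.algebraMap_injective R K h1
  refine (IsLocalRing.mem_maximalIdeal _).1 ?_ u.isUnit
  rw [← h2]
  exact Ideal.mul_mem_right _ _ (Ideal.mul_mem_right _ _ hγ)

namespace AlgebraicGeometry

/-- The element of the function field defined by a section of the structure sheaf of a curve. -/
def toFunctionField {C : Scheme.{u}} [IrreducibleSpace C] (U : C.Opens) (h : genericPoint C ∈ U) :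
    Γ(C, U) →+* C.functionField := (C.presheaf.germ U (genericPoint C) h).hom

section

variable {C : Scheme.{u}}

lemma map_map_section {U V W : C.Opens} (h : V ≤ U) (h' : W ≤ V) (s : Γ(C, U)) :
    C.presheaf.map (homOfLE h').op (C.presheaf.map (homOfLE h).op s) =
      C.presheaf.map (homOfLE (h'.trans h)).op s := by
  rw [← CommRingCat.comp_apply, ← Functor.map_comp]
  rfl

lemma toFunctionField_map [IrreducibleSpace C] {U V : C.Opens} (hUV : V ≤ U)
    (h : genericPoint C ∈ V) (s : Γ(C, U)) :
    toFunctionField V h (C.presheaf.map (homOfLE hUV).op s) = toFunctionField U (hUV h) s :=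
  germ_map hUV h s

lemma toFunctionField_injective [IsIntegral C] (U : C.Opens) (h : genericPoint C ∈ U) :
    Function.Injective (toFunctionField U h) := by
  have : Nonempty U := ⟨⟨_, h⟩⟩
  exact Scheme.germToFunctionField_injective C U

lemma algebraMap_germ [IsIntegral C] {U : C.Opens} {x : C} (hx : x ∈ U) (s : Γ(C, U)) :
    algebraMap (C.presheaf.stalk x) C.functionField (C.presheaf.germ U x hx s) =
      toFunctionField U (genericPoint_mem_of_mem hx) s := by
  have : Nonempty U := ⟨⟨_, hx⟩⟩
  exact Scheme.algebraMap_germ_eq_germToFunctionField ..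

/-- On an integral scheme, a section over an open `V` whose image in the function field lies in
the local ring at a further point `x` extends to each open `W` contained in `V ∪ {x}`. -/
lemma exists_extension [IsIntegral C] {V W : C.Opens} {x : C} (hV : ∀ y ∈ W, y ≠ x → y ∈ V)
    (hgV : genericPoint C ∈ V) (hgW : genericPoint C ∈ W) (s : Γ(C, V)) (r : C.presheaf.stalk x)
    (h : algebraMap _ C.functionField r = toFunctionField V hgV s) :
    ∃ s' : Γ(C, W), toFunctionField W hgW s' = toFunctionField V hgV s := by
  obtain ⟨U, hU, r, rfl⟩ := C.presheaf.exists_germ_eq r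
  have hUV : W ≤ (U : C.Opens) ⊔ V := by
    intro y hyW
    by_cases hy : y = x
    · subst hy; exact Or.inl hU
    · exact Or.inr (hV y hyW hy)
  rw [algebraMap_germ] at h
  have hg : genericPoint C ∈ (U : C.Opens) ⊓ V := ⟨genericPoint_mem_of_mem hU, hgV⟩
  obtain ⟨s', hs'⟩ : ∃ s' : Γ(C, U ⊔ V), C.presheaf.map (homOfLE le_sup_right).op s' = s := by
    refine ⟨(C.sheaf.objSupIsoProdEqLocus U V).inv ⟨⟨r, s⟩, ?_⟩,
      C.sheaf.objSupIsoProdEqLocus_inv_snd U V _⟩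
    apply toFunctionField_injective _ hg
    exact (toFunctionField_map inf_le_left hg r).trans
      (h.trans (toFunctionField_map inf_le_right hg s).symm)
  refine ⟨C.presheaf.map (homOfLE hUV).op s', ?_⟩
  rw [toFunctionField_map, ← hs', toFunctionField_map]

end

section

variable {k : Type u} [Field k] {C : Scheme.{u}} (f : C ⟶ Spec (CommRingCat.of k))
  (x₀ : Spec (CommRingCat.of k) ⟶ C)

lemma exists_eq_constMap [IsIntegral C] [UniversallyClosed f] (hx₀ : x₀ ≫ f = 𝟙 _)
    (g : Γ(C, ⊤)) : ∃ c : k, g = constMap f ⊤ c := by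
  let _ : Field Γ(C, ⊤) := (isField_of_universallyClosed k f).toField
  have hle := le_preimage_of_closedPt_mem x₀ (U := ⊤) trivial
  refine ⟨evalAt x₀ ⊤ hle g, (evalAt x₀ ⊤ hle).injective ?_⟩
  rw [evalAt_constMap_self f x₀ hx₀]

/-- The constants in the local ring at a point. -/
def stalkConst (x : C) : k →+* C.presheaf.stalk x :=
  (C.presheaf.germ ⊤ x trivial).hom.comp (constMap f ⊤)

lemma algebraMap_stalkConst [IsIntegral C] {U : C.Opens} (x : C) (hU : genericPoint C ∈ U) (c : k) :
    algebraMap _ C.functionField (stalkConst f x c) = toFunctionField U hU (constMap f U c) := by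
  rw [← map_constMap f (le_top : U ≤ ⊤), toFunctionField_map]
  exact algebraMap_germ _ _

lemma toFunctionField_polyMap [IsIntegral C] {V : C.Opens} (hV : genericPoint C ∈ V) (x : C)
    (t : Γ(C, V)) (P : Polynomial k) : toFunctionField V hV (polyMap f t P) =
      P.eval₂ ((algebraMap _ C.functionField).comp (stalkConst f x)) (toFunctionField V hV t) := by
  have h : (algebraMap _ C.functionField).comp (stalkConst f x) =
      (toFunctionField V hV).comp (constMap f V) :=
    RingHom.ext fun c => algebraMap_stalkConst f x hV c
  rw [h, polyMap]
  exact Polynomial.hom_eval₂ _ _ _ _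

/-- The complement of a rational point. -/
def complPt [IsSeparated f] (hx₀ : x₀ ≫ f = 𝟙 _) : C.Opens :=
  ⟨{closedPt x₀}ᶜ, (isClosed_closedPt f x₀ hx₀).isOpen_compl⟩

lemma genericPoint_mem_complPt [IsIntegral C] [SmoothOfRelativeDimension 1 f] [IsSeparated f]
    (hx₀ : x₀ ≫ f = 𝟙 _) : genericPoint C ∈ complPt f x₀ hx₀ :=
  (closedPt_ne_genericPoint f x₀ hx₀).symm

/-- On a curve of genus zero, there is a function with a single pole, which is simple, at a given
rational point. -/
lemma exists_simplePole [IsIntegral C] [SmoothOfRelativeDimension 1 f] [IsSeparated f]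
    (hx₀ : x₀ ≫ f = 𝟙 _) (hC : HasGenusZero C) :
    ∃ (t : Γ(C, complPt f x₀ hx₀)) (y : C.presheaf.stalk (closedPt x₀)), Irreducible y ∧
      algebraMap _ C.functionField y *
        toFunctionField _ (genericPoint_mem_complPt f x₀ hx₀) t = 1 := by
  obtain ⟨U, hU, a, ha, hUa⟩ := exists_localParameter f x₀ hx₀
  let V := complPt f x₀ hx₀
  have hgV := genericPoint_mem_complPt f x₀ hx₀
  have hUV : U ⊔ V = ⊤ := by
    refine top_le_iff.1 fun y _ => ?_
    by_cases hy : y = closedPt x₀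
    · subst hy; exact Or.inl hU
    · exact Or.inr hy
  have hgU := genericPoint_mem_of_mem hU
  have hg : genericPoint C ∈ U ⊓ V := ⟨hgU, hgV⟩
  have hunit : IsUnit (C.presheaf.map (homOfLE (inf_le_left : U ⊓ V ≤ U)).op a) := by
    have h1 : U ⊓ V ≤ C.basicOpen a := fun x hx => hUa x hx.1 hx.2
    have h2 := (RingedSpace.isUnit_res_basicOpen C.toRingedSpace a).map
      (C.presheaf.map (homOfLE h1).op).hom
    exact (map_map_section (C.basicOpen_le a) h1 a) ▸ h2
  obtain ⟨b, hb⟩ := hunit.exists_right_inv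
  -- since `1 / a = α - β`, the function `-β` differs from `1 / a` by a function regular at `x₀`
  obtain ⟨α, β, hαβ⟩ := hC.exists_sub U V hUV b
  have hK := congrArg (toFunctionField _ hg) hb
  rw [hαβ, map_mul, map_sub, map_one] at hK
  replace hK : toFunctionField U hgU a * (toFunctionField U hgU α - toFunctionField V hgV β) = 1 := by
    rw [← toFunctionField_map inf_le_left hg a, ← toFunctionField_map inf_le_left hg α,
      ← toFunctionField_map inf_le_right hg β]
    exact hK
  have := isDiscreteValuationRing_stalk f _ (closedPt_ne_genericPoint f x₀ hx₀)
  have hu : IsUnit (1 - C.presheaf.germ U _ hU a * C.presheaf.germ U _ hU α) := by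
    refine IsLocalRing.isUnit_one_sub_self_of_mem_nonunits _ ?_
    rw [← IsLocalRing.mem_maximalIdeal, ha.maximalIdeal_eq]
    exact Ideal.mul_mem_right _ _ (Ideal.mem_span_singleton_self _)
  obtain ⟨w, hw⟩ := hu.exists_right_inv
  have hwu : IsUnit w := IsUnit.of_mul_eq_one _ ((mul_comm _ _).trans hw)
  refine ⟨-β, C.presheaf.germ U _ hU a * w, (irreducible_mul_isUnit hwu).2 ha, ?_⟩
  have hw' := congrArg (algebraMap _ C.functionField) hw
  rw [map_mul, map_sub, map_mul, algebraMap_germ, algebraMap_germ, map_one] at hw'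
  rw [map_mul, algebraMap_germ, map_neg]
  linear_combination hw' * 1 + (algebraMap _ C.functionField w) * hK

/-- The functions on the complement of `x₀` are the polynomials in a function with a single pole,
simple, at `x₀`. -/
lemma polyMap_bijective_of_simplePole [IsIntegral C] [SmoothOfRelativeDimension 1 f] [IsProper f]
    (hx₀ : x₀ ≫ f = 𝟙 _) (t : Γ(C, complPt f x₀ hx₀)) (y : C.presheaf.stalk (closedPt x₀))
    (hy : Irreducible y) (hyt : algebraMap _ C.functionField y *
      toFunctionField _ (genericPoint_mem_complPt f x₀ hx₀) t = 1) :
    Function.Bijective (polyMap f t) := by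
  have hgV := genericPoint_mem_complPt f x₀ hx₀
  have := isDiscreteValuationRing_stalk f _ (closedPt_ne_genericPoint f x₀ hx₀)
  have hym : y ∈ IsLocalRing.maximalIdeal (C.presheaf.stalk (closedPt x₀)) := by
    rw [hy.maximalIdeal_eq]; exact Ideal.mem_span_singleton_self _
  have hinj : Function.Injective (algebraMap (C.presheaf.stalk (closedPt x₀)) C.functionField) :=
    IsFractionRing.injective _ _
  constructor
  · rw [injective_iff_map_eq_zero]
    intro P hP
    by_contra hP0
    obtain ⟨u, hu⟩ := P.exists_eval₂_mul_pow_eq (stalkConst f (closedPt x₀)) hym hyt hP0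
    rw [← toFunctionField_polyMap f hgV, hP, map_zero, zero_mul] at hu
    exact u.ne_zero (hinj (by rw [← hu, map_zero]))
  · -- by induction on the order of the pole at `x₀`
    have key (n : ℕ) : ∀ g : Γ(C, complPt f x₀ hx₀), ∀ r : C.presheaf.stalk (closedPt x₀),
        toFunctionField _ hgV g * algebraMap _ C.functionField y ^ n = algebraMap _ _ r →
        ∃ P, polyMap f t P = g := by
      induction n with
      | zero =>
        intro g r hr
        obtain ⟨g', hg'⟩ := exists_extension (W := ⊤) (fun y _ hy => hy) hgV trivial g r
          (by rw [← hr, pow_zero, mul_one])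
        rw [← toFunctionField_map le_top hgV] at hg'
        have hg' := toFunctionField_injective _ hgV hg'
        obtain ⟨c, rfl⟩ := exists_eq_constMap f x₀ hx₀ g'
        refine ⟨Polynomial.C c, ?_⟩
        rw [← hg', map_constMap, polyMap]
        simp
      | succ n ih =>
        intro g r hr
        obtain ⟨c, hc⟩ := exists_germ_sub_const_mem f x₀ hx₀ r
        rw [hy.maximalIdeal_eq, Ideal.mem_span_singleton] at hc
        obtain ⟨r', hr'⟩ := hc
        change r - stalkConst f _ c = y * r' at hr'
        obtain ⟨P, hP⟩ := ih (g - polyMap f t (Polynomial.C c * Polynomial.X ^ (n + 1))) r' (by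
          have h1 := congrArg (algebraMap _ C.functionField) hr'
          rw [map_sub, map_mul, ← hr] at h1
          rw [map_sub, toFunctionField_polyMap f hgV (closedPt x₀), Polynomial.eval₂_mul,
            Polynomial.eval₂_C, Polynomial.eval₂_pow, Polynomial.eval₂_X, RingHom.comp_apply]
          set Y := algebraMap _ C.functionField y
          set T := toFunctionField _ hgV t
          have h2 : Y ^ n * T ^ n = 1 := by rw [← mul_pow, hyt, one_pow]
          linear_combination T * h1 + (algebraMap _ C.functionField r' -
            toFunctionField _ hgV g * Y ^ n) * hyt -
            T * algebraMap _ C.functionField (stalkConst f (closedPt x₀) c) * h2)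
        exact ⟨P + Polynomial.C c * Polynomial.X ^ (n + 1), by rw [map_add, hP, sub_add_cancel]⟩
    intro g
    obtain ⟨⟨r, s⟩, hrs⟩ := IsLocalization.surj
      (nonZeroDivisors (C.presheaf.stalk (closedPt x₀))) (toFunctionField _ hgV g)
    obtain ⟨n, hn⟩ := IsDiscreteValuationRing.associated_pow_irreducible
      (nonZeroDivisors.ne_zero s.2) hy
    obtain ⟨u, hu⟩ := hn
    refine key n g (r * u) ?_
    rw [← map_pow, ← hu, map_mul, map_mul, ← mul_assoc, hrs]

end

/-- Projective morphisms are proper. -/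
lemma IsProjectiveOver.isProper {R : Type u} [CommRing R] {X : Scheme.{u}}
    {f : X ⟶ Spec (CommRingCat.of R)} (h : IsProjectiveOver f) : IsProper f := by
  let _ (n : ℕ) : GradedAlgebra (MvPolynomial.homogeneousSubmodule (Fin (n + 1)) R) :=
    MvPolynomial.gradedAlgebra
  obtain ⟨n, j, hj, rfl⟩ := h
  have h0 : Function.Surjective
      (algebraMap R (MvPolynomial.homogeneousSubmodule (Fin (n + 1)) R 0)) := by
    rintro ⟨p, hp⟩
    rw [MvPolynomial.mem_homogeneousSubmodule] at hp
    refine ⟨p.coeff 0, Subtype.ext ?_⟩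
    exact (MvPolynomial.totalDegree_eq_zero_iff_eq_C.1
      ((MvPolynomial.totalDegree_zero_iff_isHomogeneous _).2 hp)).symm
  have h1 : IsClosedImmersion (Spec.map (CommRingCat.ofHom
      (algebraMap R (MvPolynomial.homogeneousSubmodule (Fin (n + 1)) R 0)))) :=
    IsClosedImmersion.spec_of_surjective _ h0
  have h2 : Algebra.FiniteType (MvPolynomial.homogeneousSubmodule (Fin (n + 1)) R 0)
      (MvPolynomial (Fin (n + 1)) R) :=
    by
      have : IsScalarTower R (MvPolynomial.homogeneousSubmodule (Fin (n + 1)) R 0)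
        (MvPolynomial (Fin (n + 1)) R) :=
        ⟨fun a b c => Algebra.smul_mul_assoc a b.1 c⟩
      exact Algebra.FiniteType.of_restrictScalars_finiteType R _ _
  infer_instance

lemma fromSpec_comp {R : Type u} [CommRing R] {C : Scheme.{u}}
    (f : C ⟶ Spec (CommRingCat.of R)) {V : C.Opens} (hV : IsAffineOpen V) :
    hV.fromSpec ≫ f = Spec.map (CommRingCat.ofHom (constMap f V)) := by
  rw [← IsAffineOpen.SpecMap_appLE_fromSpec f (isAffineOpen_top _) hV (le_preimage_top f V),
    constMap, CommRingCat.ofHom_hom, Spec.map_comp]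
  congr 1
  rw [IsAffineOpen.fromSpec_top, Scheme.isoSpec_Spec_inv]

section

variable {k : Type u} [Field k] {C : Scheme.{u}} (f : C ⟶ Spec (CommRingCat.of k))

lemma polyMap_ι {V : C.Opens} (t : Γ(C, V)) (P : Polynomial k) :
    polyMap (V.ι ≫ f) (V.topIso.inv t) P = V.topIso.inv (polyMap f t P) := by
  have h : constMap (V.ι ≫ f) ⊤ = V.topIso.inv.hom.comp (constMap f V) := by
    rw [constMap, constMap, ← CommRingCat.hom_comp, Category.assoc]
    congr 2
    rw [← Scheme.Hom.appLE_comp_appLE V.ι f ⊤ V ⊤ (le_preimage_top f V) (by simp)]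
    congr 1
    simp
    exact congrArg C.presheaf.map (Subsingleton.elim _ _)
  rw [polyMap, polyMap, h]
  exact (Polynomial.hom_eval₂ _ _ V.topIso.inv.hom _).symm

lemma isAffineOpen_of_polyMap_bijective [IsIntegral C] [SmoothOfRelativeDimension 1 f]
    [IsProper f] (V : C.Opens) (hV : genericPoint C ∈ V) (t : Γ(C, V))
    (ht : Function.Bijective (polyMap f t)) : IsAffineOpen V := by
  have : Nonempty V := ⟨⟨_, hV⟩⟩
  have : SmoothOfRelativeDimension 1 (V.ι ≫ f) :=
    inferInstanceAs (SmoothOfRelativeDimension (0 + 1) (V.ι ≫ f))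
  have : IsLocallyNoetherian C := LocallyOfFiniteType.isLocallyNoetherian f
  have : CompactSpace C := QuasiCompact.compactSpace_of_compactSpace f
  have : IsNoetherian C := {}
  have : CompactSpace V := isCompact_iff_compactSpace.1 (NoetherianSpace.isCompact _)
  refine isAffine_of_polyMap_bijective (V.ι ≫ f) (V.topIso.inv t) ?_
  have h : ⇑(polyMap (V.ι ≫ f) (V.topIso.inv t)) = V.topIso.inv ∘ polyMap f t :=
    funext fun P => polyMap_ι f t P
  rw [h]
  exact (ConcreteCategory.bijective_of_isIso V.topIso.inv).comp ht

end

/-- An isomorphism of the complement of a rational point `x₀` of a curve with the affine line, over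
the base field: an affine open `V`, the isomorphism `φ` of its ring of functions with `k[X]`, and an
element `y` of the maximal ideal of the local ring at `x₀` that is inverse to the coordinate. -/
structure LineChart {k : Type u} [Field k] {C : Scheme.{u}} [IsIntegral C]
    (f : C ⟶ Spec (CommRingCat.of k)) (x₀ : Spec (CommRingCat.of k) ⟶ C) where
  V : C.Opens
  isAffineOpen : IsAffineOpen V
  mem_iff (x : C) : x ∈ V ↔ x ≠ closedPt x₀
  genericPoint_mem : genericPoint C ∈ V
  φ : Polynomial k ≃+* Γ(C, V)
  φ_C (c : k) : φ (Polynomial.C c) = constMap f V c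
  y : C.presheaf.stalk (closedPt x₀)
  y_mem : y ∈ IsLocalRing.maximalIdeal (C.presheaf.stalk (closedPt x₀))
  y_mul : algebraMap _ C.functionField y *
    toFunctionField V genericPoint_mem (φ Polynomial.X) = 1

/-- A curve of genus zero with a rational point is the projective line. -/
lemma nonempty_lineChart {k : Type u} [Field k] {C : Scheme.{u}} [IsIntegral C]
    (f : C ⟶ Spec (CommRingCat.of k)) [SmoothOfRelativeDimension 1 f] [IsProper f]
    (hC : HasGenusZero C) (x₀ : Spec (CommRingCat.of k) ⟶ C) (hx₀ : x₀ ≫ f = 𝟙 _) :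
    Nonempty (LineChart f x₀) := by
  obtain ⟨t, y, hy, hyt⟩ := exists_simplePole f x₀ hx₀ hC
  have hb := polyMap_bijective_of_simplePole f x₀ hx₀ t y hy hyt
  have := isDiscreteValuationRing_stalk f _ (closedPt_ne_genericPoint f x₀ hx₀)
  have hX : RingEquiv.ofBijective _ hb Polynomial.X = t := by
    simp [polyMap]
  exact ⟨{
    V := complPt f x₀ hx₀
    isAffineOpen := isAffineOpen_of_polyMap_bijective f _ (genericPoint_mem_complPt f x₀ hx₀) t hb
    mem_iff := fun x => Iff.rfl
    genericPoint_mem := genericPoint_mem_complPt f x₀ hx₀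
    φ := RingEquiv.ofBijective _ hb
    φ_C := fun c => by simp [polyMap]
    y := y
    y_mem := by rw [hy.maximalIdeal_eq]; exact Ideal.mem_span_singleton_self _
    y_mul := by rw [hX]; exact hyt }⟩

namespace LineChart

variable {k : Type u} [Field k] {C : Scheme.{u}} [IsIntegral C]
  {f : C ⟶ Spec (CommRingCat.of k)} {x₀ : Spec (CommRingCat.of k) ⟶ C} (L : LineChart f x₀)
  {R : CommRingCat.{u}}

/-- The `R`-valued point of the curve given by an `R`-valued point of the affine line. -/
def pt (τ : Polynomial k →+* R) : Spec R ⟶ C :=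
  pointOf L.isAffineOpen (τ.comp L.φ.symm.toRingHom)

lemma le_preimage_pt (τ : Polynomial k →+* R) : ⊤ ≤ (L.pt τ) ⁻¹ᵁ L.V :=
  le_preimage_pointOf L.isAffineOpen _

lemma evalAt_pt (τ : Polynomial k →+* R) (P : Polynomial k) :
    evalAt (L.pt τ) L.V (L.le_preimage_pt τ) (L.φ P) = τ P := by
  refine (congrArg (fun z => z (L.φ P))
    (evalAt_pointOf L.isAffineOpen (τ.comp L.φ.symm.toRingHom))).trans ?_
  simp

lemma pt_comp (τ : Polynomial k →+* R) :
    L.pt τ ≫ f = Spec.map (CommRingCat.ofHom (τ.comp Polynomial.C)) := by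
  rw [pt, pointOf, Category.assoc, fromSpec_comp, ← Spec.map_comp, ← CommRingCat.ofHom_comp]
  congr 2
  ext c
  simp [← L.φ_C]

lemma eq_pt (a : Spec R ⟶ C) (h : ⊤ ≤ a ⁻¹ᵁ L.V) :
    a = L.pt ((evalAt a L.V h).comp L.φ.toRingHom) := by
  refine hom_ext_of_evalAt L.isAffineOpen h (L.le_preimage_pt _) (RingHom.ext fun g => ?_)
  obtain ⟨P, rfl⟩ := L.φ.surjective g
  rw [evalAt_pt]
  rfl

lemma pt_apply_mem_basicOpen_iff (τ : Polynomial k →+* R) (r : Polynomial k) (p : Spec R) :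
    L.pt τ p ∈ C.basicOpen (L.φ r) ↔ τ r ∉ p.asIdeal := by
  rw [← L.evalAt_pt]
  exact apply_mem_basicOpen_iff _ (L.le_preimage_pt τ) _ _

lemma le_preimage_basicOpen (τ : Polynomial k →+* R) (r : Polynomial k) (hr : IsUnit (τ r)) :
    ⊤ ≤ (L.pt τ) ⁻¹ᵁ C.basicOpen (L.φ r) := fun p _ =>
  (L.pt_apply_mem_basicOpen_iff τ r p).2
    fun h => p.isPrime.ne_top (Ideal.eq_top_of_isUnit_mem _ h hr)

lemma exists_map_mul_pow_eq {U : C.Opens} {r : Polynomial k} (h : C.basicOpen (L.φ r) ≤ U)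
    (g : Γ(C, U)) : ∃ (n : ℕ) (P : Polynomial k), C.presheaf.map (homOfLE h).op g *
      C.presheaf.map (homOfLE (C.basicOpen_le (L.φ r))).op (L.φ r) ^ n =
        C.presheaf.map (homOfLE (C.basicOpen_le (L.φ r))).op (L.φ P) := by
  have := L.isAffineOpen.isLocalization_basicOpen (L.φ r)
  obtain ⟨n, a, ha⟩ := IsLocalization.Away.surj (L.φ r) (C.presheaf.map (homOfLE h).op g)
  obtain ⟨P, rfl⟩ := L.φ.surjective a
  exact ⟨n, P, ha⟩

lemma evalAt_mul_pow_eq {U : C.Opens} {r : Polynomial k} (h : C.basicOpen (L.φ r) ≤ U)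
    {g : Γ(C, U)} {n : ℕ} {P : Polynomial k} (hP : C.presheaf.map (homOfLE h).op g *
      C.presheaf.map (homOfLE (C.basicOpen_le (L.φ r))).op (L.φ r) ^ n =
        C.presheaf.map (homOfLE (C.basicOpen_le (L.φ r))).op (L.φ P))
    (τ : Polynomial k →+* R) (hr : IsUnit (τ r)) (hU : ⊤ ≤ (L.pt τ) ⁻¹ᵁ U) :
    evalAt (L.pt τ) U hU g * τ r ^ n = τ P := by
  have hle := L.le_preimage_basicOpen τ r hr
  have := congrArg (evalAt (L.pt τ) _ hle) hP
  rw [map_mul, map_pow, evalAt_res, evalAt_res, evalAt_res, evalAt_pt, evalAt_pt] at this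
  exact this

/-- A function that is defined where `r` does not vanish is a fraction `P / r ^ n`. -/
lemma exists_evalAt_mul_pow_eq {U : C.Opens} {r : Polynomial k} (h : C.basicOpen (L.φ r) ≤ U)
    (g : Γ(C, U)) : ∃ (n : ℕ) (P : Polynomial k), ∀ (R : CommRingCat.{u})
      (τ : Polynomial k →+* R) (_ : IsUnit (τ r)) (hU : ⊤ ≤ (L.pt τ) ⁻¹ᵁ U),
      evalAt (L.pt τ) U hU g * τ r ^ n = τ P := by
  obtain ⟨n, P, hP⟩ := L.exists_map_mul_pow_eq h g
  exact ⟨n, P, fun R τ hr hU => L.evalAt_mul_pow_eq h hP τ hr hU⟩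

/-- A function that is defined at the point at infinity and where `r` does not vanish is the
sum of its value at infinity and a fraction `P / r ^ n` with `deg P < n * deg r`. -/
lemma exists_evalAt_sub_mul_pow_eq {U : C.Opens} {r : Polynomial k} (hr0 : r ≠ 0)
    (h : C.basicOpen (L.φ r) ≤ U) (h₀ : ⊤ ≤ x₀ ⁻¹ᵁ U) (hx₀ : x₀ ≫ f = 𝟙 _) (g : Γ(C, U)) :
    ∃ (n : ℕ) (P : Polynomial k), (P = 0 ∨ P.natDegree < n * r.natDegree) ∧
      ∀ (R : CommRingCat.{u}) (τ : Polynomial k →+* R) (_ : IsUnit (τ r))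
        (hU : ⊤ ≤ (L.pt τ) ⁻¹ᵁ U),
        (evalAt (L.pt τ) U hU g - τ (Polynomial.C (evalAt x₀ U h₀ g))) * τ r ^ n = τ P := by
  set c : k := evalAt x₀ U h₀ g with hc
  obtain ⟨n, P, hP⟩ := L.exists_map_mul_pow_eq h (g - constMap f U c)
  refine ⟨n, P, or_iff_not_imp_left.2 fun hP0 => ?_, fun R τ hr hU => ?_⟩
  · have hg : genericPoint C ∈ C.basicOpen (L.φ r) :=
      genericPoint_mem_basicOpen _ ((map_ne_zero_iff _ L.φ.injective).2 hr0)
    have hxU := closedPt_mem_of_le_preimage x₀ h₀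
    have h1 (Q : Polynomial k) : toFunctionField L.V L.genericPoint_mem (L.φ Q) =
        Q.eval₂ ((algebraMap _ C.functionField).comp (stalkConst f (closedPt x₀)))
          (toFunctionField L.V L.genericPoint_mem (L.φ Polynomial.X)) := by
      rw [← toFunctionField_polyMap]
      congr 1
      have : L.φ.toRingHom = polyMap f (L.φ Polynomial.X) := by
        ext c
        · simp [polyMap, L.φ_C]
        · simp [polyMap]
      exact congrArg (fun z => z Q) this
    have hK := congrArg (toFunctionField _ hg) hP
    rw [map_mul, map_pow, toFunctionField_map, toFunctionField_map, toFunctionField_map, h1 r, h1 P,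
      ← algebraMap_germ hxU] at hK
    have : IsDomain (C.presheaf.stalk (closedPt x₀)) := inferInstance
    have : FaithfulSMul (C.presheaf.stalk (closedPt x₀)) C.functionField :=
      (faithfulSMul_iff_algebraMap_injective _ _).2 (IsFractionRing.injective _ _)
    refine Polynomial.natDegree_lt_of_eval₂ (stalkConst f (closedPt x₀)) L.y_mem L.y_mul hP0 hr0
      ?_ hK
    rw [IsLocalRing.mem_maximalIdeal, mem_nonunits_iff, ← Scheme.mem_basicOpen C _ _ hxU,
      closedPt_mem_basicOpen_iff x₀ h₀, not_not, map_sub, evalAt_constMap_self f x₀ hx₀, ← hc,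
      sub_self]
  · have := L.evalAt_mul_pow_eq h hP τ hr hU
    rw [map_sub, evalAt_constMap f (L.pt τ) _ (L.pt_comp τ)] at this
    exact this

end LineChart

end AlgebraicGeometry

/-! ### Extension of rational points to integral points -/

section

variable {O : Type*} [CommRing O] [IsDomain O] (K : Type*) [Field K] [Algebra O K]
  [IsFractionRing O K]

/-- The local ring of a domain at a prime `p`, as a subring of the field of fractions. -/
def localSubring (p : Ideal O) [p.IsPrime] : Subalgebra O K :=
  Localization.subalgebra.ofField K p.primeCompl p.primeCompl_le_nonZeroDivisors

variable {K}

lemma mem_localSubring_iff {p : Ideal O} [p.IsPrime] {x : K} :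
    x ∈ localSubring K p ↔ ∃ a s : O, s ∉ p ∧ algebraMap O K s * x = algebraMap O K a := by
  change (∃ (a s : O) (_ : s ∈ p.primeCompl), x = algebraMap O K a * (algebraMap O K s)⁻¹) ↔ _
  refine exists₂_congr fun a s => ⟨fun ⟨hs, h⟩ => ⟨hs, ?_⟩, fun ⟨hs, h⟩ => ⟨hs, ?_⟩⟩
  all_goals
    have hs0 : algebraMap O K s ≠ 0 := by
      rw [Ne, FaithfulSMul.algebraMap_eq_zero_iff]
      rintro rfl
      exact hs p.zero_mem
  · rw [h]; field_simp
  · rw [← h]; field_simp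

lemma inv_mem_localSubring {p : Ideal O} [p.IsPrime] {a : O} (ha : a ∉ p) :
    (algebraMap O K a)⁻¹ ∈ localSubring K p := by
  refine mem_localSubring_iff.2 ⟨1, a, ha, ?_⟩
  rw [map_one, mul_inv_cancel₀]
  rw [Ne, FaithfulSMul.algebraMap_eq_zero_iff]
  rintro rfl
  exact ha p.zero_mem

/-- If a homomorphism to the field of fractions of `O` from a finitely generated `O`-algebra takes
values in the local ring at `p`, then it takes values in `O[1/h]` for some `h` outside `p`. -/
lemma exists_away_lift {p : Ideal O} [p.IsPrime] {A : Type*} [CommRing A] {c : O →+* A}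
    (hc : c.FiniteType) {ρ : A →+* K} (hρc : ρ.comp c = algebraMap O K)
    (hρ : ∀ a, ρ a ∈ localSubring K p) :
    ∃ (h : O) (_ : h ∉ p) (ρ' : A →+* Localization.Away h)
      (j : Localization.Away h →+* K), j.comp (algebraMap O _) = algebraMap O K ∧
        ρ'.comp c = algebraMap O _ ∧ j.comp ρ' = ρ := by
  classical
  algebraize [c]
  obtain ⟨T, hT⟩ := ‹Algebra.FiniteType O A›.out
  choose num den hden hnum using fun a => mem_localSubring_iff.1 (hρ a)
  let h : O := ∏ a ∈ T, den a
  have hp : h ∉ p := fun hh => by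
    obtain ⟨a, _, ha⟩ := (Ideal.IsPrime.prod_mem_iff (s := T) (x := den)).1 hh
    exact hden a ha
  have hh0 : h ≠ 0 := fun h0 => hp (h0 ▸ p.zero_mem)
  have hle : Submonoid.powers h ≤ nonZeroDivisors O :=
    powers_le_nonZeroDivisors_of_noZeroDivisors hh0
  have hunit : IsUnit (algebraMap O K h) :=
    (IsUnit.mk0 _ ((FaithfulSMul.algebraMap_eq_zero_iff O K).not.2 hh0))
  let j : Localization.Away h →+* K := IsLocalization.Away.lift h hunit
  have hj : j.comp (algebraMap O _) = algebraMap O K := IsLocalization.Away.lift_comp h hunit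
  have hj' (o : O) : j (algebraMap O _ o) = algebraMap O K o := congrArg (fun z => z o) hj
  have hjinj : Function.Injective j := by
    have : Function.Injective (IsLocalization.lift (M := Submonoid.powers h)
        (S := Localization.Away h) (g := algebraMap O K) _) :=
      (IsLocalization.lift_injective_iff (S := Localization.Away h) (fun y =>
        IsUnit.mk0 _ ((FaithfulSMul.algebraMap_eq_zero_iff O K).not.2
          (nonZeroDivisors.ne_zero (hle y.2))))).2 fun x y => by
        rw [(IsLocalization.injective (Localization.Away h) hle).eq_iff,
          (FaithfulSMul.algebraMap_injective O K).eq_iff]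
    exact this
  have hrange (a : A) : ρ a ∈ j.range := by
    have ha : a ∈ Algebra.adjoin O (T : Set A) := by rw [hT]; trivial
    induction ha using Algebra.adjoin_induction with
    | mem a ha =>
      have hd : IsUnit (algebraMap O (Localization.Away h) (den a)) :=
        isUnit_of_dvd_unit (map_dvd _ (Finset.dvd_prod_of_mem den ha))
          (IsLocalization.Away.algebraMap_isUnit h)
      obtain ⟨e, he⟩ := hd.exists_right_inv
      refine ⟨algebraMap O _ (num a) * e, ?_⟩
      rw [map_mul, hj', ← hnum a]
      have := congrArg j he
      rw [map_mul, hj', map_one] at this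
      linear_combination ρ a * this
    | algebraMap o =>
      exact ⟨algebraMap O _ o, (hj' o).trans (congrArg (fun z => z o) hρc).symm⟩
    | add a b _ _ ha hb => rw [map_add]; exact add_mem ha hb
    | mul a b _ _ ha hb => rw [map_mul]; exact mul_mem ha hb
  let e : Localization.Away h ≃+* j.range :=
    RingEquiv.ofBijective j.rangeRestrict ⟨fun a b hab => hjinj (congrArg Subtype.val hab),
      j.rangeRestrict_surjective⟩
  have hje (x : j.range) : j (e.symm x) = x := congrArg Subtype.val (e.apply_symm_apply x)
  have hcomp : j.comp (e.symm.toRingHom.comp (ρ.codRestrict j.range hrange)) = ρ :=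
    RingHom.ext fun a => hje ⟨ρ a, hrange a⟩
  refine ⟨h, hp, e.symm.toRingHom.comp (ρ.codRestrict j.range hrange), j, hj, ?_, hcomp⟩
  refine RingHom.ext fun o => hjinj ?_
  refine (congrArg (fun z => z (c o)) hcomp).trans ?_
  exact (congrArg (fun z => z o) hρc).trans (hj' o).symm

end

namespace AlgebraicGeometry

lemma evalAt_base {O R : CommRingCat.{u}} {X : Scheme.{u}} (g : X ⟶ Spec O) (a : Spec R ⟶ X)
    (φ : O ⟶ R) (ha : a ≫ g = Spec.map φ) (U : X.Opens) (h : ⊤ ≤ a ⁻¹ᵁ U) :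
    (evalAt a U h).comp (constMap g U) = φ.hom :=
  RingHom.ext fun c => evalAt_constMap g a φ ha U h c

lemma pointOf_comp {O : Type u} [CommRing O] {R : CommRingCat.{u}} {X : Scheme.{u}}
    (g : X ⟶ Spec (CommRingCat.of O)) {U : X.Opens}
    (hU : IsAffineOpen U) (ρ : Γ(X, U) →+* R) :
    pointOf hU ρ ≫ g = Spec.map (CommRingCat.ofHom (ρ.comp (constMap g U))) := by
  rw [pointOf, Category.assoc, fromSpec_comp g hU, ← Spec.map_comp, ← CommRingCat.ofHom_comp]

/-- Morphisms on the members of an open cover glue if they agree on a dense set. -/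
lemma exists_glue {X Y S T : Scheme.{u}} [IsReduced X] (𝒰 : X.OpenCover) (g : Y ⟶ S)
    [IsSeparated g] (t : T ⟶ X) [IsDominant t] (π : X ⟶ S) (y : T ⟶ Y)
    (e : ∀ i, T ⟶ 𝒰.X i) (he : ∀ i, e i ≫ 𝒰.f i = t) (a : ∀ i, 𝒰.X i ⟶ Y)
    (ha : ∀ i, e i ≫ a i = y) (hg : ∀ i, a i ≫ g = 𝒰.f i ≫ π) :
    ∃ s : X ⟶ Y, ∀ i, 𝒰.f i ≫ s = a i := by
  refine ⟨𝒰.glueMorphisms a fun i j => ?_, fun i => 𝒰.ι_glueMorphisms a _ i⟩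
  let l : T ⟶ pullback (𝒰.f i) (𝒰.f j) := pullback.lift (e i) (e j) (by rw [he, he])
  have hl : IsDominant l := by
    have : IsDominant (l ≫ pullback.fst (𝒰.f i) (𝒰.f j) ≫ 𝒰.f i) := by
      rw [pullback.lift_fst_assoc, he]
      infer_instance
    exact IsDominant.of_comp_of_isOpenImmersion l (pullback.fst (𝒰.f i) (𝒰.f j) ≫ 𝒰.f i)
  have : IsReduced (pullback (𝒰.f i) (𝒰.f j)) :=
    isReduced_of_isOpenImmersion (pullback.fst (𝒰.f i) (𝒰.f j) ≫ 𝒰.f i)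
  refine ext_of_isDominant_of_isSeparated g ?_ l ?_
  · rw [Category.assoc, Category.assoc, hg, hg, pullback.condition_assoc]
  · rw [pullback.lift_fst_assoc, pullback.lift_snd_assoc, ha, ha]

/-- A rational point extends to an integral point if it is integral at each prime, on an affine
chart which may depend on the prime. -/
lemma exists_section_of_forall_prime {O K : Type u} [CommRing O] [IsDomain O] [Field K]
    [Algebra O K] [IsFractionRing O K] {X : Scheme.{u}} (g : X ⟶ Spec (CommRingCat.of O))
    [IsSeparated g] [LocallyOfFiniteType g] (W : X.Opens) (y : Spec (CommRingCat.of K) ⟶ X)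
    (hy : y ≫ g = Spec.map (CommRingCat.ofHom (algebraMap O K)))
    (H : ∀ (p : Ideal O) [p.IsPrime], ∃ (U : X.Opens) (_ : IsAffineOpen U) (_ : U ≤ W)
      (h : ⊤ ≤ y ⁻¹ᵁ U), ∀ s : Γ(X, U), evalAt y U h s ∈ localSubring K p) :
    ∃ s : Spec (CommRingCat.of O) ⟶ X, s ≫ g = 𝟙 _ ∧ (∀ p, s p ∈ W) ∧
      Spec.map (CommRingCat.ofHom (algebraMap O K)) ≫ s = y := by
  have H' (p : PrimeSpectrum O) : ∃ (h : O) (_ : h ∉ p.asIdeal)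
      (a : Spec (CommRingCat.of (Localization.Away h)) ⟶ X) (j : Localization.Away h →+* K),
      j.comp (algebraMap O _) = algebraMap O K ∧
      a ≫ g = Spec.map (CommRingCat.ofHom (algebraMap O _)) ∧
      (∀ q, a q ∈ W) ∧ Spec.map (CommRingCat.ofHom j) ≫ a = y := by
    obtain ⟨U, hU, hUW, h, hs⟩ := H p.asIdeal
    have hc : (constMap g U).FiniteType := by
      have h1 := LocallyOfFiniteType.finiteType_appLE g (isAffineOpen_top _) hU (le_preimage_top g U)
      exact RingHom.FiniteType.comp h1 (RingHom.FiniteType.of_surjective _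
        (ConcreteCategory.bijective_of_isIso (Scheme.ΓSpecIso (CommRingCat.of O)).inv).2)
    obtain ⟨b, hb, ρ', j, hj, hρ', hjρ⟩ :=
      exists_away_lift (p := p.asIdeal) hc (evalAt_base g y _ hy U h) hs
    refine ⟨b, hb, pointOf (R := CommRingCat.of (Localization.Away b)) hU ρ', j, hj, ?_,
      fun q => hUW (le_preimage_pointOf hU _ (Set.mem_univ q)), ?_⟩
    · rw [pointOf_comp, hρ']
    · rw [pointOf, ← Category.assoc, ← Spec.map_comp, ← CommRingCat.ofHom_comp, hjρ]
      exact (eq_SpecMap_evalAt y hU h).symm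
  choose b hb a j hj hag haW haj using H'
  have hspan : Ideal.span (Set.range b) = ⊤ := by
    by_contra hne
    obtain ⟨m, hm, hle⟩ := Ideal.exists_le_maximal _ hne
    exact hb ⟨m, hm.isPrime⟩ (hle (Ideal.subset_span ⟨_, rfl⟩))
  let 𝒰 := (Scheme.affineOpenCoverOfSpanRangeEqTop (R := CommRingCat.of O) b hspan).openCover
  have hdom : IsDominant (Spec.map (CommRingCat.ofHom (algebraMap O K))) := by
    refine ⟨(PrimeSpectrum.denseRange_comap_iff_ker_le_nilRadical _).2 ?_⟩
    exact ((RingHom.injective_iff_ker_eq_bot _).1 (FaithfulSMul.algebraMap_injective O K)).le.trans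
      bot_le
  have he (p : PrimeSpectrum O) : Spec.map (CommRingCat.ofHom (j p)) ≫
      Spec.map (CommRingCat.ofHom (algebraMap O (Localization.Away (b p)))) =
        Spec.map (CommRingCat.ofHom (algebraMap O K)) := by
    rw [← Spec.map_comp, ← CommRingCat.ofHom_comp, hj]
  obtain ⟨s, hs⟩ := exists_glue 𝒰 g (Spec.map (CommRingCat.ofHom (algebraMap O K)))
    (𝟙 _) y (fun p => Spec.map (CommRingCat.ofHom (j p))) he a haj
    (fun p => (hag p).trans (Category.comp_id _).symm)
  refine ⟨s, ?_, fun p => ?_, ?_⟩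
  · refine 𝒰.hom_ext _ _ fun p => ?_
    rw [← Category.assoc, hs]
    exact (hag p).trans (Category.comp_id _).symm
  · obtain ⟨q, hq⟩ := 𝒰.covers p
    rw [← hq, ← Scheme.Hom.comp_apply, hs]
    exact haW _ _
  · let p : PrimeSpectrum O := ⊥
    rw [← he p, Category.assoc]
    exact (congrArg (_ ≫ ·) (hs p)).trans (haj p)

end AlgebraicGeometry

section

variable {O : Type*} [CommRing O] [IsDomain O] {K : Type*} [Field K] [Algebra O K]
  [IsFractionRing O K]

variable (O) in
/-- `N` is a common denominator of the coefficients of the polynomial `P`. -/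
def ClearsDenominators (N : O) (P : Polynomial K) : Prop :=
  ∀ i, ∃ c : O, algebraMap O K c = algebraMap O K N * P.coeff i

omit [IsDomain O] [IsFractionRing O K] in
lemma ClearsDenominators.of_dvd {N N' : O} {P : Polynomial K} (h : ClearsDenominators O N P)
    (hN : N ∣ N') : ClearsDenominators O N' P := fun i => by
  obtain ⟨c, hc⟩ := h i
  obtain ⟨d, rfl⟩ := hN
  exact ⟨d * c, by rw [map_mul, map_mul, hc]; ring⟩

lemma exists_clearsDenominators (P : Polynomial K) : ∃ N : O, N ≠ 0 ∧ ClearsDenominators O N P := by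
  classical
  obtain ⟨N, hN⟩ := IsLocalization.exist_integer_multiples_of_finset (nonZeroDivisors O)
    (P.support.image P.coeff)
  refine ⟨N, nonZeroDivisors.ne_zero N.2, fun i => ?_⟩
  by_cases hi : P.coeff i = 0
  · exact ⟨0, by rw [hi, map_zero, mul_zero]⟩
  · obtain ⟨c, hc⟩ := hN (P.coeff i) (Finset.mem_image_of_mem _ (Polynomial.mem_support_iff.2 hi))
    exact ⟨c, hc.trans (Algebra.smul_def _ _)⟩

omit [Algebra O K] [IsFractionRing O K] in
/-- Finitely many nonzero elements of a domain have a nonzero common multiple. -/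
lemma exists_common_multiple {ι : Type*} (T : Finset ι) (N : ι → O) (hN : ∀ i ∈ T, N i ≠ 0) :
    ∃ M : O, M ≠ 0 ∧ ∀ i ∈ T, N i ∣ M :=
  ⟨∏ i ∈ T, N i, Finset.prod_ne_zero_iff.2 hN, fun _ hi => Finset.dvd_prod_of_mem _ hi⟩

lemma eval_mem_localSubring {p : Ideal O} [p.IsPrime] {N : O} {P : Polynomial K}
    (h : ClearsDenominators O N P) (hN : N ∉ p) {τ : K} (hτ : τ ∈ localSubring K p) :
    P.eval τ ∈ localSubring K p := by
  rw [Polynomial.eval_eq_sum_range]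
  refine sum_mem fun i _ => mul_mem ?_ (pow_mem hτ i)
  obtain ⟨c, hc⟩ := h i
  exact mem_localSubring_iff.2 ⟨c, N, hN, hc.symm⟩

omit [IsDomain O] in
lemma algebraMap_ne_zero_of_ne_zero {b : O} (hb : b ≠ 0) : algebraMap O K b ≠ 0 :=
  (FaithfulSMul.algebraMap_eq_zero_iff O K).not.2 hb

omit [IsDomain O] in
/-- The homogenization of a monic polynomial of degree `e` at `(a, b)` is `a ^ e` modulo a prime
that contains `b`, if `b` is sufficiently divisible. -/
lemma exists_homogenization_of_monic {p : Ideal O} [p.IsPrime] {N : O} {r : Polynomial K}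
    (h : ClearsDenominators O N r) (hr : r.Monic) {a b : O} (hb : b ≠ 0) (hbp : b ∈ p)
    (hN : N ^ 2 ∣ b) : ∃ ρ : O, ρ - a ^ r.natDegree ∈ p ∧
      algebraMap O K ρ = algebraMap O K b ^ r.natDegree *
        r.eval (algebraMap O K a / algebraMap O K b) := by
  obtain ⟨b', rfl⟩ := hN
  have hNb : N * b' ∈ p := by
    rcases ‹p.IsPrime›.mem_or_mem hbp with h | h
    · exact Ideal.mul_mem_right _ _ (‹p.IsPrime›.mem_of_pow_mem _ h)
    · exact Ideal.mul_mem_left _ _ h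
  choose c hc using h
  generalize he : r.natDegree = e
  have hb0 := algebraMap_ne_zero_of_ne_zero (K := K) hb
  refine ⟨a ^ e + ∑ i ∈ Finset.range e,
    c i * a ^ i * (N * b') * (N ^ 2 * b') ^ (e - i - 1), ?_, ?_⟩
  · rw [add_sub_cancel_left]
    exact Ideal.sum_mem _ fun i _ => Ideal.mul_mem_right _ _ (Ideal.mul_mem_left _ _ hNb)
  · rw [Polynomial.eval_eq_sum_range, he, Finset.sum_range_succ, mul_add, add_comm, map_add, map_pow]
    congr 1
    · rw [map_sum, Finset.mul_sum]
      refine Finset.sum_congr rfl fun i hi => ?_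
      have hi : i < e := Finset.mem_range.1 hi
      obtain ⟨l, rfl⟩ : ∃ l, e = i + (l + 1) := ⟨e - i - 1, by omega⟩
      have : i + (l + 1) - i - 1 = l := by omega
      rw [this, map_mul, map_mul, map_mul, hc, div_pow, map_pow, map_pow]
      field_simp
      rw [map_mul, map_mul, map_pow]
      ring
    · rw [← he, hr.coeff_natDegree, one_mul, div_pow]
      field_simp

omit [IsDomain O] in
lemma exists_homogenization_of_lt {N : O} {P : Polynomial K} (h : ClearsDenominators O N P)
    {a b : O} (hb : b ≠ 0) (hN : N ∣ b) {m : ℕ} (hm : P.natDegree < m) :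
    ∃ ρ : O, algebraMap O K ρ = algebraMap O K b ^ m *
        P.eval (algebraMap O K a / algebraMap O K b) := by
  have hb0 := algebraMap_ne_zero_of_ne_zero (K := K) hb
  obtain ⟨b', rfl⟩ := hN
  choose c hc using h
  refine ⟨∑ i ∈ Finset.range (P.natDegree + 1), c i * a ^ i * b' * (N * b') ^ (m - i - 1), ?_⟩
  rw [Polynomial.eval_eq_sum_range, map_sum, Finset.mul_sum]
  refine Finset.sum_congr rfl fun i hi => ?_
  have hi : i < P.natDegree + 1 := Finset.mem_range.1 hi
  obtain ⟨l, rfl⟩ : ∃ l, m = i + (l + 1) := ⟨m - i - 1, by omega⟩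
  have : i + (l + 1) - i - 1 = l := by omega
  rw [this, map_mul, map_mul, map_mul, hc, div_pow, map_pow, map_pow]
  field_simp
  rw [map_mul]
  ring

end

namespace AlgebraicGeometry

section

variable {O k : Type u} [CommRing O] [IsDomain O] [Field k] [Algebra O k] [IsFractionRing O k]
  {M C : Scheme.{u}} (g : M ⟶ Spec (CommRingCat.of O))

omit [IsDomain O] [IsFractionRing O k] in
/-- It suffices to test the integrality of a point on finitely many functions. -/
lemma exists_finset_evalAt_mem [LocallyOfFiniteType g] {U : M.Opens} (hU : IsAffineOpen U) :
    ∃ T : Finset Γ(M, U), ∀ (y : Spec (CommRingCat.of k) ⟶ M)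
      (_ : y ≫ g = Spec.map (CommRingCat.ofHom (algebraMap O k))) (h : ⊤ ≤ y ⁻¹ᵁ U)
      (B : Subalgebra O k), (∀ t ∈ T, evalAt y U h t ∈ B) → ∀ s, evalAt y U h s ∈ B := by
  have hc : (constMap g U).FiniteType := by
    have h1 := LocallyOfFiniteType.finiteType_appLE g (isAffineOpen_top _) hU (le_preimage_top g U)
    exact RingHom.FiniteType.comp h1 (RingHom.FiniteType.of_surjective _
      (ConcreteCategory.bijective_of_isIso (Scheme.ΓSpecIso (CommRingCat.of O)).inv).2)
  let _ := (constMap g U).toAlgebra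
  obtain ⟨T, hT⟩ := Algebra.FiniteType.out (self := hc)
  refine ⟨T, fun y hy h B hB s => ?_⟩
  have hs : s ∈ Algebra.adjoin O (T : Set Γ(M, U)) := by rw [hT]; trivial
  induction hs using Algebra.adjoin_induction with
  | mem t ht => exact hB t ht
  | algebraMap o =>
    have : evalAt y U h (constMap g U o) = algebraMap O k o :=
      evalAt_constMap g y (CommRingCat.ofHom (algebraMap O k)) hy U h o
    exact this ▸ B.algebraMap_mem o
  | add a b _ _ ha hb => rw [map_add]; exact add_mem ha hb
  | mul a b _ _ ha hb => rw [map_mul]; exact mul_mem ha hb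

/-- An integral point is integral, at each prime, on each chart that contains its reduction. -/
lemma evalAt_mem_localSubring {s : Spec (CommRingCat.of O) ⟶ M} {U : M.Opens}
    {p : PrimeSpectrum O} (hp : s p ∈ U)
    (h : ⊤ ≤ (Spec.map (CommRingCat.ofHom (algebraMap O k)) ≫ s) ⁻¹ᵁ U) (t : Γ(M, U)) :
    evalAt (Spec.map (CommRingCat.ofHom (algebraMap O k)) ≫ s) U h t ∈
      localSubring k p.asIdeal := by
  let B := localSubring k p.asIdeal
  have h1 : ⊤ ≤ (Spec.map (CommRingCat.ofHom (algebraMap O B)) ≫ s) ⁻¹ᵁ U := by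
    intro P _
    have h2 : (Spec.map (CommRingCat.ofHom (algebraMap O B)) P) ⤳ (p : Spec (CommRingCat.of O)) := by
      refine (PrimeSpectrum.le_iff_specializes _ _).1 fun a ha => ?_
      by_contra hap
      have hu : IsUnit (algebraMap O B a) := by
        refine IsUnit.of_mul_eq_one ⟨(algebraMap O k a)⁻¹, inv_mem_localSubring hap⟩
          (Subtype.ext ?_)
        exact mul_inv_cancel₀ (algebraMap_ne_zero_of_ne_zero
          fun h0 => hap (h0 ▸ Ideal.zero_mem _))
      exact P.isPrime.ne_top (Ideal.eq_top_of_isUnit_mem _ ha hu)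
    exact (h2.map s.continuous).mem_open U.isOpen hp
  have h3 : Spec.map (CommRingCat.ofHom (algebraMap O k)) ≫ s =
      Spec.map (CommRingCat.ofHom (algebraMap B k)) ≫
        Spec.map (CommRingCat.ofHom (algebraMap O B)) ≫ s := by
    rw [← Category.assoc, ← Spec.map_comp, ← CommRingCat.ofHom_comp, ← IsScalarTower.algebraMap_eq]
  have h4 := evalAt_SpecMap_comp _ U h1 (CommRingCat.ofHom (algebraMap B k))
  have h5 := congrArg (fun z => z t) (evalAt_congr h3 U h)
  rw [h5, h4]
  exact (evalAt _ U h1 t : B).2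

section

variable {f : C ⟶ Spec (CommRingCat.of k)} [IsIntegral C] {x₀ : Spec (CommRingCat.of k) ⟶ C}
  (L : LineChart f x₀) {g} {ι : C ⟶ M}

namespace LineChart

/-- The rational point of the curve with coordinate `τ`. -/
def ratPt (τ : k) : Spec (CommRingCat.of k) ⟶ C :=
  L.pt (R := CommRingCat.of k) (Polynomial.evalRingHom τ)

omit [CommRing O] [IsDomain O] [Algebra O k] [IsFractionRing O k] in
lemma ratPt_comp_self (τ : k) : L.ratPt τ ≫ f = 𝟙 _ := by
  rw [ratPt, pt_comp, ← Spec.map_id]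
  congr 1
  ext c
  simp

omit [IsDomain O] [IsFractionRing O k] in
lemma ratPt_comp
    (hι : IsPullback ι f g (Spec.map (CommRingCat.ofHom (algebraMap O k)))) (τ : k) :
    (L.ratPt τ ≫ ι) ≫ g = Spec.map (CommRingCat.ofHom (algebraMap O k)) := by
  rw [Category.assoc, hι.w, ← Category.assoc, ratPt_comp_self, Category.id_comp]

omit [CommRing O] [IsDomain O] [Algebra O k] [IsFractionRing O k] in
lemma le_preimage_ratPt_comp {r : Polynomial k} {τ : k} (hr : r.eval τ ≠ 0) {U : M.Opens}
    (h : C.basicOpen (L.φ r) ≤ ι ⁻¹ᵁ U) : ⊤ ≤ (L.ratPt τ ≫ ι) ⁻¹ᵁ U := fun _ hp =>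
  h (L.le_preimage_basicOpen (R := CommRingCat.of k) (Polynomial.evalRingHom τ) r
    (IsUnit.mk0 _ hr) hp)

/-- At a prime `p` outside finitely many, a rational point whose coordinate `τ` is integral at `p`
is integral on a given affine chart which contains the points where `r` does not vanish, as soon as
`r(τ)` is a unit at `p`. -/
lemma exists_forall_mem_of_unit [LocallyOfFiniteType g]
    (hι : IsPullback ι f g (Spec.map (CommRingCat.ofHom (algebraMap O k)))) {U : M.Opens}
    (hU : IsAffineOpen U) {r : Polynomial k} (hr : C.basicOpen (L.φ r) ≤ ι ⁻¹ᵁ U) :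
    ∃ N : O, N ≠ 0 ∧ ∀ (p : Ideal O) [p.IsPrime] (τ : k), N ∉ p → τ ∈ localSubring k p →
      r.eval τ ≠ 0 → (r.eval τ)⁻¹ ∈ localSubring k p →
      ∃ h : ⊤ ≤ (L.ratPt τ ≫ ι) ⁻¹ᵁ U, ∀ s, evalAt (L.ratPt τ ≫ ι) U h s ∈ localSubring k p := by
  obtain ⟨T, hT⟩ := exists_finset_evalAt_mem (k := k) g hU
  choose n P hP using fun t => L.exists_evalAt_mul_pow_eq hr (ι.app U t)
  choose D hD0 hD using fun t => exists_clearsDenominators (O := O) (P t)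
  obtain ⟨N, hN0, hN⟩ := exists_common_multiple T D fun t _ => hD0 t
  refine ⟨N, hN0, fun p _ τ hNp hτ hrτ hrτ' => ?_⟩
  have h := L.le_preimage_ratPt_comp (ι := ι) hrτ hr
  refine ⟨h, hT _ (L.ratPt_comp hι τ) h _ fun t ht => ?_⟩
  have h1 := hP t (CommRingCat.of k) (Polynomial.evalRingHom τ) (IsUnit.mk0 _ hrτ) h
  have h2 : evalAt (L.ratPt τ ≫ ι) U h t * (r.eval τ) ^ n t = (P t).eval τ := by
    rw [evalAt_comp]; exact h1
  have h3 : evalAt (L.ratPt τ ≫ ι) U h t = (P t).eval τ * (r.eval τ)⁻¹ ^ n t := by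
    rw [← h2, mul_assoc, ← mul_pow, mul_inv_cancel₀ hrτ, one_pow, mul_one]
  rw [h3]
  exact mul_mem (eval_mem_localSubring ((hD t).of_dvd (hN t ht)) hNp hτ) (pow_mem hrτ' _)

/-- At a prime `p` where a rational point reduces to the point at infinity, it is integral on the
charts that contain the reduction of the integral point `s` at infinity. Here the rational point is
assumed to be so close to infinity that `p`-adic denominators do not matter. -/
lemma exists_forall_mem_of_infinity [LocallyOfFiniteType g]
    (hι : IsPullback ι f g (Spec.map (CommRingCat.ofHom (algebraMap O k))))
    (hx₀ : x₀ ≫ f = 𝟙 _) {s : Spec (CommRingCat.of O) ⟶ M}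
    (hs : x₀ ≫ ι = Spec.map (CommRingCat.ofHom (algebraMap O k)) ≫ s) {U : M.Opens}
    (hU : IsAffineOpen U) (h₀ : closedPt x₀ ∈ ι ⁻¹ᵁ U) :
    ∃ N : O, N ≠ 0 ∧ ∀ (p : PrimeSpectrum O) (a b : O), s p ∈ U → b ≠ 0 → b ∈ p.asIdeal →
      a ∉ p.asIdeal → N ∣ b →
      ∃ h : ⊤ ≤ (L.ratPt (algebraMap O k a / algebraMap O k b) ≫ ι) ⁻¹ᵁ U,
        ∀ t, evalAt _ U h t ∈ localSubring k p.asIdeal := by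
  obtain ⟨r, hrm, hr⟩ : ∃ r : Polynomial k, r.Monic ∧ C.basicOpen (L.φ r) ≤ ι ⁻¹ᵁ U := by
    obtain ⟨r, hr, hxr⟩ := L.isAffineOpen.exists_basicOpen_le (V := ι ⁻¹ᵁ U)
      ⟨genericPoint C, genericPoint_mem_of_mem h₀⟩ L.genericPoint_mem
    obtain ⟨r, rfl⟩ := L.φ.surjective r
    have hr0 : r ≠ 0 := by
      rintro rfl
      rw [map_zero, Scheme.basicOpen_zero] at hxr
      exact hxr
    refine ⟨r * Polynomial.C r.leadingCoeff⁻¹, Polynomial.monic_mul_leadingCoeff_inv hr0, ?_⟩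
    rw [map_mul, Scheme.basicOpen_mul]
    exact inf_le_left.trans hr
  obtain ⟨T, hT⟩ := exists_finset_evalAt_mem (k := k) g hU
  have h₀' := le_preimage_of_closedPt_mem x₀ h₀
  choose n P hPn hP using fun t =>
    L.exists_evalAt_sub_mul_pow_eq hrm.ne_zero hr h₀' hx₀ (ι.app U t)
  choose D hD0 hD using fun t => exists_clearsDenominators (O := O) (P t)
  obtain ⟨N₁, hN₁, hN₁'⟩ := exists_common_multiple T D fun t _ => hD0 t
  obtain ⟨N₂, hN₂, hN₂'⟩ := exists_clearsDenominators (O := O) r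
  refine ⟨N₁ * N₂ ^ 2, mul_ne_zero hN₁ (pow_ne_zero 2 hN₂), fun p a b hp hb hbp hap hN => ?_⟩
  have hb0 := algebraMap_ne_zero_of_ne_zero (K := k) hb
  obtain ⟨ρ, hρ, hρr⟩ := exists_homogenization_of_monic hN₂' hrm (a := a) hb hbp
    ((dvd_mul_left _ _).trans hN)
  set τ := algebraMap O k a / algebraMap O k b
  have hρp : ρ ∉ p.asIdeal := fun h =>
    hap (p.isPrime.mem_of_pow_mem r.natDegree (by simpa using Ideal.sub_mem _ h hρ))
  have hρ0 : algebraMap O k ρ ≠ 0 :=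
    algebraMap_ne_zero_of_ne_zero fun h => hρp (h ▸ Ideal.zero_mem _)
  have hrτ : r.eval τ ≠ 0 := fun h => hρ0 (by rw [hρr, h, mul_zero])
  have h := L.le_preimage_ratPt_comp (ι := ι) hrτ hr
  refine ⟨h, hT _ (L.ratPt_comp hι τ) h _ fun t ht => ?_⟩
  have h1 := hP t (CommRingCat.of k) (Polynomial.evalRingHom τ) (IsUnit.mk0 _ hrτ) h
  have h₀'' : ⊤ ≤ (Spec.map (CommRingCat.ofHom (algebraMap O k)) ≫ s) ⁻¹ᵁ U := hs ▸ h₀'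
  have h2 : evalAt x₀ _ h₀' (ι.app U t) ∈ localSubring k p.asIdeal := by
    have h3 := evalAt_comp x₀ ι U h₀' t
    have h4 := congrArg (fun z => z t) (evalAt_congr hs U h₀')
    rw [← h3, h4]
    exact evalAt_mem_localSubring hp h₀'' t
  have h3 : (evalAt (L.ratPt τ ≫ ι) U h t - evalAt x₀ _ h₀' (ι.app U t)) * (r.eval τ) ^ n t =
      (P t).eval τ := by
    have h4 := (Polynomial.eval_C (R := k) (a := evalAt x₀ _ h₀' (ι.app U t)) (x := τ))
    rw [evalAt_comp]
    refine Eq.trans ?_ h1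
    exact congrArg (fun z => (_ - z) * _) h4.symm
  rw [← sub_add_cancel (evalAt (L.ratPt τ ≫ ι) U h t) (evalAt x₀ _ h₀' (ι.app U t))]
  refine add_mem ?_ h2
  rw [eq_div_of_mul_eq (pow_ne_zero _ hrτ) h3]
  rcases hPn t with h0 | hlt
  · rw [h0, Polynomial.eval_zero, zero_div]
    exact zero_mem _
  · obtain ⟨ν, hν⟩ := exists_homogenization_of_lt ((hD t).of_dvd (hN₁' t ht)) (a := a) hb
      ((dvd_mul_right _ _).trans hN) hlt
    have h5 : (P t).eval τ / r.eval τ ^ n t =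
        algebraMap O k ν * (algebraMap O k ρ)⁻¹ ^ n t := by
      rw [hν, hρr, mul_comm (n t) r.natDegree, pow_mul, inv_pow, mul_pow]
      field_simp
      rfl
    rw [h5]
    exact mul_mem (Subalgebra.algebraMap_mem _ _) (pow_mem (inv_mem_localSubring hρp) _)

end LineChart

end

end

end AlgebraicGeometry

namespace AlgebraicGeometry.LineChart

variable {O k : Type u} [CommRing O] [IsDomain O] [Field k] [Algebra O k] [IsFractionRing O k]
  {M C : Scheme.{u}} {g : M ⟶ Spec (CommRingCat.of O)}
  {f : C ⟶ Spec (CommRingCat.of k)} [IsIntegral C] {x₀ : Spec (CommRingCat.of k) ⟶ C}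
  (L : LineChart f x₀) {ι : C ⟶ M}

/-- If `q` vanishes at the points of the affine line that lie off an open set `W` of the model, then
some power of `q` lies in the ideal generated by finitely many polynomials `r` whose nonvanishing
loci lie in affine charts contained in `W`. -/
lemma exists_finset_pow_mem_span {W : M.Opens} {q : Polynomial k}
    (hq : C.basicOpen (L.φ q) ≤ ι ⁻¹ᵁ W) :
    ∃ T : Finset (Polynomial k), (∀ r ∈ T, ∃ U : M.Opens, IsAffineOpen U ∧ U ≤ W ∧
      C.basicOpen (L.φ r) ≤ ι ⁻¹ᵁ U) ∧ ∃ m, q ^ m ∈ Ideal.span (T : Set (Polynomial k)) := by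
  let G : Set (Polynomial k) := {r | ∃ U : M.Opens, IsAffineOpen U ∧ U ≤ W ∧
      C.basicOpen (L.φ r) ≤ ι ⁻¹ᵁ U}
  obtain ⟨T, hTG, hT⟩ := Submodule.fg_span_iff_fg_span_finset_subset G |>.1
    (IsNoetherian.noetherian (Ideal.span G))
  refine ⟨T, fun r hr => hTG hr, ?_⟩
  have h : q ∈ (Ideal.span G).radical := by
    rw [Ideal.radical_eq_sInf, Submodule.mem_sInf]
    rintro P ⟨hGP, hP⟩
    by_contra hqP
    let x := L.pt (R := CommRingCat.of (Polynomial k)) (RingHom.id _) ⟨P, hP⟩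
    have hx (r : Polynomial k) : x ∈ C.basicOpen (L.φ r) ↔ r ∉ P :=
      L.pt_apply_mem_basicOpen_iff (R := CommRingCat.of (Polynomial k)) (RingHom.id _) r ⟨P, hP⟩
    have hxW : ι x ∈ W := hq ((hx q).2 hqP)
    obtain ⟨U, hU, hxU, hUW⟩ := exists_isAffineOpen_mem_and_subset hxW
    have hxV : x ∈ L.V := C.basicOpen_le _ ((hx q).2 hqP)
    obtain ⟨r, hr, hxr⟩ := L.isAffineOpen.exists_basicOpen_le (V := ι ⁻¹ᵁ U) ⟨x, hxU⟩ hxV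
    obtain ⟨r, rfl⟩ := L.φ.surjective r
    exact (hx r).1 hxr (hGP (Ideal.subset_span ⟨U, hU, hUW, hr⟩))
  obtain ⟨m, hm⟩ := h
  exact ⟨m, by rw [Ideal.span, ← hT]; exact hm⟩

/-- A rational point with coordinate `a / b` extends to an integral point in the open set `W` of
the model if the homogenization at `(a, b)` of a polynomial `q` that vanishes on the complement of `W`
is a unit, and `b` is divisible by a suitable `N`. At the primes that contain `b`, the point reduces
to the same point as the integral point `s` at infinity, and the charts around `s` can be used; at
the other primes, `q` takes a unit value, hence so does one of the polynomials `r` of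
`exists_finset_pow_mem_span`. -/
theorem exists_section [IsSeparated g] [LocallyOfFiniteType g]
    (hι : IsPullback ι f g (Spec.map (CommRingCat.ofHom (algebraMap O k))))
    (hx₀ : x₀ ≫ f = 𝟙 _) {s : Spec (CommRingCat.of O) ⟶ M}
    (hs : x₀ ≫ ι = Spec.map (CommRingCat.ofHom (algebraMap O k)) ≫ s) {W : M.Opens}
    (hsW : ∀ p, s p ∈ W) {q : Polynomial k} (hqm : q.Monic)
    (hqd : 0 < q.natDegree) (hq : C.basicOpen (L.φ q) ≤ ι ⁻¹ᵁ W) :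
    ∃ N : O, N ≠ 0 ∧ ∀ a b : O, b ≠ 0 → N ∣ b →
      (∃ u : Oˣ, algebraMap O k u = algebraMap O k b ^ q.natDegree *
        q.eval (algebraMap O k a / algebraMap O k b)) →
      ∃ s' : Spec (CommRingCat.of O) ⟶ M, s' ≫ g = 𝟙 _ ∧ (∀ p, s' p ∈ W) ∧
        Spec.map (CommRingCat.ofHom (algebraMap O k)) ≫ s' =
          L.ratPt (algebraMap O k a / algebraMap O k b) ≫ ι := by
  classical
  -- charts that cover the integral point at infinity
  choose U hU hpU hUW using fun p => exists_isAffineOpen_mem_and_subset (hsW p)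
  have hU₀ (p) : closedPt x₀ ∈ ι ⁻¹ᵁ U p := by
    have h1 : Spec.map (CommRingCat.ofHom (algebraMap O k)) (IsLocalRing.closedPoint k) ⤳ p := by
      refine (PrimeSpectrum.le_iff_specializes _ _).1 fun a ha => ?_
      have h2 : algebraMap O k a ∈ (⊥ : Ideal k) := IsLocalRing.maximalIdeal_eq_bot (R := k) ▸ ha
      rw [Ideal.mem_bot, FaithfulSMul.algebraMap_eq_zero_iff] at h2
      rw [h2]
      exact Ideal.zero_mem _
    have h2 : ι (closedPt x₀) = s (Spec.map (CommRingCat.ofHom (algebraMap O k))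
        (IsLocalRing.closedPoint k)) := by
      exact congrArg (fun z : Spec (CommRingCat.of k) ⟶ M => z (IsLocalRing.closedPoint k)) hs
    change ι (closedPt x₀) ∈ U p
    rw [h2]
    exact (h1.map s.continuous).mem_open (U p).isOpen (hpU p)
  choose N₁ hN₁ hN₁' using fun p => L.exists_forall_mem_of_infinity hι hx₀ hs (hU p) (hU₀ p)
  obtain ⟨F, hF⟩ := (isCompact_univ (X := Spec (CommRingCat.of O))).elim_finite_subcover
    (fun p => (s ⁻¹ᵁ U p : Set (Spec (CommRingCat.of O))))
    (fun p => (s ⁻¹ᵁ U p).isOpen) (fun p _ => Set.mem_iUnion.2 ⟨p, hpU p⟩)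
  obtain ⟨N₂, hN₂, hN₂'⟩ := exists_common_multiple F N₁ fun p _ => hN₁ p
  -- charts that cover the other points
  obtain ⟨T, hT, m, hm⟩ := L.exists_finset_pow_mem_span hq
  obtain ⟨c, hc⟩ := Submodule.mem_span_finset'.1 hm
  choose V hV hVW hrV using fun r : T => hT r r.2
  choose N₃ hN₃ hN₃' using fun r : T => L.exists_forall_mem_of_unit hι (hV r) (hrV r)
  obtain ⟨N₄, hN₄, hN₄'⟩ := exists_common_multiple Finset.univ N₃ fun r _ => hN₃ r
  choose D₁ hD₁ hD₁' using fun r : T => exists_clearsDenominators (O := O) (c r)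
  choose D₂ hD₂ hD₂' using fun r : T => exists_clearsDenominators (O := O) (r : Polynomial k)
  obtain ⟨E₁, hE₁, hE₁'⟩ := exists_common_multiple Finset.univ D₁ fun r _ => hD₁ r
  obtain ⟨E₂, hE₂, hE₂'⟩ := exists_common_multiple Finset.univ D₂ fun r _ => hD₂ r
  obtain ⟨E₃, hE₃, hE₃'⟩ := exists_clearsDenominators (O := O) q
  have hd₂ : N₂ ∣ N₂ * N₄ * E₁ * E₂ * E₃ ^ 2 := ⟨N₄ * E₁ * E₂ * E₃ ^ 2, by ring⟩
  have hd₄ : N₄ ∣ N₂ * N₄ * E₁ * E₂ * E₃ ^ 2 := ⟨N₂ * E₁ * E₂ * E₃ ^ 2, by ring⟩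
  have he₁ : E₁ ∣ N₂ * N₄ * E₁ * E₂ * E₃ ^ 2 := ⟨N₂ * N₄ * E₂ * E₃ ^ 2, by ring⟩
  have he₂ : E₂ ∣ N₂ * N₄ * E₁ * E₂ * E₃ ^ 2 := ⟨N₂ * N₄ * E₁ * E₃ ^ 2, by ring⟩
  refine ⟨N₂ * N₄ * E₁ * E₂ * E₃ ^ 2, by simp [*], fun a b hb hN ⟨u, hu⟩ => ?_⟩
  have hb0 := algebraMap_ne_zero_of_ne_zero (K := k) hb
  refine exists_section_of_forall_prime g W _ (L.ratPt_comp hι _) fun p hp => ?_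
  by_cases hbp : b ∈ p
  · have hap : a ∉ p := fun hap => by
      obtain ⟨ρ, hρ, hρq⟩ := exists_homogenization_of_monic hE₃' hqm (a := a) hb hbp
        ((dvd_mul_left _ _).trans hN)
      have hρu : ρ = u := FaithfulSMul.algebraMap_injective O k (hρq.trans hu.symm)
      have h1 := Ideal.add_mem _ hρ (Ideal.pow_mem_of_mem _ hap _ hqd)
      rw [sub_add_cancel, hρu] at h1
      exact hp.ne_top (Ideal.eq_top_of_isUnit_mem _ h1 u.isUnit)
    obtain ⟨P, hP⟩ := Set.mem_iUnion.1 (hF (Set.mem_univ ⟨p, hp⟩))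
    obtain ⟨hPF, hP⟩ := Set.mem_iUnion.1 hP
    obtain ⟨h, h'⟩ := hN₁' P ⟨p, hp⟩ a b hP hb hbp hap
      ((hN₂' P hPF).trans (hd₂.trans hN))
    exact ⟨U P, hU P, hUW P, h, h'⟩
  · have hNp : N₂ * N₄ * E₁ * E₂ * E₃ ^ 2 ∉ p := fun h => hbp (Ideal.mem_of_dvd _ hN h)
    have hdvd {N : O} (h : N ∣ N₂ * N₄ * E₁ * E₂ * E₃ ^ 2) : N ∉ p := fun h' =>
      hNp (Ideal.mem_of_dvd _ h h')
    have hτ : algebraMap O k a / algebraMap O k b ∈ localSubring k p := by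
      rw [div_eq_mul_inv]
      exact mul_mem (Subalgebra.algebraMap_mem _ _) (inv_mem_localSubring hbp)
    set τ := algebraMap O k a / algebraMap O k b
    obtain ⟨r, hr0, hr⟩ : ∃ r : T, (r : Polynomial k).eval τ ≠ 0 ∧
        ((r : Polynomial k).eval τ)⁻¹ ∈ localSubring k p := by
      have : IsLocalRing (localSubring k p) := by
        have : IsLocalization.AtPrime (localSubring k p) p :=
          Localization.subalgebra.isLocalization_ofField k _ _
        exact IsLocalization.AtPrime.isLocalRing _ p
      have hrm (r : T) : (r : Polynomial k).eval τ ∈ localSubring k p :=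
        eval_mem_localSubring (hD₂' r) (hdvd ((hE₂' r (Finset.mem_univ _)).trans he₂)) hτ
      have hcm (r : T) : (c r).eval τ ∈ localSubring k p :=
        eval_mem_localSubring (hD₁' r) (hdvd ((hE₁' r (Finset.mem_univ _)).trans he₁)) hτ
      by_contra! hcon
      have hmax (r : T) : (⟨_, hrm r⟩ : localSubring k p) ∈
          IsLocalRing.maximalIdeal (localSubring k p) := by
        rw [IsLocalRing.mem_maximalIdeal, mem_nonunits_iff]
        intro hu
        obtain ⟨e, he⟩ := hu.exists_right_inv
        have he' : (r : Polynomial k).eval τ * e = 1 := congrArg Subtype.val he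
        refine hcon r (left_ne_zero_of_mul_eq_one he') ?_
        rw [inv_eq_of_mul_eq_one_right he']
        exact e.2
      have hsum : ∑ r : T, (⟨_, hcm r⟩ * ⟨_, hrm r⟩ : localSubring k p) ∈
          IsLocalRing.maximalIdeal (localSubring k p) :=
        Ideal.sum_mem _ fun r _ => Ideal.mul_mem_left _ _ (hmax r)
      refine (IsLocalRing.mem_maximalIdeal _).1 hsum ?_
      have h1 : ((∑ r : T, (⟨_, hcm r⟩ * ⟨_, hrm r⟩ : localSubring k p) : localSubring k p) : k) =
          q.eval τ ^ m := by
        rw [← Polynomial.eval_pow, ← hc, Polynomial.eval_finsetSum, AddSubmonoidClass.coe_finsetSum]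
        exact Finset.sum_congr rfl fun r _ => by simp
      have h2 : q.eval τ * (algebraMap O k b ^ q.natDegree * algebraMap O k ↑u⁻¹) = 1 := by
        have : algebraMap O k u * algebraMap O k ↑u⁻¹ = 1 := by
          rw [← map_mul, Units.mul_inv, map_one]
        rw [hu] at this
        linear_combination this
      have hinv : (algebraMap O k b ^ q.natDegree * algebraMap O k ↑u⁻¹) ^ m ∈ localSubring k p :=
        pow_mem (mul_mem (pow_mem (Subalgebra.algebraMap_mem _ _) _)
          (Subalgebra.algebraMap_mem _ _)) _
      refine IsUnit.of_mul_eq_one ⟨_, hinv⟩ (Subtype.ext ?_)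
      rw [MulMemClass.coe_mul, h1, ← mul_pow, h2, one_pow]
      rfl
    obtain ⟨h, h'⟩ := hN₃' r p τ (hdvd ((hN₄' r (Finset.mem_univ _)).trans hd₄)) hτ hr0 hr
    exact ⟨V r, hV r, hVW r, h, h'⟩

end AlgebraicGeometry.LineChart

/-! ### Divisors on the affine line and the topology on its points -/

/-- A finite reduced quotient of `k[X]` is `k[X] / (q)` with `q` monic and squarefree. -/
lemma Polynomial.exists_monic_of_surjective {k A : Type*} [Field k] [CommRing A] [IsReduced A]
    (ρ : Polynomial k →+* A) (hρ : Function.Surjective ρ)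
    (hfin : (ρ.comp Polynomial.C).Finite) :
    ∃ q : Polynomial k, q.Monic ∧ Squarefree q ∧ (∀ r, ρ r = 0 ↔ q ∣ r) ∧
      q.natDegree = letI := (ρ.comp Polynomial.C).toAlgebra; Module.finrank k A := by
  let _ := (ρ.comp Polynomial.C).toAlgebra
  have : Module.Finite k A := hfin
  let ρ' : Polynomial k →ₐ[k] A := { ρ with commutes' := fun c => rfl }
  obtain ⟨q₀, hq₀⟩ := IsPrincipalIdealRing.principal (RingHom.ker ρ)
  have hq₀' (r : Polynomial k) : ρ r = 0 ↔ q₀ ∣ r := by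
    rw [← RingHom.mem_ker, hq₀]
    exact Ideal.mem_span_singleton
  have hne : q₀ ≠ 0 := by
    rintro rfl
    have hinj : Function.Injective ρ' :=
      (injective_iff_map_eq_zero _).2 fun r hr => zero_dvd_iff.1 ((hq₀' r).1 hr)
    have : Module.Finite k (Polynomial k) := Module.Finite.of_injective ρ'.toLinearMap hinj
    exact Polynomial.not_finite this
  obtain ⟨q, hqm, hq⟩ : ∃ q : Polynomial k, q.Monic ∧ ∀ r, ρ r = 0 ↔ q ∣ r := by
    refine ⟨q₀ * Polynomial.C q₀.leadingCoeff⁻¹, Polynomial.monic_mul_leadingCoeff_inv hne,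
      fun r => ?_⟩
    have hu : IsUnit (Polynomial.C q₀.leadingCoeff⁻¹) :=
      Polynomial.isUnit_C.2 (IsUnit.mk0 _ (inv_ne_zero (Polynomial.leadingCoeff_ne_zero.2 hne)))
    rw [hq₀', hu.mul_right_dvd]
  refine ⟨q, hqm, ?_, hq, ?_⟩
  · have h1 := (RingHom.ker_isRadical_iff_reduced_of_surjective hρ).2 ‹_›
    rw [← isRadical_iff_squarefree_of_ne_zero hqm.ne_zero]
    intro n x hx
    rw [← hq] at hx ⊢
    exact h1 ⟨n, by rw [RingHom.mem_ker]; exact hx⟩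
  · have hker : RingHom.ker ρ' = Ideal.span {q} := by
      ext r
      rw [Ideal.mem_span_singleton, ← hq]
      rfl
    rw [← finrank_quotient_span_eq_natDegree, ← hker]
    exact (Ideal.quotientKerAlgEquivOfSurjective (f := ρ') hρ).toLinearEquiv.finrank_eq

namespace AlgebraicGeometry

section

lemma app_comp_constMap {k : Type u} [CommRing k] {C D : Scheme.{u}}
    (f : C ⟶ Spec (CommRingCat.of k)) (i : D ⟶ C) (V : C.Opens) :
    (i.app V).hom.comp (constMap f V) = constMap (i ≫ f) (i ⁻¹ᵁ V) := by
  rw [constMap, constMap, ← CommRingCat.hom_comp, Category.assoc]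
  congr 2
  rw [Scheme.Hom.app_eq_appLE, Scheme.Hom.appLE_comp_appLE]

variable {k : Type u} [Field k] {C D : Scheme.{u}} (f : C ⟶ Spec (CommRingCat.of k)) (i : D ⟶ C)

lemma finite_constMap_top [IsFinite f] : (constMap f ⊤).Finite := by
  have h : f.appTop.hom.Finite := f.finite_app _ (isAffineOpen_top _)
  have h1 : f.appLE ⊤ ⊤ (le_preimage_top f ⊤) = f.appTop := (Scheme.Hom.app_eq_appLE f).symm
  rw [constMap, CommRingCat.hom_comp, h1]
  exact RingHom.Finite.comp h (RingHom.Finite.of_surjective _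
    (ConcreteCategory.bijective_of_isIso (Scheme.ΓSpecIso (CommRingCat.of k)).inv).2)

lemma degreeOver_eq : degreeOver f =
    letI := (constMap f ⊤).toAlgebra; Module.finrank k Γ(C, ⊤) := by
  rw [degreeOver]
  have h1 : f.appLE ⊤ ⊤ (le_preimage_top f ⊤) = f.appTop := (Scheme.Hom.app_eq_appLE f).symm
  rw [constMap, CommRingCat.hom_comp, h1]

/-- A reduced divisor on the affine line `V` is cut out by a squarefree polynomial `q`. -/
lemma LineChart.exists_polynomial [IsIntegral C] {f} {x₀ : Spec (CommRingCat.of k) ⟶ C}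
    (L : LineChart f x₀) [IsReduced D] [IsClosedImmersion i] [IsFinite (i ≫ f)]
    (hD : ∀ x, i x ∈ L.V) :
    ∃ q : Polynomial k, q.Monic ∧ Squarefree q ∧ q.natDegree = degreeOver (i ≫ f) ∧
      (∀ x ∈ L.V, x ∈ C.basicOpen (L.φ q) ↔ x ∉ Set.range i) ∧ i.app L.V (L.φ q) = 0 := by
  have hV : i ⁻¹ᵁ L.V = ⊤ := top_le_iff.1 fun x _ => hD x
  let ρ : Polynomial k →+* Γ(D, i ⁻¹ᵁ L.V) := (i.app L.V).hom.comp L.φ.toRingHom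
  have hρ : Function.Surjective ρ :=
    (i.app_surjective L.V L.isAffineOpen).comp L.φ.surjective
  have hρC : ρ.comp Polynomial.C = constMap (i ≫ f) (i ⁻¹ᵁ L.V) := by
    rw [← app_comp_constMap]
    ext c
    exact congrArg (i.app L.V) (L.φ_C c)
  have htop (U : D.Opens) (hU : U = ⊤) : (constMap (i ≫ f) U).Finite ∧
      degreeOver (i ≫ f) = letI := (constMap (i ≫ f) U).toAlgebra; Module.finrank k Γ(D, U) := by
    subst hU
    exact ⟨finite_constMap_top _, degreeOver_eq _⟩
  obtain ⟨hfin, hdeg⟩ := htop _ hV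
  obtain ⟨q, hqm, hqs, hq, hqd⟩ := Polynomial.exists_monic_of_surjective ρ hρ (hρC ▸ hfin)
  have hq0 : i.app L.V (L.φ q) = 0 := (hq q).2 dvd_rfl
  refine ⟨q, hqm, hqs, ?_, fun x hx => ⟨?_, fun hxi => ?_⟩, hq0⟩
  · rw [hqd, hdeg, hρC]
  · rintro hxq ⟨y, rfl⟩
    have h : y ∈ i ⁻¹ᵁ C.basicOpen (L.φ q) := hxq
    rw [Scheme.preimage_basicOpen, hq0, Scheme.basicOpen_zero] at h
    exact h
  · obtain ⟨r, hr, hxr⟩ := L.isAffineOpen.exists_basicOpen_le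
      (V := ⟨(Set.range i)ᶜ, i.isClosedEmbedding.isClosed_range.isOpen_compl⟩) ⟨x, hxi⟩ hx
    obtain ⟨r, rfl⟩ := L.φ.surjective r
    have h1 : D.basicOpen (i.app L.V (L.φ r)) = ⊥ := by
      rw [← Scheme.preimage_basicOpen]
      exact eq_bot_iff.2 fun y hy => hr hy ⟨y, rfl⟩
    obtain ⟨r, rfl⟩ := (hq r).1 ((basicOpen_eq_bot_iff _).1 h1)
    rw [map_mul, Scheme.basicOpen_mul] at hxr
    exact hxr.1

/-- The point of the curve with coordinate `θ` in an extension field `F`. -/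
def LineChart.fieldPt [IsIntegral C] {f} {x₀ : Spec (CommRingCat.of k) ⟶ C}
    (L : LineChart f x₀) (F : Type u) [Field F] [Algebra k F] (θ : F) : FieldPoints f F :=
  ⟨L.pt (R := CommRingCat.of F) (Polynomial.eval₂RingHom (algebraMap k F) θ), by
    rw [L.pt_comp]
    congr 2
    ext c
    simp⟩

lemma LineChart.exists_eq_fieldPt [IsIntegral C] {f} {x₀ : Spec (CommRingCat.of k) ⟶ C}
    (L : LineChart f x₀) {F : Type u} [Field F] [Algebra k F] (x : FieldPoints f F)
    (h : ⊤ ≤ x.1 ⁻¹ᵁ L.V) :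
    ∃ θ : F, x = L.fieldPt F θ ∧
      ∀ P, evalAt x.1 L.V h (L.φ P) = P.eval₂ (algebraMap k F) θ := by
  let ψ : Polynomial k →+* F := (evalAt x.1 L.V h).comp L.φ.toRingHom
  have hψ : ψ = Polynomial.eval₂RingHom (algebraMap k F) (ψ Polynomial.X) := by
    ext c
    · have h1 : ψ (Polynomial.C c) = evalAt x.1 L.V h (constMap f L.V c) :=
        congrArg (evalAt x.1 L.V h) (L.φ_C c)
      have h2 := evalAt_constMap f x.1 (CommRingCat.ofHom (algebraMap k F)) x.2 L.V h c
      simpa using h1.trans h2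
    · simp
  exact ⟨ψ Polynomial.X,
    Subtype.ext ((L.eq_pt _ h).trans (congrArg (fun z => L.pt (R := CommRingCat.of F) z) hψ)),
    fun P => congrArg (fun z => z P) hψ⟩

/-- The `F`-valued points of a divisor on the affine line are given by roots. -/
lemma LineChart.exists_root [IsIntegral C] {f} {x₀ : Spec (CommRingCat.of k) ⟶ C}
    (L : LineChart f x₀) (hD : ∀ x, i x ∈ L.V) {q : Polynomial k}
    (hq : i.app L.V (L.φ q) = 0) {F : Type u} [Field F] [Algebra k F]
    (d : FieldPoints (i ≫ f) F) :
    ∃ θ : F, q.eval₂ (algebraMap k F) θ = 0 ∧ FieldPoints.map i d = L.fieldPt F θ := by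
  have hle : ⊤ ≤ (d.1 ≫ i) ⁻¹ᵁ L.V := fun x _ => hD (d.1 x)
  obtain ⟨θ, h, hP⟩ := L.exists_eq_fieldPt (FieldPoints.map i d) hle
  refine ⟨θ, ?_, h⟩
  rw [← hP]
  have h2 : evalAt (d.1 ≫ i) L.V hle (L.φ q) = evalAt d.1 (i ⁻¹ᵁ L.V) hle (i.app L.V (L.φ q)) :=
    evalAt_comp d.1 i L.V hle (L.φ q)
  exact h2.trans (by rw [hq, map_zero])

lemma LineChart.fieldPt_injective [IsIntegral C] {f} {x₀ : Spec (CommRingCat.of k) ⟶ C}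
    (L : LineChart f x₀) (F : Type u) [Field F] [Algebra k F] :
    Function.Injective (L.fieldPt F) := by
  intro θ θ' h
  have h1 : (L.fieldPt F θ).1 = (L.fieldPt F θ').1 := congrArg Subtype.val h
  have h2 := L.evalAt_pt (R := CommRingCat.of F)
    (Polynomial.eval₂RingHom (algebraMap k F) θ) Polynomial.X
  have h3 := L.evalAt_pt (R := CommRingCat.of F)
    (Polynomial.eval₂RingHom (algebraMap k F) θ') Polynomial.X
  have h4 := congrArg (fun z => z (L.φ Polynomial.X)) (evalAt_congr h1 L.V (L.le_preimage_pt _))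
  have h5 := (h2.symm.trans h4).trans h3
  simpa using h5

/-- The map from the affine line over a topological field to the points of the curve is
continuous. -/
lemma LineChart.continuous_fieldPt [IsIntegral C] {f} {x₀ : Spec (CommRingCat.of k) ⟶ C}
    (L : LineChart f x₀) (F : Type u) [Field F] [Algebra k F] [TopologicalSpace F]
    [IsTopologicalRing F] : Continuous (L.fieldPt F) := by
  let a : F → {x : FieldPoints f F // ⊤ ≤ x.1 ⁻¹ᵁ L.V} := fun θ =>
    ⟨L.fieldPt F θ, L.le_preimage_pt _⟩
  have ha : @Continuous _ _ _ (⨅ s : Γ(C, L.V),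
      TopologicalSpace.induced (FieldPoints.eval L.V s) inferInstance) a := by
    refine continuous_iInf_rng.2 fun s => continuous_induced_rng.2 ?_
    obtain ⟨P, rfl⟩ := L.φ.surjective s
    have : FieldPoints.eval L.V (L.φ P) ∘ a = fun θ => P.eval₂ (algebraMap k F) θ := by
      funext θ
      exact L.evalAt_pt (R := CommRingCat.of F) (Polynomial.eval₂RingHom (algebraMap k F) θ) P
    rw [this]
    exact Polynomial.continuous_eval₂ P (algebraMap k F)
  have h2 : @Continuous _ _ (⨅ s : Γ(C, L.V),
      TopologicalSpace.induced (FieldPoints.eval L.V s) inferInstance) _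
      (Subtype.val : {x : FieldPoints f F // ⊤ ≤ x.1 ⁻¹ᵁ L.V} → FieldPoints f F) :=
    continuous_iff_coinduced_le.2 (le_iSup (fun U : C.affineOpens =>
      TopologicalSpace.coinduced
        (Subtype.val : {x : FieldPoints f F // ⊤ ≤ x.1 ⁻¹ᵁ U.1} → FieldPoints f F)
        (⨅ s : Γ(C, U.1), TopologicalSpace.induced (FieldPoints.eval U.1 s) inferInstance))
      ⟨L.V, L.isAffineOpen⟩)
  exact @Continuous.comp _ _ _ _ (_) _ _ _ h2 ha

end

end AlgebraicGeometry

/-! ### Rings of `S`-integers -/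

section

lemma IsDedekindDomain.HeightOneSpectrum.exists_pow_eq_span {R : Type*} [CommRing R]
    [IsDedekindDomain R] [Finite (ClassGroup R)] (p : HeightOneSpectrum R) :
    ∃ (h : ℕ) (π : R), h ≠ 0 ∧ π ≠ 0 ∧ p.asIdeal ^ h = Ideal.span {π} := by
  have hp : p.asIdeal ∈ nonZeroDivisors (Ideal R) := mem_nonZeroDivisors_of_ne_zero p.ne_bot
  have h1 : ClassGroup.mk0 (⟨p.asIdeal, hp⟩ ^ Nat.card (ClassGroup R)) = 1 := by
    rw [map_pow, pow_card_eq_one']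
  have h2 := (ClassGroup.mk0_eq_one_iff (pow_mem hp _)).1 h1
  obtain ⟨π, hπ⟩ := h2
  refine ⟨Nat.card (ClassGroup R), π, Nat.card_pos.ne', ?_, hπ⟩
  rintro rfl
  rw [Ideal.submodule_span_eq, Ideal.span_singleton_eq_bot.2 rfl] at hπ
  exact p.ne_bot (pow_eq_zero_iff (Nat.card_pos.ne') |>.1 hπ)

namespace SIntegers

variable {k : Type u} [Field k] [NumberField k] (S : Set (NFPlace k))

instance : IsFractionRing (SIntegers k S) k := by
  refine (isLocalization_iff _ _).2 ⟨?_, ?_, ?_⟩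
  · rintro ⟨y, hy⟩
    exact IsUnit.mk0 _ ((map_ne_zero_iff _ Subtype.val_injective).2 (nonZeroDivisors.ne_zero hy))
  · intro z
    obtain ⟨a, b, hb, rfl⟩ := IsFractionRing.div_surjective (A := 𝓞 k) z
    have hb0 : algebraMap (𝓞 k) k b ≠ 0 :=
      (map_ne_zero_iff _ (IsFractionRing.injective (𝓞 k) k)).2 (nonZeroDivisors.ne_zero hb)
    refine ⟨⟨algebraMap (𝓞 k) _ a, ⟨algebraMap (𝓞 k) _ b, mem_nonZeroDivisors_of_ne_zero ?_⟩⟩, ?_⟩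
    · intro h
      exact hb0 (congrArg Subtype.val h)
    · exact div_mul_cancel₀ _ hb0
  · intro x y h
    exact ⟨1, by rw [Subtype.val_injective h]⟩

lemma mem_of_isIntegral {x : k} (hx : IsIntegral (SIntegers k S) x) : x ∈ SIntegers k S := by
  intro p hp
  obtain ⟨P, hP, hPx⟩ := hx
  by_contra h
  rw [not_le] at h
  let V := (p.valuation k).valuationSubring
  let φ : SIntegers k S →+* V :=
    (algebraMap (SIntegers k S) k).codRestrict V fun y => y.2 p hp
  have h2 : IsIntegral V x := by
    refine ⟨P.map φ, hP.map _, ?_⟩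
    rw [Polynomial.eval₂_map]
    exact hPx
  obtain ⟨y, rfl⟩ := IsIntegrallyClosed.isIntegral_iff.1 h2
  exact absurd y.2 (not_le.2 h)

/-- Every nonzero `S`-integer divides a nonzero algebraic integer. -/
lemma exists_algebraMap_eq_mul {N : SIntegers k S} (hN : N ≠ 0) :
    ∃ (n : 𝓞 k) (c : SIntegers k S), n ≠ 0 ∧ algebraMap (𝓞 k) _ n = N * c := by
  obtain ⟨a, b, hb, h⟩ := IsFractionRing.div_surjective (A := 𝓞 k) (N : k)
  have hb0 : algebraMap (𝓞 k) k b ≠ 0 :=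
    (map_ne_zero_iff _ (IsFractionRing.injective (𝓞 k) k)).2 (nonZeroDivisors.ne_zero hb)
  refine ⟨a, algebraMap (𝓞 k) _ b, ?_, ?_⟩
  · rintro rfl
    rw [map_zero, zero_div] at h
    exact hN (Subtype.ext h.symm)
  · refine Subtype.ext ?_
    exact (div_eq_iff hb0).1 h

lemma inv_mem {p : HeightOneSpectrum (𝓞 k)} (hp : NFPlace.finite p ∈ S) {h : ℕ} {π : 𝓞 k}
    (hπ : p.asIdeal ^ h = Ideal.span {π}) : (algebraMap (𝓞 k) k π)⁻¹ ∈ SIntegers k S := by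
  intro p' hp'
  have h1 : p'.valuation k (algebraMap (𝓞 k) k π) = 1 := by
    refine p'.valuation_eq_one_iff_notMem.2 fun hmem => ?_
    have h2 : p.asIdeal ^ h ≤ p'.asIdeal := by
      rw [hπ, Ideal.span_singleton_le_iff_mem]
      exact hmem
    have h3 : p.asIdeal ≤ p'.asIdeal := p'.isPrime.le_of_pow_le h2
    have h4 : p = p' := HeightOneSpectrum.ext (p.isMaximal.eq_of_le p'.isPrime.ne_top h3)
    exact hp' (h4 ▸ hp)
  rw [map_inv₀, h1, inv_one]

end SIntegers

open Filter Topology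

/-- If `w` is a unit over a ring `O`, then some powers of `w` are congruent to `1` modulo a given
algebraic integer `N`, because `𝓞 L / N` is finite. -/
lemma exists_isIntegral_pow_sub_one_div {O L : Type*} [CommRing O] [Field L] [NumberField L]
    [Algebra O L] {w : 𝓞 L} (hw0 : w ≠ 0) (hw : IsIntegral O (w : L)⁻¹) {N : 𝓞 L} (hN : N ≠ 0) :
    ∃ m : ℕ, 0 < m ∧ ∀ n, IsIntegral O (((w : L) ^ (m * n) - 1) / (N : L)) := by
  have hfin : Finite (𝓞 L ⧸ Ideal.span {N}) :=
    Ideal.finiteQuotientOfFreeOfNeBot _ (mt Ideal.span_singleton_eq_bot.1 hN)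
  obtain ⟨i, j, hij, h⟩ := Finite.exists_ne_map_eq_of_infinite
    fun n : ℕ => (Ideal.Quotient.mk (Ideal.span {N}) (w ^ n))
  wlog hlt : i < j generalizing i j
  · exact this j i hij.symm h.symm (lt_of_le_of_ne (not_lt.1 hlt) hij.symm)
  obtain ⟨m, rfl⟩ := Nat.exists_eq_add_of_lt hlt
  refine ⟨m + 1, Nat.succ_pos _, fun n => ?_⟩
  obtain ⟨t, ht⟩ := Ideal.mem_span_singleton.1 (Ideal.Quotient.eq.1 h.symm)
  obtain ⟨r, hr⟩ := sub_one_dvd_pow_sub_one (w ^ (m + 1)) n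
  have hN' : (N : L) ≠ 0 := by simpa using hN
  have hw' : (w : L) ≠ 0 := by simpa using hw0
  have e : ((w : L) ^ ((m + 1) * n) - 1) / (N : L) = ((t * r : 𝓞 L) : L) * (w : L)⁻¹ ^ i := by
    have ht' := congrArg (algebraMap (𝓞 L) L) ht
    have hr' := congrArg (algebraMap (𝓞 L) L) hr
    simp only [map_sub, map_mul, map_pow, map_one] at ht' hr' ⊢
    rw [pow_mul, hr', inv_pow, div_eq_iff hN', mul_right_comm, ← div_eq_mul_inv,
      eq_div_iff (pow_ne_zero _ hw')]
    linear_combination (algebraMap (𝓞 L) L r) * ht'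
  rw [e]
  exact ((RingOfIntegers.isIntegral_coe _).tower_top).mul (hw.pow _)

/-- The arithmetic heart of the approximation: if `w₁ / w₂` is topologically nilpotent, then the
equations `a - ϑ₁ b = w₁ ^ n` and `a - ϑ₂ b = w₂ ^ n` define for suitable `n` a fraction `a / b`
close to `ϑ₁` at which the form `(a - ϑ₁ b) (a - ϑ₂ b)` has a unit as its value. -/
theorem SIntegers.exists_div_mem_of_tendsto {k : Type u} [Field k] [NumberField k]
    {S : Set (NFPlace k)} {F L : Type*} [Field F] [TopologicalSpace F] [IsTopologicalDivisionRing F]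
    [T1Space F] [Algebra k F] [Field L] [NumberField L] [Algebra k L] (j : L →ₐ[k] F) {ϑ₁ ϑ₂ : L}
    (hϑ : ϑ₁ ≠ ϑ₂) {q : Polynomial k}
    (hq : q.map (algebraMap k L) =
      (Polynomial.X - Polynomial.C ϑ₁) * (Polynomial.X - Polynomial.C ϑ₂))
    {w₁ w₂ : 𝓞 L} (hw₁0 : w₁ ≠ 0) (hw₂0 : w₂ ≠ 0)
    (hw₁ : IsIntegral (SIntegers k S) (w₁ : L)⁻¹) (hw₂ : IsIntegral (SIntegers k S) (w₂ : L)⁻¹)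
    (hdesc : ∀ n : ℕ, ∃ a b : k, algebraMap k L b = ((w₁ : L) ^ n - (w₂ : L) ^ n) / (ϑ₂ - ϑ₁) ∧
      algebraMap k L a = (w₁ : L) ^ n + ϑ₁ * algebraMap k L b)
    (hj : Tendsto (fun n : ℕ => (j w₁ / j w₂) ^ n) atTop (𝓝 0))
    {N : SIntegers k S} (hN : N ≠ 0) {Ω : Set F} (hΩ : Ω ∈ 𝓝 (j ϑ₁)) :
    ∃ a b : SIntegers k S, b ≠ 0 ∧ N ∣ b ∧
      (∃ u : (SIntegers k S)ˣ, algebraMap (SIntegers k S) k u =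
        algebraMap (SIntegers k S) k b ^ 2 *
          q.eval (algebraMap (SIntegers k S) k a / algebraMap (SIntegers k S) k b)) ∧
      algebraMap k F (algebraMap (SIntegers k S) k a / algebraMap (SIntegers k S) k b) ∈ Ω ∧
      algebraMap k F (algebraMap (SIntegers k S) k a / algebraMap (SIntegers k S) k b) ≠ j ϑ₁ := by
  have hint (x : 𝓞 L) : IsIntegral (SIntegers k S) (x : L) :=
    (RingOfIntegers.isIntegral_coe x).tower_top
  have hmul (x y : 𝓞 L) : ((x * y : 𝓞 L) : L) = x * y := map_mul (algebraMap (𝓞 L) L) x y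
  have hδ : ϑ₂ - ϑ₁ ≠ 0 := sub_ne_zero.2 hϑ.symm
  have hw₁' : (w₁ : L) ≠ 0 := by simpa using hw₁0
  have hw₂' : (w₂ : L) ≠ 0 := by simpa using hw₂0
  obtain ⟨n, c, hn0, hnc⟩ := exists_algebraMap_eq_mul S hN
  obtain ⟨x₁, y₁, hy₁, h₁⟩ := IsFractionRing.div_surjective (A := 𝓞 L) (ϑ₂ - ϑ₁)⁻¹
  obtain ⟨x₂, y₂, hy₂, h₂⟩ := IsFractionRing.div_surjective (A := 𝓞 L) ((ϑ₂ - ϑ₁)⁻¹ * ϑ₁)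
  have hy₁0 := nonZeroDivisors.ne_zero hy₁
  have hy₂0 := nonZeroDivisors.ne_zero hy₂
  have hy₁' : (y₁ : L) ≠ 0 := by simpa using hy₁0
  have hy₂' : (y₂ : L) ≠ 0 := by simpa using hy₂0
  let nL : 𝓞 L := algebraMap (𝓞 k) (𝓞 L) n
  have hnL : (nL : L) = algebraMap k L (n : k) := rfl
  have hn' : (n : k) ≠ 0 := by simpa using hn0
  have hnL' : (nL : L) ≠ 0 := by rw [hnL]; simpa using hn0
  have hnL0 : nL ≠ 0 := fun h => hnL' (by rw [h]; exact map_zero _)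
  obtain ⟨m₁, hm₁, H₁⟩ := exists_isIntegral_pow_sub_one_div hw₁0 hw₁
    (mul_ne_zero hnL0 (mul_ne_zero hy₁0 hy₂0))
  obtain ⟨m₂, hm₂, H₂⟩ := exists_isIntegral_pow_sub_one_div hw₂0 hw₂
    (mul_ne_zero hnL0 (mul_ne_zero hy₁0 hy₂0))
  set z : F := j w₁ / j w₂ with hz
  have hz1 : Tendsto (fun t : ℕ => z ^ (m₁ * m₂ * t)) atTop (𝓝 0) :=
    hj.comp (tendsto_id.const_mul_atTop' (Nat.mul_pos hm₁ hm₂))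
  have hz2 : Tendsto (fun t : ℕ => j ϑ₁ + (j ϑ₂ - j ϑ₁) *
      (z ^ (m₁ * m₂ * t) / (z ^ (m₁ * m₂ * t) - 1))) atTop (𝓝 (j ϑ₁)) := by
    have h3 := ((hz1.div (hz1.sub_const 1) (by simp)).const_mul (j ϑ₂ - j ϑ₁)).const_add (j ϑ₁)
    simpa using h3
  obtain ⟨t, ht, ht1⟩ := ((hz2.eventually_mem hΩ).and (hz1.eventually_ne zero_ne_one)).exists
  obtain ⟨a, b, hb, ha⟩ := hdesc (m₁ * m₂ * t)
  set E := m₁ * m₂ * t with hE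
  have hjw₁ : j w₁ ≠ 0 := by simpa using hw₁'
  have hjw₂ : j w₂ ≠ 0 := by simpa using hw₂'
  have hzE : z ^ E ≠ 0 := pow_ne_zero _ (div_ne_zero hjw₁ hjw₂)
  have hD : (w₁ : L) ^ E - (w₂ : L) ^ E ≠ 0 := by
    intro h
    apply ht1
    rw [hz, div_pow, ← map_pow j, ← map_pow j, sub_eq_zero.1 h, div_self]
    rw [map_pow]
    exact pow_ne_zero _ hjw₂
  have hb0 : b ≠ 0 := by
    rintro rfl
    rw [map_zero] at hb
    exact div_ne_zero hD hδ hb.symm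
  have hbL : algebraMap k L b ≠ 0 := by simpa using hb0
  have hNk : (N : k) ≠ 0 := fun h => hN (Subtype.ext h)
  have hNL : algebraMap k L (N : k) ≠ 0 := by simpa using hNk
  have hncL : (nL : L) = algebraMap k L N * algebraMap k L c := by
    rw [hnL, ← map_mul]
    exact congrArg (fun x => algebraMap k L (Subtype.val x)) hnc
  have hI : IsIntegral (SIntegers k S)
      (((w₁ : L) ^ E - (w₂ : L) ^ E) / ((nL * (y₁ * y₂) : 𝓞 L) : L)) := by
    have h3 := (H₁ (m₂ * t)).sub (H₂ (m₁ * t))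
    rw [← sub_div, sub_sub_sub_cancel_right] at h3
    have e₁ : m₁ * (m₂ * t) = E := by rw [hE]; ring
    have e₂ : m₂ * (m₁ * t) = E := by rw [hE]; ring
    rwa [e₁, e₂] at h3
  have hδ₁ : (ϑ₂ - ϑ₁)⁻¹ * (y₁ : L) = x₁ := by rw [← h₁]; exact div_mul_cancel₀ _ hy₁'
  have hδ₂ : (ϑ₂ - ϑ₁)⁻¹ * ϑ₁ * (y₂ : L) = x₂ := by rw [← h₂]; exact div_mul_cancel₀ _ hy₂'
  have hbN : b / (N : k) ∈ SIntegers k S := by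
    refine SIntegers.mem_of_isIntegral S ?_
    rw [← isIntegral_algebraMap_iff (algebraMap k L).injective]
    have e : algebraMap k L (b / (N : k)) =
        ((w₁ : L) ^ E - (w₂ : L) ^ E) / ((nL * (y₁ * y₂) : 𝓞 L) : L) * algebraMap k L c *
          ((x₁ * y₂ : 𝓞 L) : L) := by
      rw [map_div₀, hb, hmul, hmul,
        hmul, ← hδ₁]
      field_simp
      rw [hncL]
    rw [e]
    exact (hI.mul (isIntegral_algebraMap (R := SIntegers k S) (x := c))).mul (hint _)
  have haO : a ∈ SIntegers k S := by
    refine SIntegers.mem_of_isIntegral S ?_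
    rw [← isIntegral_algebraMap_iff (algebraMap k L).injective]
    have e : algebraMap k L a = (w₁ : L) ^ E +
        ((w₁ : L) ^ E - (w₂ : L) ^ E) / ((nL * (y₁ * y₂) : 𝓞 L) : L) *
          ((nL * (y₁ * x₂) : 𝓞 L) : L) := by
      rw [ha, hb, hmul, hmul,
        hmul, hmul, ← hδ₂]
      field_simp
    rw [e]
    exact ((hint _).pow _).add (hI.mul (hint _))
  have hbO : b ∈ SIntegers k S := by
    have h3 := mul_mem hbN N.2
    rwa [div_mul_cancel₀ _ hNk] at h3
  have hval : algebraMap k L (b ^ 2 * q.eval (a / b)) = (w₁ : L) ^ E * (w₂ : L) ^ E := by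
    have h3 : algebraMap k L (q.eval (a / b)) =
        (algebraMap k L (a / b) - ϑ₁) * (algebraMap k L (a / b) - ϑ₂) := by
      have h4 := Polynomial.eval_map_apply (f := algebraMap k L) (p := q) (a / b)
      rw [hq] at h4
      simpa using h4.symm
    rw [map_mul, map_pow, h3, map_div₀, ha]
    field_simp
    rw [hb]
    field_simp
    ring
  refine ⟨⟨a, haO⟩, ⟨b, hbO⟩, fun h => hb0 (congrArg Subtype.val h),
    ⟨⟨_, hbN⟩, Subtype.ext (mul_div_cancel₀ _ hNk).symm⟩, ?_, ?_⟩
  · have hne : b ^ 2 * q.eval (a / b) ≠ 0 := by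
      intro h
      rw [h, map_zero] at hval
      exact mul_ne_zero (pow_ne_zero _ hw₁') (pow_ne_zero _ hw₂') hval.symm
    refine ⟨⟨⟨b ^ 2 * q.eval (a / b), ?_⟩, ⟨(b ^ 2 * q.eval (a / b))⁻¹, ?_⟩, ?_, ?_⟩, rfl⟩
    · refine SIntegers.mem_of_isIntegral S ?_
      rw [← isIntegral_algebraMap_iff (algebraMap k L).injective, hval]
      exact ((hint _).pow _).mul ((hint _).pow _)
    · refine SIntegers.mem_of_isIntegral S ?_
      rw [← isIntegral_algebraMap_iff (algebraMap k L).injective, map_inv₀, hval, mul_inv,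
        ← inv_pow, ← inv_pow]
      exact (hw₁.pow _).mul (hw₂.pow _)
    · exact Subtype.ext (mul_inv_cancel₀ hne)
    · exact Subtype.ext (inv_mul_cancel₀ hne)
  · have hτ : algebraMap k F (a / b) =
        j ϑ₁ + (j ϑ₂ - j ϑ₁) * (z ^ E / (z ^ E - 1)) := by
      have hjD : j w₁ ^ E - j w₂ ^ E ≠ 0 := by
        rw [← map_pow j, ← map_pow j, ← map_sub]
        exact (map_ne_zero_iff _ j.injective).2 hD
      have hjb : j (algebraMap k L b) ≠ 0 := (map_ne_zero_iff _ j.injective).2 hbL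
      rw [← j.commutes, map_div₀, ha, map_div₀, map_add, map_mul, add_div,
        mul_div_cancel_right₀ _ hjb, add_comm, hb, hz, div_pow]
      simp only [map_div₀, map_sub, map_pow]
      have hjδ : j ϑ₂ - j ϑ₁ ≠ 0 := by
        rw [← map_sub]
        exact (map_ne_zero_iff _ j.injective).2 hδ
      have hjw₂E : j w₂ ^ E ≠ 0 := pow_ne_zero _ hjw₂
      congr 1
      rw [div_sub_one hjw₂E]
      field_simp
    refine ⟨?_, ?_⟩
    · change algebraMap k F (a / b) ∈ Ω
      rw [hτ]
      exact ht
    · change algebraMap k F (a / b) ≠ j ϑ₁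
      rw [hτ]
      intro h
      rw [add_eq_left] at h
      refine mul_ne_zero ?_ (div_ne_zero hzE (sub_ne_zero.2 ht1)) h
      rw [← map_sub]
      exact (map_ne_zero_iff _ j.injective).2 hδ

/-! ### Quadratic extensions -/

/-- In the quadratic extension `k[X] / (q)`, the polynomial `q` has a second root `ϑ`, to which a
conjugation takes the first. -/
lemma AdjoinRoot.exists_conj {k : Type*} [Field k] {q : Polynomial k} [Fact (Irreducible q)]
    (hqm : q.Monic) (hq2 : q.natDegree = 2) (hsep : q.Separable) :
    ∃ (ϑ : AdjoinRoot q) (σ : AdjoinRoot q →ₐ[k] AdjoinRoot q), σ (root q) = ϑ ∧ σ ϑ = root q ∧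
      root q ≠ ϑ ∧
      q.map (algebraMap k (AdjoinRoot q)) =
        (Polynomial.X - Polynomial.C (root q)) * (Polynomial.X - Polynomial.C ϑ) := by
  set L := AdjoinRoot q
  set α : L := root q
  have hq : q = Polynomial.X ^ 2 + Polynomial.C (q.coeff 1) * Polynomial.X +
      Polynomial.C (q.coeff 0) := by
    have h2 : q.coeff 2 = 1 := by rw [← hq2]; exact hqm
    conv_lhs => rw [q.as_sum_range, hq2]
    simp only [Finset.sum_range_succ, Finset.range_zero, Finset.sum_empty, h2,
      ← Polynomial.C_mul_X_pow_eq_monomial, map_one]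
    ring
  have haeval (y : L) : Polynomial.aeval y q =
      y ^ 2 + algebraMap k L (q.coeff 1) * y + algebraMap k L (q.coeff 0) :=
    (congrArg (Polynomial.aeval y) hq).trans (by simp)
  have hα : α ^ 2 + algebraMap k L (q.coeff 1) * α + algebraMap k L (q.coeff 0) = 0 :=
    (haeval α).symm.trans ((AdjoinRoot.aeval_eq q).trans AdjoinRoot.mk_self)
  have hroot : Polynomial.aeval (-algebraMap k L (q.coeff 1) - α) q = 0 := by
    rw [haeval]
    linear_combination hα
  have hmap : q.map (algebraMap k L) =
      (Polynomial.X - Polynomial.C α) *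
        (Polynomial.X - Polynomial.C (-algebraMap k L (q.coeff 1) - α)) := by
    refine (congrArg (Polynomial.map (algebraMap k L)) hq).trans ?_
    have hα' := congrArg Polynomial.C hα
    simp only [Polynomial.map_add, Polynomial.map_mul, Polynomial.map_pow, Polynomial.map_X,
      Polynomial.map_C, map_sub, map_neg, map_add, map_mul, map_pow, map_zero] at hα' ⊢
    linear_combination hα'
  refine ⟨-algebraMap k L (q.coeff 1) - α,
    AdjoinRoot.liftAlgHom q (Algebra.ofId k L) _ hroot, ?_, ?_, ?_, hmap⟩
  · exact AdjoinRoot.liftAlgHom_root ..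
  · rw [map_sub, map_neg, AlgHom.commutes,
      show AdjoinRoot.liftAlgHom q (Algebra.ofId k L) _ hroot α = _ from
        AdjoinRoot.liftAlgHom_root ..]
    ring
  · intro h
    have h1 := hsep.map (f := algebraMap k L)
    rw [hmap, ← h] at h1
    exact Polynomial.not_isUnit_X_sub_C α (h1.squarefree _ (dvd_refl _))

lemma AdjoinRoot.exists_eq_add_mul_root {k : Type*} [Field k] {q : Polynomial k}
    (hqm : q.Monic) (hq2 : q.natDegree = 2) (x : AdjoinRoot q) :
    ∃ r s : k, x = algebraMap k _ r + algebraMap k _ s * root q := by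
  obtain ⟨P, rfl⟩ := AdjoinRoot.mk_surjective x
  have h1 : AdjoinRoot.mk q P = AdjoinRoot.mk q (P %ₘ q) := by
    conv_lhs => rw [← Polynomial.modByMonic_add_div P q]
    rw [map_add, map_mul, AdjoinRoot.mk_self, zero_mul, add_zero]
  have hdeg : (P %ₘ q).natDegree ≤ 1 := by
    have := Polynomial.natDegree_modByMonic_lt P hqm (by rintro rfl; simp at hq2)
    omega
  refine ⟨(P %ₘ q).coeff 0, (P %ₘ q).coeff 1, ?_⟩
  rw [h1]
  conv_lhs => rw [Polynomial.eq_X_add_C_of_natDegree_le_one hdeg]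
  rw [map_add, map_mul, AdjoinRoot.mk_C, AdjoinRoot.mk_C, AdjoinRoot.mk_X, add_comm]
  rfl

namespace SIntegers

/-! ### Units that are small at one place -/

/-- If two valuations of `L` that are bounded by `1` on integers can be separated by some element
of `L`, then they have distinct centres in `𝓞 L`, and a generator of a power of the first centre is
small for the first valuation and a unit for the second. -/
lemma exists_valuation_lt_one {k : Type u} [Field k] [NumberField k]
    {S : Set (NFPlace k)} {L Γ : Type*} [Field L] [NumberField L] [Algebra k L]
    [LinearOrderedCommGroupWithZero Γ] (V₁ V₂ : Valuation L Γ)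
    (hV₁ : ∀ x : 𝓞 L, V₁ x ≤ 1) (hV₂ : ∀ x : 𝓞 L, V₂ x ≤ 1)
    {p : HeightOneSpectrum (𝓞 k)} (hp : NFPlace.finite p ∈ S)
    (hpV₁ : ∀ x ∈ p.asIdeal, V₁ (algebraMap k L (x : k)) < 1)
    (hpV₂ : ∀ x ∈ p.asIdeal, V₂ (algebraMap k L (x : k)) < 1)
    {z : L} (hz₁ : V₁ z < 1) (hz₂ : 1 < V₂ z) :
    ∃ w : 𝓞 L, w ≠ 0 ∧ V₁ w < 1 ∧ V₂ w = 1 ∧ IsIntegral (SIntegers k S) (w : L)⁻¹ := by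
  obtain ⟨h, π, hh, hπ0, hπ⟩ := p.exists_pow_eq_span
  have hπp : π ∈ p.asIdeal :=
    Ideal.pow_le_self hh (hπ ▸ Ideal.mem_span_singleton_self π)
  have center (V : Valuation L Γ) (hV : ∀ x : 𝓞 L, V x ≤ 1)
      (hpV : ∀ x ∈ p.asIdeal, V (algebraMap k L (x : k)) < 1) :
      ∃ P : HeightOneSpectrum (𝓞 L), ∀ x, x ∈ P.asIdeal ↔ V x < 1 := by
    let φ : 𝓞 L →+* V.valuationSubring := (algebraMap (𝓞 L) L).codRestrict V.valuationSubring hV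
    have hφ (x : 𝓞 L) : x ∈ (IsLocalRing.maximalIdeal V.valuationSubring).comap φ ↔ V x < 1 := by
      rw [Ideal.mem_comap, Valuation.mem_maximalIdeal_iff]
      rfl
    refine ⟨⟨(IsLocalRing.maximalIdeal V.valuationSubring).comap φ, inferInstance, ?_⟩, hφ⟩
    intro hbot
    have h1 : algebraMap (𝓞 k) (𝓞 L) π ∈ (IsLocalRing.maximalIdeal V.valuationSubring).comap φ :=
      (hφ _).2 (hpV π hπp)
    rw [hbot, Ideal.mem_bot] at h1
    have h2 := congrArg (algebraMap (𝓞 L) L) h1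
    rw [map_zero] at h2
    have h3 : algebraMap k L (π : k) = 0 := h2
    exact hπ0 (by simpa using h3)
  obtain ⟨P₁, hP₁⟩ := center V₁ hV₁ hpV₁
  obtain ⟨P₂, hP₂⟩ := center V₂ hV₂ hpV₂
  have hle (V : Valuation L Γ) (hV : ∀ x : 𝓞 L, V x ≤ 1) (P : HeightOneSpectrum (𝓞 L))
      (hP : ∀ x, x ∈ P.asIdeal ↔ V x < 1) (y : L) (hy : P.valuation L y ≤ 1) : V y ≤ 1 := by
    obtain ⟨a, s, hs⟩ := P.exists_primeCompl_mul_eq_of_integer y hy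
    have hVs : V (s : 𝓞 L) = 1 := le_antisymm (hV _) (not_lt.1 fun h => s.2 ((hP _).2 h))
    have h1 := congrArg V hs
    rw [map_mul] at h1
    have h2 : V y * V (s : 𝓞 L) = V a := h1
    rw [hVs, mul_one] at h2
    exact h2 ▸ hV a
  have hne : P₁ ≠ P₂ := by
    rintro rfl
    rcases (P₁.valuation L).val_le_one_or_val_inv_le_one z with h1 | h1
    · exact absurd (hle V₂ hV₂ P₁ hP₂ z h1) (not_le.2 hz₂)
    · have h2 := hle V₁ hV₁ P₁ hP₁ _ h1
      rw [map_inv₀] at h2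
      have hz0 : V₁ z ≠ 0 := by
        rw [Valuation.ne_zero_iff]
        rintro rfl
        rw [map_zero] at hz₂
        exact not_lt_zero hz₂
      exact absurd h2 (not_le.2 ((one_lt_inv₀ (zero_lt_iff.2 hz0)).2 hz₁))
  obtain ⟨h', w, hh', hw0, hw⟩ := P₁.exists_pow_eq_span
  have hwP : w ∈ P₁.asIdeal := Ideal.pow_le_self hh' (hw ▸ Ideal.mem_span_singleton_self w)
  refine ⟨w, hw0, (hP₁ _).1 hwP, le_antisymm (hV₂ _) (not_lt.1 fun h => hne ?_), ?_⟩
  · have h2 : P₁.asIdeal ^ h' ≤ P₂.asIdeal := by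
      rw [hw, Ideal.span_singleton_le_iff_mem]
      exact (hP₂ _).2 h
    have h3 : P₁.asIdeal ≤ P₂.asIdeal := P₂.isPrime.le_of_pow_le h2
    exact HeightOneSpectrum.ext (P₁.isMaximal.eq_of_le P₂.isPrime.ne_top h3)
  · have h1 : algebraMap (𝓞 k) (𝓞 L) π ^ h' ∈ P₁.asIdeal ^ h' :=
      Ideal.pow_mem_pow ((hP₁ _).2 (hpV₁ π hπp)) _
    rw [hw] at h1
    obtain ⟨t, ht⟩ := Ideal.mem_span_singleton.1 h1
    have ht' : algebraMap k L (π : k) ^ h' = (w : L) * (t : L) := by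
      have := congrArg (algebraMap (𝓞 L) L) ht
      rw [map_pow, map_mul] at this
      exact this
    have hw' : (w : L) ≠ 0 := by simpa using hw0
    have hπ' : algebraMap k L (π : k) ≠ 0 := by simpa using hπ0
    have e : (w : L)⁻¹ = (t : L) * algebraMap k L ((π : k)⁻¹) ^ h' := by
      rw [map_inv₀, inv_pow, ht']
      have ht0 : (t : L) ≠ 0 := by
        intro h0
        rw [h0, mul_zero] at ht'
        exact pow_ne_zero _ hπ' ht'
      field_simp
    rw [e]
    exact ((RingOfIntegers.isIntegral_coe t).tower_top).mul
      ((isIntegral_algebraMap (R := SIntegers k S) (A := L)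
        (x := ⟨_, inv_mem S hp hπ⟩)).pow _)

/-- Approximating the root `θ` of a linear polynomial: if `z` is topologically nilpotent and `z⁻¹`
an `S`-integer, then the fractions `θ + (N c)⁻¹ z ^ n` tend to `θ`. -/
theorem exists_div_mem_of_linear {k : Type u} [Field k] [NumberField k]
    {S : Set (NFPlace k)} {F : Type*} [Field F] [TopologicalSpace F] [IsTopologicalDivisionRing F]
    [Algebra k F] {z : k} (hz0 : z ≠ 0) (hz : z⁻¹ ∈ SIntegers k S)
    (hlim : Tendsto (fun n : ℕ => algebraMap k F z ^ n) atTop (𝓝 0)) (θ : k)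
    {N : SIntegers k S} (hN : N ≠ 0) {Ω : Set F} (hΩ : Ω ∈ 𝓝 (algebraMap k F θ)) :
    ∃ a b : SIntegers k S, b ≠ 0 ∧ N ∣ b ∧
      (∃ u : (SIntegers k S)ˣ, algebraMap (SIntegers k S) k u =
        algebraMap (SIntegers k S) k b ^ 1 * (Polynomial.X - Polynomial.C θ).eval
          (algebraMap (SIntegers k S) k a / algebraMap (SIntegers k S) k b)) ∧
      algebraMap k F (algebraMap (SIntegers k S) k a / algebraMap (SIntegers k S) k b) ∈ Ω ∧
      algebraMap k F (algebraMap (SIntegers k S) k a / algebraMap (SIntegers k S) k b) ≠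
        algebraMap k F θ := by
  obtain ⟨x, c, hc, hθ⟩ := IsFractionRing.div_surjective (A := SIntegers k S) θ
  have hc0 : c ≠ 0 := nonZeroDivisors.ne_zero hc
  have hck : (c : k) ≠ 0 := fun h => hc0 (Subtype.ext h)
  have hNk : (N : k) ≠ 0 := fun h => hN (Subtype.ext h)
  have hz1 : Tendsto (fun n : ℕ => algebraMap k F θ + algebraMap k F (N * c : k)⁻¹ *
      algebraMap k F z ^ n) atTop (𝓝 (algebraMap k F θ)) := by
    simpa using (hlim.const_mul (algebraMap k F (N * c : k)⁻¹)).const_add (algebraMap k F θ)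
  obtain ⟨n, hn⟩ := (hz1.eventually_mem hΩ).exists
  let w : SIntegers k S := ⟨z⁻¹, hz⟩
  have hw : (w : k) = z⁻¹ := rfl
  have hw0 : (w : k) ≠ 0 := inv_ne_zero hz0
  have hbk : ((N * c * w ^ n : SIntegers k S) : k) = N * c * (w : k) ^ n := rfl
  have hb0 : (N * c * (w : k) ^ n : k) ≠ 0 := mul_ne_zero (mul_ne_zero hNk hck) (pow_ne_zero _ hw0)
  have hak : ((1 + N * x * w ^ n : SIntegers k S) : k) = 1 + θ * (N * c * (w : k) ^ n) := by
    have hx : (x : k) = θ * c := by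
      rw [← hθ]
      exact (div_mul_cancel₀ _ hck).symm
    change 1 + (N : k) * x * (w : k) ^ n = _
    rw [hx]
    ring
  have hτ : algebraMap (SIntegers k S) k (1 + N * x * w ^ n) /
      algebraMap (SIntegers k S) k (N * c * w ^ n) = θ + (N * c : k)⁻¹ * z ^ n := by
    change ((1 + N * x * w ^ n : SIntegers k S) : k) / ((N * c * w ^ n : SIntegers k S) : k) = _
    rw [hak, hbk, add_div, mul_div_cancel_right₀ _ hb0, hw, inv_pow, one_div, mul_inv, inv_inv,
      add_comm]
  refine ⟨1 + N * x * w ^ n, N * c * w ^ n, fun h => hb0 (congrArg Subtype.val h),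
    ⟨c * w ^ n, mul_assoc _ _ _⟩, ⟨1, ?_⟩, ?_, ?_⟩
  · rw [hτ, Polynomial.eval_sub, Polynomial.eval_X, Polynomial.eval_C, add_sub_cancel_left]
    change (1 : k) = ((N * c * w ^ n : SIntegers k S) : k) ^ 1 * _
    rw [hbk, hw]
    field_simp
    rw [← mul_pow, one_div_mul_cancel hz0, one_pow]
  · rw [hτ, map_add, map_mul, map_pow]
    exact hn
  · rw [hτ, (algebraMap k F).injective.ne_iff]
    simp [hNk, hck, hz0]

/-- Approximating a root in `k` of a split quadratic polynomial. -/
theorem exists_div_mem_of_split {k : Type u} [Field k] [NumberField k]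
    {S : Set (NFPlace k)} {F : Type*} [Field F] [TopologicalSpace F] [IsTopologicalDivisionRing F]
    [T1Space F] [Algebra k F] {w₁ w₂ : 𝓞 k} (hw₁0 : w₁ ≠ 0) (hw₂0 : w₂ ≠ 0)
    (hw₁ : (w₁ : k)⁻¹ ∈ SIntegers k S) (hw₂ : (w₂ : k)⁻¹ ∈ SIntegers k S)
    (hlim : Tendsto (fun n : ℕ => algebraMap k F (w₁ / w₂ : k) ^ n) atTop (𝓝 0))
    {θ₁ θ₂ : k} (hθ : θ₁ ≠ θ₂)
    {N : SIntegers k S} (hN : N ≠ 0) {Ω : Set F} (hΩ : Ω ∈ 𝓝 (algebraMap k F θ₁)) :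
    ∃ a b : SIntegers k S, b ≠ 0 ∧ N ∣ b ∧
      (∃ u : (SIntegers k S)ˣ, algebraMap (SIntegers k S) k u =
        algebraMap (SIntegers k S) k b ^ 2 *
          ((Polynomial.X - Polynomial.C θ₁) * (Polynomial.X - Polynomial.C θ₂)).eval
            (algebraMap (SIntegers k S) k a / algebraMap (SIntegers k S) k b)) ∧
      algebraMap k F (algebraMap (SIntegers k S) k a / algebraMap (SIntegers k S) k b) ∈ Ω ∧
      algebraMap k F (algebraMap (SIntegers k S) k a / algebraMap (SIntegers k S) k b) ≠
        algebraMap k F θ₁ := by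
  refine exists_div_mem_of_tendsto (Algebra.ofId k F) hθ (Polynomial.map_id) hw₁0 hw₂0
    (isIntegral_algebraMap (R := SIntegers k S) (x := ⟨_, hw₁⟩))
    (isIntegral_algebraMap (R := SIntegers k S) (x := ⟨_, hw₂⟩)) (fun n => ⟨_, _, rfl, rfl⟩) ?_ hN hΩ
  simp only [← map_div₀]
  exact hlim

/-- Approximating a root `θ` of an irreducible quadratic polynomial, by means of the powers of a
number `w` of the quadratic extension with `w / σ w` topologically nilpotent. -/
theorem exists_div_mem_of_irreducible {k : Type u} [Field k] [NumberField k]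
    {S : Set (NFPlace k)} {F : Type*} [Field F] [TopologicalSpace F] [IsTopologicalDivisionRing F]
    [T1Space F] [Algebra k F] {q : Polynomial k} (hqm : q.Monic) (hq2 : q.natDegree = 2)
    [Fact (Irreducible q)] [NumberField (AdjoinRoot q)] (j : AdjoinRoot q →ₐ[k] F)
    {σ : AdjoinRoot q →ₐ[k] AdjoinRoot q} (hσ : AdjoinRoot.root q ≠ σ (AdjoinRoot.root q))
    (hqσ : q.map (algebraMap k (AdjoinRoot q)) = (Polynomial.X - Polynomial.C (AdjoinRoot.root q)) *
      (Polynomial.X - Polynomial.C (σ (AdjoinRoot.root q))))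
    {w : 𝓞 (AdjoinRoot q)} (hw0 : w ≠ 0)
    (hw : IsIntegral (SIntegers k S) (w : AdjoinRoot q)⁻¹)
    (hlim : Tendsto (fun n : ℕ => (j w / j (σ w)) ^ n) atTop (𝓝 0))
    {N : SIntegers k S} (hN : N ≠ 0) {Ω : Set F} (hΩ : Ω ∈ 𝓝 (j (AdjoinRoot.root q))) :
    ∃ a b : SIntegers k S, b ≠ 0 ∧ N ∣ b ∧
      (∃ u : (SIntegers k S)ˣ, algebraMap (SIntegers k S) k u =
        algebraMap (SIntegers k S) k b ^ 2 *
          q.eval (algebraMap (SIntegers k S) k a / algebraMap (SIntegers k S) k b)) ∧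
      algebraMap k F (algebraMap (SIntegers k S) k a / algebraMap (SIntegers k S) k b) ∈ Ω ∧
      algebraMap k F (algebraMap (SIntegers k S) k a / algebraMap (SIntegers k S) k b) ≠
        j (AdjoinRoot.root q) := by
  have hσw : ((RingOfIntegers.mapRingHom σ.toRingHom w : 𝓞 (AdjoinRoot q)) : AdjoinRoot q) =
    σ w := rfl
  have hσ0 : RingOfIntegers.mapRingHom σ.toRingHom w ≠ 0 := by
    intro h
    have h1 : σ (w : AdjoinRoot q) = 0 := hσw.symm.trans (by rw [h]; rfl)
    have h2 : (w : AdjoinRoot q) = 0 := (map_eq_zero_iff σ σ.injective).1 h1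
    exact hw0 (RingOfIntegers.ext h2)
  refine exists_div_mem_of_tendsto j hσ hqσ hw0 hσ0 hw ?_ ?_ ?_ hN hΩ
  · rw [hσw, ← map_inv₀]
    exact hw.map (σ.restrictScalars (SIntegers k S))
  · intro n
    obtain ⟨r, s, h⟩ := AdjoinRoot.exists_eq_add_mul_root hqm hq2 ((w : AdjoinRoot q) ^ n)
    have h' := congrArg σ h
    rw [map_pow, map_add, map_mul, σ.commutes, σ.commutes] at h'
    have hne : σ (AdjoinRoot.root q) - AdjoinRoot.root q ≠ 0 := sub_ne_zero.2 hσ.symm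
    refine ⟨r, -s, ?_, ?_⟩
    · rw [hσw, h, h', eq_div_iff hne, map_neg]
      ring
    · rw [h, map_neg]
      ring
  · exact hlim

/-! ### Infinite places -/

lemma tendsto_pow_infinite {k : Type u} [Field k] (v : InfinitePlace k) {x : k}
    (h : v x < 1) : Tendsto (fun n : ℕ => algebraMap k v.Completion x ^ n) atTop (𝓝 0) := by
  refine tendsto_pow_atTop_nhds_zero_of_norm_lt_one ?_
  exact (InfinitePlace.Completion.norm_coe v _).trans_lt h

/-- Given two infinite places, some unit is small at the first and large at the second: a unit that is
small at all places but the second is large there by the product formula. -/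
lemma exists_unit_lt_one_of_ne {L : Type*} [Field L] [NumberField L] {w w₁ : InfinitePlace L}
    (hw : w ≠ w₁) : ∃ u : (𝓞 L)ˣ, w (u : 𝓞 L) < 1 ∧ 1 < w₁ (u : 𝓞 L) := by
  classical
  obtain ⟨u, hu⟩ := NumberField.Units.dirichletUnitTheorem.exists_unit L w₁
  have hlt (w' : InfinitePlace L) (hw' : w' ≠ w₁) : w' (u : 𝓞 L) < 1 := by
    have h := hu w' hw'
    by_contra h1
    exact absurd h (not_lt.2 (Real.log_nonneg (not_lt.1 h1)))
  refine ⟨u, hlt w hw, ?_⟩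
  have h1 := InfinitePlace.prod_eq_abs_norm ((u : 𝓞 L) : L)
  rw [Units.norm] at h1
  by_contra hle
  rw [not_lt] at hle
  have hle' (w' : InfinitePlace L) : w' (u : 𝓞 L) ≤ 1 := by
    by_cases h : w' = w₁
    · rw [h]; exact hle
    · exact (hlt w' h).le
  have h2 : ∏ w' : InfinitePlace L, w' (u : 𝓞 L) ^ w'.mult < 1 := by
    rw [← Finset.mul_prod_erase _ _ (Finset.mem_univ w)]
    refine mul_lt_one_of_nonneg_of_lt_one_left (by positivity)
      (pow_lt_one₀ (apply_nonneg _ _) (hlt w hw) (InfinitePlace.mult_pos).ne') ?_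
    exact Finset.prod_le_one (fun _ _ => by positivity)
      fun w' _ => pow_le_one₀ (apply_nonneg _ _) (hle' w')
  rw [h1] at h2
  simp at h2

/-- In a quadratic extension of `k` contained in the completion at an infinite place `v`, some unit
is small in the given embedding and large in the conjugate one. -/
lemma exists_unit_infinite {k L : Type*} [Field k] [NumberField k] [Field L] [NumberField L]
    [Algebra k L] (v : InfinitePlace k) (j : L →ₐ[k] v.Completion) (σ : L →ₐ[k] L) {α : L}
    (hα : σ α ≠ α) : ∃ u : (𝓞 L)ˣ, ‖j (u : 𝓞 L)‖ < 1 ∧ 1 < ‖j (σ (u : 𝓞 L))‖ := by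
  let e : v.Completion →+* ℂ := InfinitePlace.Completion.extensionEmbedding v
  have he : Continuous e := (InfinitePlace.Completion.isometry_extensionEmbedding v).continuous
  let ψ₁ : L →+* ℂ := e.comp j.toRingHom
  let ψ₂ : L →+* ℂ := e.comp (j.comp σ).toRingHom
  have hnorm (x : v.Completion) : ‖e x‖ = ‖x‖ :=
    (InfinitePlace.Completion.isometry_extensionEmbedding v).norm_map_of_map_zero (map_zero e) x
  have hne : InfinitePlace.mk ψ₁ ≠ InfinitePlace.mk ψ₂ := by
    rw [Ne, InfinitePlace.mk_eq_iff]
    have h12 : ψ₁ ≠ ψ₂ := by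
      intro h
      have h1 : e (j α) = e (j (σ α)) := DFunLike.congr_fun h α
      exact hα (j.injective (e.injective h1)).symm
    rintro (h | h)
    · exact h12 h
    · -- the two embeddings agree on `k`, so `e` is fixed by complex conjugation
      have hconj : ∀ x : v.Completion, (starRingEnd ℂ) (e x) = e x := by
        intro x
        induction x using InfinitePlace.Completion.induction_on with
        | hp => exact isClosed_eq (Complex.continuous_conj.comp he) he
        | ih a =>
          have h1 := DFunLike.congr_fun h (algebraMap k L (WithAbs.equiv v.1 a))
          have h2 : (starRingEnd ℂ) (e (j (algebraMap k L (WithAbs.equiv v.1 a)))) =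
            e (j (σ (algebraMap k L (WithAbs.equiv v.1 a)))) := h1
          rw [σ.commutes, j.commutes] at h2
          exact h2
      refine h12 ?_
      rw [← h]
      ext x
      exact (hconj (j x)).symm
  obtain ⟨u, h1, h2⟩ := exists_unit_lt_one_of_ne hne
  refine ⟨u, ?_, ?_⟩
  · rw [← hnorm]; exact h1
  · rw [← hnorm]; exact h2

lemma isUnit_iff_apply_eq_one {k : Type*} [Field k] [NumberField k] {v : InfinitePlace k}
    (hv : ∀ w, w = v) {x : 𝓞 k} : IsUnit x ↔ v x = 1 := by
  have h1 := InfinitePlace.prod_eq_abs_norm (x : k)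
  have h2 : ∏ w : InfinitePlace k, w (x : k) ^ w.mult = v (x : k) ^ v.mult := by
    refine Finset.prod_eq_single v (fun w _ hw => absurd (hv w) hw) fun h => ?_
    exact absurd (Finset.mem_univ v) h
  rw [h2] at h1
  rw [NumberField.isUnit_iff_norm, RingOfIntegers.coe_norm]
  rw [← pow_eq_one_iff_of_nonneg (apply_nonneg v _) (InfinitePlace.mult_pos (w := v)).ne', h1]
  norm_cast

/-! ### Finite places -/

lemma tendsto_pow_finite {k : Type u} [Field k] [NumberField k] (p : HeightOneSpectrum (𝓞 k))
    {x : k} (h : p.valuation k x < 1) :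
    Tendsto (fun n : ℕ => algebraMap k (p.adicCompletion k) x ^ n) atTop (𝓝 0) := by
  refine Valued.tendsto_zero_pow_of_v_lt_one ?_
  exact (p.valuedAdicCompletion_eq_valuation' x).trans_lt h

lemma valued_lt_one_mem_nhds_zero {k : Type u} [Field k] [NumberField k]
    (p : HeightOneSpectrum (𝓞 k)) : {x : p.adicCompletion k | Valued.v x < 1} ∈ 𝓝 0 := by
  rw [Valued.mem_nhds_zero]
  refine ⟨1, fun x hx => ?_⟩
  simpa using hx

/-- In a quadratic extension of `k` contained in the completion at a finite place `p ∈ S`, some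
integer is an `S`-unit, small in the given embedding and a unit in the conjugate one. -/
lemma exists_integer_finite {k L : Type u} [Field k] [NumberField k] [Field L] [NumberField L]
    [Algebra k L] {S : Set (NFPlace k)} (p : HeightOneSpectrum (𝓞 k)) (hp : NFPlace.finite p ∈ S)
    (j : L →ₐ[k] p.adicCompletion k) (σ : L →ₐ[k] L) {α : L}
    (hα : σ α ≠ α) (hσ : σ (σ α) = α) :
    ∃ w : 𝓞 L, w ≠ 0 ∧ IsIntegral (SIntegers k S) (w : L)⁻¹ ∧
      Tendsto (fun n : ℕ => (j w / j (σ w)) ^ n) atTop (𝓝 0) := by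
  let V : Valuation (p.adicCompletion k) _ := Valued.v
  let V₁ := V.comap j.toRingHom
  let V₂ := V.comap (j.comp σ).toRingHom
  have hV (x : 𝓞 k) : V (algebraMap k (p.adicCompletion k) x) = p.valuation k x :=
    p.valuedAdicCompletion_eq_valuation' (x : k)
  have hint (i : L →ₐ[k] p.adicCompletion k) (x : 𝓞 L) : V (i x) ≤ 1 := by
    obtain ⟨P, hP, h1⟩ := RingOfIntegers.isIntegral_coe x
    have h2 : IsIntegral V.valuationSubring (i x) := by
      refine ⟨P.map (Int.castRingHom _), hP.map _, ?_⟩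
      rw [Polynomial.eval₂_map, Subsingleton.elim (RingHom.comp _ _)
        ((i : L →+* p.adicCompletion k).comp (algebraMap ℤ L))]
      have h3 := congrArg (i : L →+* p.adicCompletion k) h1
      rwa [Polynomial.hom_eval₂, map_zero] at h3
    obtain ⟨y, hy⟩ := IsIntegrallyClosed.isIntegral_iff.1 h2
    rw [← hy]
    exact y.2
  have hVp (i : L →ₐ[k] p.adicCompletion k) (x : 𝓞 k) (hx : x ∈ p.asIdeal) :
      V (i (algebraMap k L x)) < 1 := by
    rw [i.commutes, hV]
    exact (p.valuation_lt_one_iff_mem x).2 hx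
  -- an element `c` of `k` which is closer to `α` than to its conjugate
  obtain ⟨c, hc⟩ : ∃ c : k, V ((j α - algebraMap k _ c) / (j (σ α) - algebraMap k _ c)) < 1 := by
    have hne : j (σ α) - j α ≠ 0 := sub_ne_zero.2 fun h => hα (j.injective h)
    have h1 : ContinuousAt (fun x => (j α - x) / (j (σ α) - x)) (j α) :=
      (continuousAt_const.sub continuousAt_id).div (continuousAt_const.sub continuousAt_id) hne
    have h2 : {x | V ((j α - x) / (j (σ α) - x)) < 1} ∈ 𝓝 (j α) := by
      refine h1.preimage_mem_nhds (t := {x | V x < 1}) ?_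
      rw [sub_self, zero_div]
      exact valued_lt_one_mem_nhds_zero p
    obtain ⟨_, h3, c, rfl⟩ := mem_closure_iff_nhds.1 (p.denseRange_algebraMap (K := k) (j α)) _ h2
    exact ⟨c, h3⟩
  have hy : α - algebraMap k L c ≠ 0 := by
    intro h
    rw [sub_eq_zero] at h
    exact hα (by rw [h, σ.commutes])
  have hσy : σ α - algebraMap k L c ≠ 0 := by
    intro h
    rw [sub_eq_zero] at h
    have h1 := congrArg σ h
    rw [hσ, σ.commutes] at h1
    exact hα (h.trans h1.symm)
  have hz₁ : V₁ ((α - algebraMap k L c) / (σ α - algebraMap k L c)) < 1 := by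
    change V (j _) < 1
    rwa [map_div₀, map_sub, map_sub, j.commutes]
  have hz₂ : 1 < V₂ ((α - algebraMap k L c) / (σ α - algebraMap k L c)) := by
    change 1 < V (j (σ _))
    rw [map_div₀ σ, map_sub, map_sub, hσ, σ.commutes, ← inv_div, map_inv₀, map_inv₀]
    refine (one_lt_inv₀ (zero_lt_iff.2 ?_)).2 hz₁
    exact (V.ne_zero_iff).2 ((map_ne_zero_iff j j.injective).2 (div_ne_zero hy hσy))
  obtain ⟨w, hw0, hw₁, hw₂, hw⟩ := exists_valuation_lt_one V₁ V₂ (hint j) (hint (j.comp σ)) hp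
    (hVp j) (hVp (j.comp σ)) hz₁ hz₂
  refine ⟨w, hw0, hw, Valued.tendsto_zero_pow_of_v_lt_one ?_⟩
  change V (j w) < 1 at hw₁
  change V (j (σ w)) = 1 at hw₂
  change V (j w / j (σ w)) < 1
  rwa [map_div₀, hw₂, div_one]

/-! ### Approximation of algebraic numbers of degree at most two -/

/-- Approximation of a root of a squarefree polynomial of degree at most two, given what it takes in
each of the cases: a topologically nilpotent inverse of an `S`-integer for a linear polynomial, two
`S`-units with topologically nilpotent quotient for a product of linear factors, and an `S`-unit of
the quadratic extension with this property relative to its conjugate for an irreducible one. -/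
theorem exists_div_mem_of {k : Type u} [Field k] [NumberField k]
    {S : Set (NFPlace k)} {F : Type u} [Field F] [TopologicalSpace F] [IsTopologicalDivisionRing F]
    [T1Space F] [Algebra k F] {q : Polynomial k} (hqm : q.Monic) (hqs : Squarefree q)
    (hq2 : q.natDegree ≤ 2)
    (hlin : ∃ z : k, z ≠ 0 ∧ z⁻¹ ∈ SIntegers k S ∧
      Tendsto (fun n : ℕ => algebraMap k F z ^ n) atTop (𝓝 0))
    (hsplit : ∀ θ₁ θ₂ : k, θ₁ ≠ θ₂ →
      q = (Polynomial.X - Polynomial.C θ₁) * (Polynomial.X - Polynomial.C θ₂) →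
      ∃ w₁ w₂ : 𝓞 k, w₁ ≠ 0 ∧ w₂ ≠ 0 ∧ (w₁ : k)⁻¹ ∈ SIntegers k S ∧ (w₂ : k)⁻¹ ∈ SIntegers k S ∧
        Tendsto (fun n : ℕ => algebraMap k F (w₁ / w₂ : k) ^ n) atTop (𝓝 0))
    (hirr : ∀ (L : Type u) [Field L] [NumberField L] [Algebra k L] (j : L →ₐ[k] F) (σ : L →ₐ[k] L)
      (α : L), σ α ≠ α → σ (σ α) = α → ∃ w : 𝓞 L, w ≠ 0 ∧ IsIntegral (SIntegers k S) (w : L)⁻¹ ∧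
        Tendsto (fun n : ℕ => (j w / j (σ w)) ^ n) atTop (𝓝 0))
    {θ : F} (hθ : q.eval₂ (algebraMap k F) θ = 0) {N : SIntegers k S} (hN : N ≠ 0) {Ω : Set F}
    (hΩ : Ω ∈ 𝓝 θ) :
    ∃ a b : SIntegers k S, b ≠ 0 ∧ N ∣ b ∧
      (∃ u : (SIntegers k S)ˣ, algebraMap (SIntegers k S) k u =
        algebraMap (SIntegers k S) k b ^ q.natDegree *
          q.eval (algebraMap (SIntegers k S) k a / algebraMap (SIntegers k S) k b)) ∧
      algebraMap k F (algebraMap (SIntegers k S) k a / algebraMap (SIntegers k S) k b) ∈ Ω ∧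
      algebraMap k F (algebraMap (SIntegers k S) k a / algebraMap (SIntegers k S) k b) ≠ θ := by
  have hlin_eq (r : Polynomial k) (hr : r.Monic) (hr1 : r.natDegree = 1) :
      ∃ c, r = Polynomial.X - Polynomial.C c := by
    refine ⟨-r.coeff 0, ?_⟩
    rw [Polynomial.C_neg, sub_neg_eq_add]
    exact hr.eq_X_add_C hr1
  rcases Nat.lt_or_ge q.natDegree 1 with h0 | h1
  · rw [Polynomial.eq_one_of_monic_natDegree_zero hqm (by omega)] at hθ
    simp at hθ
  rcases Nat.lt_or_ge q.natDegree 2 with h1' | h2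
  · have hd : q.natDegree = 1 := by omega
    obtain ⟨c, rfl⟩ := hlin_eq q hqm hd
    rw [hd]
    obtain ⟨z, hz0, hz, hlim⟩ := hlin
    have hc : θ = algebraMap k F c := by
      simpa [sub_eq_zero] using hθ
    rw [hc] at hΩ ⊢
    exact exists_div_mem_of_linear hz0 hz hlim c hN hΩ
  have hd : q.natDegree = 2 := by omega
  rw [hd]
  by_cases hirred : Irreducible q
  · have : Fact (Irreducible q) := ⟨hirred⟩
    have : Module.Finite k (AdjoinRoot q) := (AdjoinRoot.powerBasis hqm.ne_zero).finite
    have : NumberField (AdjoinRoot q) := NumberField.of_module_finite k _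
    obtain ⟨ϑ, σ, hσ₁, hσ₂, hne, hmap⟩ := AdjoinRoot.exists_conj hqm hd hirred.separable
    let j : AdjoinRoot q →ₐ[k] F := AdjoinRoot.liftAlgHom q (Algebra.ofId k F) θ hθ
    have hj : j (AdjoinRoot.root q) = θ := AdjoinRoot.liftAlgHom_root ..
    obtain ⟨w, hw0, hw, hlim⟩ := hirr (AdjoinRoot q) j σ (AdjoinRoot.root q)
      (hσ₁.trans_ne hne.symm) (by rw [hσ₁, hσ₂])
    rw [← hj] at hΩ ⊢
    subst hσ₁
    exact exists_div_mem_of_irreducible hqm hd j hne hmap hw0 hw hlim hN hΩ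
  · have hroot : ∃ c, q.IsRoot c := by
      by_contra h
      push Not at h
      refine hirred ((hqm.irreducible_iff_roots_eq_zero_of_degree_le_three (by omega) (by omega)).2
        (Multiset.eq_zero_of_forall_notMem fun c hc => h c (Polynomial.isRoot_of_mem_roots hc)))
    obtain ⟨c₁, hc₁⟩ := hroot
    obtain ⟨r, hr⟩ := Polynomial.dvd_iff_isRoot.2 hc₁
    have hrm : r.Monic := (Polynomial.monic_X_sub_C c₁).of_mul_monic_left (hr ▸ hqm)
    have hr1 : r.natDegree = 1 := by
      have := congrArg Polynomial.natDegree hr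
      rw [(Polynomial.monic_X_sub_C c₁).natDegree_mul hrm, Polynomial.natDegree_X_sub_C, hd] at this
      omega
    obtain ⟨c₂, rfl⟩ := hlin_eq r hrm hr1
    have hne : c₁ ≠ c₂ := by
      rintro rfl
      exact Polynomial.not_isUnit_X_sub_C c₁ (hqs _ (hr ▸ dvd_rfl))
    have hθ' : θ = algebraMap k F c₁ ∨ θ = algebraMap k F c₂ := by
      rw [hr, Polynomial.eval₂_mul] at hθ
      simpa [sub_eq_zero] using hθ
    obtain ⟨θ₁, θ₂, h12, hq, hθ₁⟩ : ∃ θ₁ θ₂ : k, θ₁ ≠ θ₂ ∧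
        q = (Polynomial.X - Polynomial.C θ₁) * (Polynomial.X - Polynomial.C θ₂) ∧
        θ = algebraMap k F θ₁ := by
      rcases hθ' with h | h
      · exact ⟨c₁, c₂, hne, hr, h⟩
      · exact ⟨c₂, c₁, hne.symm, hr.trans (mul_comm _ _), h⟩
    obtain ⟨w₁, w₂, hw₁0, hw₂0, hw₁, hw₂, hlim⟩ := hsplit θ₁ θ₂ h12 hq
    rw [hθ₁] at hΩ ⊢
    rw [hq]
    exact exists_div_mem_of_split hw₁0 hw₂0 hw₁ hw₂ hlim h12 hN hΩ

variable {k : Type u} [Field k] [NumberField k] {S : Set (NFPlace k)}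

lemma exists_unit_tendsto_infinite {L : Type*} [Field L] [NumberField L]
    [Algebra k L] (v : InfinitePlace k) (j : L →ₐ[k] v.Completion) (σ : L →ₐ[k] L) {α : L}
    (hα : σ α ≠ α) :
    ∃ u : (𝓞 L)ˣ, Tendsto (fun n : ℕ => (j (u : 𝓞 L) / j (σ (u : 𝓞 L))) ^ n) atTop (𝓝 0) := by
  obtain ⟨u, h1, h2⟩ := exists_unit_infinite v j σ hα
  refine ⟨u, tendsto_pow_atTop_nhds_zero_of_norm_lt_one ?_⟩
  rw [norm_div]
  exact (div_lt_one (zero_lt_one.trans h2)).2 (h1.trans h2)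

lemma coe_unit_inv {L : Type*} [Field L] (u : (𝓞 L)ˣ) :
    ((u : 𝓞 L) : L)⁻¹ = ((u⁻¹ : (𝓞 L)ˣ) : 𝓞 L) :=
  inv_eq_of_mul_eq_one_right (congrArg (algebraMap (𝓞 L) L) u.mul_inv)

/-- If `k` has a single infinite place and `S` no finite ones, all conjugates of a unit have absolute
value `1`, and so there are only finitely many units. -/
lemma finite_units (v : InfinitePlace k) (hv : ∀ w, w = v)
    (hS : ∀ p, NFPlace.finite p ∉ S) : Finite (SIntegers k S)ˣ := by
  have hint (x : SIntegers k S) : ∃ y : 𝓞 k, (y : k) = x :=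
    HeightOneSpectrum.mem_integers_of_valuation_le_one k (x : k) fun p => x.2 p (hS p)
  have hfin := (NumberField.Embeddings.finite_of_norm_le k ℂ 1).to_subtype
  refine Finite.of_injective (β := {x : k | IsIntegral ℤ x ∧ ∀ φ : k →+* ℂ, ‖φ x‖ ≤ 1})
    (fun u => ⟨((u : SIntegers k S) : k), ?_, fun φ => ?_⟩) ?_
  · obtain ⟨y, hy⟩ := hint u
    rw [← hy]
    exact RingOfIntegers.isIntegral_coe y
  · obtain ⟨y, hy⟩ := hint u
    obtain ⟨y', hy'⟩ := hint (u⁻¹ : (SIntegers k S)ˣ)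
    have h1 : y * y' = 1 := by
      refine RingOfIntegers.ext ?_
      change (y : k) * (y' : k) = 1
      rw [hy, hy']
      exact congrArg Subtype.val u.mul_inv
    have h2 := (isUnit_iff_apply_eq_one hv).1 (IsUnit.of_mul_eq_one _ h1)
    rw [hy] at h2
    have h3 : InfinitePlace.mk φ ((u : SIntegers k S) : k) = 1 := by rw [hv (InfinitePlace.mk φ), h2]
    exact h3.le
  · intro u u' h
    have h' := Subtype.ext_iff.1 h
    exact Units.ext (Subtype.ext h')

/-- Two `S`-units whose quotient is small at an infinite place `v`: units, if there is another
infinite place, or else a generator of a power of a prime in `S`, whose absolute value at `v` is not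
`1` since it is not a unit. -/
lemma exists_split_infinite (v : InfinitePlace k)
    (hu : (∀ p, NFPlace.finite p ∉ S) → Infinite (SIntegers k S)ˣ) :
    ∃ w₁ w₂ : 𝓞 k, w₁ ≠ 0 ∧ w₂ ≠ 0 ∧ (w₁ : k)⁻¹ ∈ SIntegers k S ∧ (w₂ : k)⁻¹ ∈ SIntegers k S ∧
      Tendsto (fun n : ℕ => algebraMap k v.Completion (w₁ / w₂ : k) ^ n) atTop (𝓝 0) := by
  have h11 : ((1 : 𝓞 k) : k) = 1 := rfl
  have h1 : ((1 : 𝓞 k) : k)⁻¹ ∈ SIntegers k S := by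
    rw [h11, inv_one]
    exact one_mem _
  by_cases hv : ∃ w, w ≠ v
  · obtain ⟨w, hw⟩ := hv
    obtain ⟨u, hu1, -⟩ := exists_unit_lt_one_of_ne hw.symm
    refine ⟨u, 1, u.ne_zero, one_ne_zero, ?_, h1, tendsto_pow_infinite v ?_⟩
    · rw [coe_unit_inv]
      exact algebraMap_mem _ _
    · rwa [h11, div_one]
  · push Not at hv
    by_cases hS : ∃ p, NFPlace.finite p ∈ S
    · obtain ⟨p, hp⟩ := hS
      obtain ⟨h, π, hh, hπ0, hπ⟩ := p.exists_pow_eq_span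
      have hπ1 : v π ≠ 1 := by
        rw [Ne, ← isUnit_iff_apply_eq_one hv]
        intro hunit
        rw [Ideal.span_singleton_eq_top.2 hunit] at hπ
        exact p.isPrime.ne_top (top_le_iff.1 (hπ.symm.le.trans (Ideal.pow_le_self hh)))
      have hinv := inv_mem S hp hπ
      rcases lt_or_gt_of_ne hπ1 with hlt | hlt
      · refine ⟨π, 1, hπ0, one_ne_zero, hinv, h1, tendsto_pow_infinite v ?_⟩
        rwa [h11, div_one]
      · refine ⟨1, π, one_ne_zero, hπ0, h1, hinv, tendsto_pow_infinite v ?_⟩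
        rw [h11, one_div, map_inv₀]
        exact inv_lt_one_of_one_lt₀ hlt
    · push Not at hS
      exact absurd (hu hS) (not_infinite_iff_finite.2 (finite_units v hv hS))

end SIntegers

namespace NFPlace

variable {k : Type u} [Field k] [NumberField k]

instance (v : NFPlace k) : IsTopologicalDivisionRing v.Completion :=
  match v with
  | infinite w => inferInstanceAs (IsTopologicalDivisionRing w.Completion)
  | finite p => inferInstanceAs (IsTopologicalDivisionRing (p.adicCompletion k))

instance (v : NFPlace k) : T1Space v.Completion :=
  match v with
  | infinite w => inferInstanceAs (T1Space w.Completion)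
  | finite p => inferInstanceAs (T1Space (p.adicCompletion k))

end NFPlace

/-- A root in `k_v` of a squarefree polynomial `q` of degree at most two can be approximated by
fractions `a / b` of `S`-integers, with `b` divisible by a given `N`, at which the form defined by
`q` takes unit values. If `q` is a product of two linear factors over `k` and there are no finite
places in `S`, this requires infinitely many units. -/
theorem SIntegers.exists_div_mem {k : Type u} [Field k] [NumberField k] {S : Set (NFPlace k)}
    {v : NFPlace k} (hv : v ∈ S) {q : Polynomial k} (hqm : q.Monic) (hqs : Squarefree q)
    (hq2 : q.natDegree ≤ 2)
    (hu : ∀ θ₁ θ₂ : k, q = (Polynomial.X - Polynomial.C θ₁) * (Polynomial.X - Polynomial.C θ₂) →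
      (∀ p, NFPlace.finite p ∉ S) → Infinite (SIntegers k S)ˣ)
    {θ : v.Completion} (hθ : q.eval₂ (algebraMap k v.Completion) θ = 0) {N : SIntegers k S}
    (hN : N ≠ 0) {Ω : Set v.Completion} (hΩ : Ω ∈ 𝓝 θ) :
    ∃ a b : SIntegers k S, b ≠ 0 ∧ N ∣ b ∧
      (∃ u : (SIntegers k S)ˣ, algebraMap (SIntegers k S) k u =
        algebraMap (SIntegers k S) k b ^ q.natDegree *
          q.eval (algebraMap (SIntegers k S) k a / algebraMap (SIntegers k S) k b)) ∧
      algebraMap k v.Completion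
        (algebraMap (SIntegers k S) k a / algebraMap (SIntegers k S) k b) ∈ Ω ∧
      algebraMap k v.Completion
        (algebraMap (SIntegers k S) k a / algebraMap (SIntegers k S) k b) ≠ θ := by
  refine exists_div_mem_of hqm hqs hq2 ?_ ?_ ?_ hθ hN hΩ
  · match v with
    | .infinite w =>
      refine ⟨2⁻¹, by norm_num, ?_, tendsto_pow_infinite w ?_⟩
      · rw [inv_inv]
        exact one_add_one_eq_two (R := k) ▸ add_mem (one_mem _) (one_mem _)
      · rw [map_inv₀]
        have h2 : w (2 : k) = 2 := by
          rw [← InfinitePlace.norm_embedding_eq, map_ofNat, Complex.norm_ofNat]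
        rw [h2]
        norm_num
    | .finite p =>
      obtain ⟨h, π, hh, hπ0, hπ⟩ := p.exists_pow_eq_span
      refine ⟨π, by simpa using hπ0, inv_mem S hv hπ, tendsto_pow_finite p ?_⟩
      exact (p.valuation_lt_one_iff_mem π).2
        (Ideal.pow_le_self hh (hπ ▸ Ideal.mem_span_singleton_self π))
  · intro θ₁ θ₂ _ hq
    have h11 : ((1 : 𝓞 k) : k) = 1 := rfl
    match v with
    | .infinite w => exact exists_split_infinite w (hu θ₁ θ₂ hq)
    | .finite p =>
      obtain ⟨h, π, hh, hπ0, hπ⟩ := p.exists_pow_eq_span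
      refine ⟨π, 1, hπ0, one_ne_zero, inv_mem S hv hπ, ?_, tendsto_pow_finite p ?_⟩
      · rw [h11, inv_one]
        exact one_mem _
      · rw [h11, div_one]
        exact (p.valuation_lt_one_iff_mem π).2
          (Ideal.pow_le_self hh (hπ ▸ Ideal.mem_span_singleton_self π))
  · intro L _ _ _ j σ α hα hσ
    match v with
    | .infinite w =>
      obtain ⟨u, hu⟩ := exists_unit_tendsto_infinite w j σ hα
      refine ⟨u, u.ne_zero, ?_, hu⟩
      rw [coe_unit_inv]
      exact (RingOfIntegers.isIntegral_coe _).tower_top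
    | .finite p => exact exists_integer_finite p hv j σ hα hσ

end

/-! ### Integral points and units -/

/-- In a Dedekind domain, a nonzero element with infinitely many divisors forces infinitely many
units, since it lies in finitely many ideals. -/
lemma IsDedekindDomain.infinite_units_of_infinite_dvd {O : Type*} [CommRing O] [IsDedekindDomain O]
    {N : O} (hN : N ≠ 0) (h : {o : O | o ∣ N}.Infinite) : Infinite Oˣ := by
  by_contra hfin
  rw [not_infinite_iff_finite] at hfin
  have hI : Ideal.span {N} ≠ (0 : Ideal O) := mt Ideal.span_singleton_eq_bot.1 hN
  have h1 : {I : Ideal O | I ∣ Ideal.span {N}}.Finite :=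
    Set.finite_coe_iff.1 (UniqueFactorizationMonoid.fintypeSubtypeDvd _ hI).finite
  refine h ((h1.preimage' (f := fun o : O => Ideal.span {o}) fun I _ => ?_).subset ?_)
  · by_cases hne : ∃ o : O, Ideal.span {o} = I
    · obtain ⟨o, rfl⟩ := hne
      refine (Set.finite_range fun u : Oˣ => o * u).subset fun o' ho' => ?_
      obtain ⟨u, hu⟩ := Ideal.span_singleton_eq_span_singleton.1 (Eq.symm ho')
      exact ⟨u, hu⟩
    · convert Set.finite_empty
      ext o
      exact ⟨fun ho => hne ⟨o, ho⟩, fun ho => ho.elim⟩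
  · intro o ho
    exact Ideal.dvd_span_singleton.2 (Ideal.mem_span_singleton.2 ho)

lemma mem_range_of_forall_localSubring {O k : Type*} [CommRing O] [IsDomain O] [Field k]
    [Algebra O k] [IsFractionRing O k] {x : k}
    (h : ∀ p : PrimeSpectrum O, x ∈ localSubring k p.asIdeal) :
    ∃ o : O, algebraMap O k o = x := by
  have h1 : x ∈ ⨅ p : PrimeSpectrum O,
      Localization.subalgebra.ofField k _ p.asIdeal.primeCompl_le_nonZeroDivisors :=
    Algebra.mem_iInf.2 h
  rw [PrimeSpectrum.iInf_localization_eq_bot] at h1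
  exact Algebra.mem_bot.1 h1

namespace AlgebraicGeometry

section

variable {O k : Type u} [CommRing O] [IsDomain O] [Field k] [Algebra O k] [IsFractionRing O k]
  {M C : Scheme.{u}} {g : M ⟶ Spec (CommRingCat.of O)} {f : C ⟶ Spec (CommRingCat.of k)} {ι : C ⟶ M}

lemma constMap_comp_SpecMap {A B : Type u} [CommRing A] [CommRing B] {X : Scheme.{u}}
    (h : X ⟶ Spec (CommRingCat.of B)) (φ : A →+* B) (U : X.Opens) (c : A) :
    constMap (h ≫ Spec.map (CommRingCat.ofHom φ)) U c = constMap h U (φ c) := by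
  have h1 : CommRingCat.ofHom φ ≫ (Scheme.ΓSpecIso (CommRingCat.of B)).inv =
      (Scheme.ΓSpecIso (CommRingCat.of A)).inv ≫
        (Spec.map (CommRingCat.ofHom φ)).appLE ⊤ ⊤ le_top := by
    rw [Scheme.ΓSpecIso_inv_naturality]
    exact congrArg (_ ≫ ·) (Scheme.Hom.app_eq_appLE (Spec.map (CommRingCat.ofHom φ)))
  have h2 := Scheme.Hom.appLE_comp_appLE h (Spec.map (CommRingCat.ofHom φ)) ⊤ ⊤ U le_top
    (le_preimage_top h U)
  have h3 : (Scheme.ΓSpecIso (CommRingCat.of A)).inv ≫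
      (h ≫ Spec.map (CommRingCat.ofHom φ)).appLE ⊤ U (le_preimage_top _ U) =
      CommRingCat.ofHom φ ≫ (Scheme.ΓSpecIso (CommRingCat.of B)).inv ≫
        h.appLE ⊤ U (le_preimage_top h U) := by
    rw [← h2, ← Category.assoc, ← h1, Category.assoc]
  exact congrArg (fun z => z.hom c) h3

omit [IsDomain O] [IsFractionRing O k] in
lemma app_constMap_base
    (hι : IsPullback ι f g (Spec.map (CommRingCat.ofHom (algebraMap O k)))) (U : M.Opens) (c : O) :
    ι.app U (constMap g U c) = constMap f (ι ⁻¹ᵁ U) (algebraMap O k c) := by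
  rw [← constMap_comp_SpecMap]
  have h := congrArg (fun z => z c) (app_comp_constMap g ι U)
  have h1 : constMap (ι ≫ g) (ι ⁻¹ᵁ U) =
      constMap (f ≫ Spec.map (CommRingCat.ofHom (algebraMap O k))) (ι ⁻¹ᵁ U) := by rw [hι.w]
  exact h.trans (congrArg (fun z => z c) h1)

/-- Functions on an affine open of the generic fibre of a model have multiples that extend to the
model. -/
lemma exists_constMap_mul_eq_app
    (hι : IsPullback ι f g (Spec.map (CommRingCat.ofHom (algebraMap O k)))) {U : M.Opens}
    (hU : IsAffineOpen U) (c : Γ(C, ι ⁻¹ᵁ U)) :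
    ∃ (N : O) (m : Γ(M, U)), N ≠ 0 ∧ constMap f (ι ⁻¹ᵁ U) (algebraMap O k N) * c = ι.app U m := by
  have : IsAffineHom ι := MorphismProperty.of_isPullback hι.flip inferInstance
  have hUι : IsAffineOpen (ι ⁻¹ᵁ U) := hU.preimage ι
  -- the functions with an extending multiple form a subring, and `ι ⁻¹ᵁ U` is also the fibre
  -- product over it
  let B : Subring Γ(C, ι ⁻¹ᵁ U) :=
    { carrier := {c | ∃ (N : O) (m : Γ(M, U)), N ≠ 0 ∧
        constMap f (ι ⁻¹ᵁ U) (algebraMap O k N) * c = ι.app U m}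
      mul_mem' := by
        rintro c c' ⟨N, m, hN, h⟩ ⟨N', m', hN', h'⟩
        refine ⟨N * N', m * m', mul_ne_zero hN hN', ?_⟩
        rw [map_mul, map_mul, map_mul, ← h, ← h']
        ring
      one_mem' := ⟨1, 1, one_ne_zero, by simp⟩
      add_mem' := by
        rintro c c' ⟨N, m, hN, h⟩ ⟨N', m', hN', h'⟩
        refine ⟨N * N', constMap g U N' * m + constMap g U N * m', mul_ne_zero hN hN', ?_⟩
        rw [map_mul, map_mul, map_add, map_mul, map_mul, ← h, ← h', app_constMap_base hι,
          app_constMap_base hι]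
        ring
      zero_mem' := ⟨1, 0, one_ne_zero, by simp⟩
      neg_mem' := by
        rintro c ⟨N, m, hN, h⟩
        exact ⟨N, -m, hN, by rw [mul_neg, h, map_neg]⟩ }
  let a : Γ(M, U) →+* B := (ι.app U).hom.codRestrict B fun m => ⟨1, m, one_ne_zero, by simp⟩
  let b : k →+* B := (constMap f (ι ⁻¹ᵁ U)).codRestrict B fun c => by
    obtain ⟨x, y, hy, rfl⟩ := IsFractionRing.div_surjective (A := O) c
    refine ⟨y, constMap g U x, nonZeroDivisors.ne_zero hy, ?_⟩
    rw [app_constMap_base hι, ← map_mul, mul_div_cancel₀ _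
      (algebraMap_ne_zero_of_ne_zero (nonZeroDivisors.ne_zero hy))]
  have hab : a.comp (constMap g U) = b.comp (algebraMap O k) := by
    ext c
    exact app_constMap_base hι U c
  let l : Spec (CommRingCat.of B) ⟶ C := hι.lift (pointOf (R := CommRingCat.of B) hU a)
    (Spec.map (CommRingCat.ofHom b)) (by
      rw [pointOf_comp g (R := CommRingCat.of B) hU a, hab, CommRingCat.ofHom_comp, Spec.map_comp])
  have hl : ⊤ ≤ l ⁻¹ᵁ (ι ⁻¹ᵁ U) := by
    have h1 := le_preimage_pointOf (R := CommRingCat.of B) hU a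
    rw [← hι.lift_fst (pointOf (R := CommRingCat.of B) hU a) (Spec.map (CommRingCat.ofHom b))] at h1
    exact h1
  have hcomp : Spec.map (CommRingCat.ofHom B.subtype) ≫ l =
      pointOf (R := Γ(C, ι ⁻¹ᵁ U)) hUι (RingHom.id _) := by
    refine hι.hom_ext ?_ ?_
    · rw [Category.assoc, hι.lift_fst]
      refine hom_ext_of_evalAt (R := Γ(C, ι ⁻¹ᵁ U)) hU
        (le_preimage_SpecMap_comp (le_preimage_pointOf _ _) _)
        (le_preimage_pointOf (R := Γ(C, ι ⁻¹ᵁ U)) hUι (RingHom.id _)) (RingHom.ext fun m => ?_)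
      have e1 := evalAt_SpecMap_comp (pointOf (R := CommRingCat.of B) hU a) U
        (le_preimage_pointOf _ _) (CommRingCat.ofHom B.subtype)
        (le_preimage_SpecMap_comp (le_preimage_pointOf _ _) _)
      rw [evalAt_pointOf] at e1
      have e2 := evalAt_comp (pointOf (R := Γ(C, ι ⁻¹ᵁ U)) hUι (RingHom.id _)) ι U
        (le_preimage_pointOf (R := Γ(C, ι ⁻¹ᵁ U)) hUι (RingHom.id _)) m
      rw [evalAt_pointOf] at e2
      exact (congrArg (fun z => z m) e1).trans e2.symm
    · rw [Category.assoc, hι.lift_snd, pointOf_comp f (R := Γ(C, ι ⁻¹ᵁ U)) hUι, ← Spec.map_comp]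
      rfl
  have h2 := evalAt_SpecMap_comp l (ι ⁻¹ᵁ U) hl (CommRingCat.ofHom B.subtype)
    (le_preimage_SpecMap_comp hl _)
  have h3 := evalAt_congr hcomp (ι ⁻¹ᵁ U) (le_preimage_SpecMap_comp hl _)
  have h4 := h3.trans (evalAt_pointOf (R := Γ(C, ι ⁻¹ᵁ U)) hUι (RingHom.id _))
  have h5 := congrArg (fun z => z c) (h2.symm.trans h4)
  have h6 : ((evalAt l (ι ⁻¹ᵁ U) hl c : B) : Γ(C, ι ⁻¹ᵁ U)) = c := h5
  rw [← h6]
  exact (evalAt l (ι ⁻¹ᵁ U) hl c : B).2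

end

section

variable {k : Type u} [Field k] {C : Scheme.{u}} {f : C ⟶ Spec (CommRingCat.of k)} [IsIntegral C]
  {x₀ : Spec (CommRingCat.of k) ⟶ C} (L : LineChart f x₀)

namespace LineChart

lemma evalAt_ratPt (τ : k) (P : Polynomial k) (h : ⊤ ≤ (L.ratPt τ) ⁻¹ᵁ L.V) :
    evalAt (L.ratPt τ) L.V h (L.φ P) = P.eval τ :=
  L.evalAt_pt (R := CommRingCat.of k) (Polynomial.evalRingHom τ) P

/-- The function `(X - θ₁) / (X - θ₂)` is regular away from `θ₂`, with value `1` at infinity. -/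
lemma exists_ratio (θ₁ θ₂ : k) {T : C.Opens} (hgT : genericPoint C ∈ T)
    (hT : ∀ y ∈ T, y ≠ closedPt x₀ → y ∈ C.basicOpen (L.φ (Polynomial.X - Polynomial.C θ₂))) :
    ∃ Φ : Γ(C, T), ∀ (τ : k) (h : ⊤ ≤ (L.ratPt τ) ⁻¹ᵁ T),
      evalAt (L.ratPt τ) T h Φ * (τ - θ₂) = τ - θ₁ := by
  set a := L.φ (Polynomial.X - Polynomial.C θ₁) with ha
  set b := L.φ (Polynomial.X - Polynomial.C θ₂) with hb
  have hgV := L.genericPoint_mem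
  have hb0 : b ≠ 0 := (map_ne_zero_iff _ L.φ.injective).2 (Polynomial.X_sub_C_ne_zero θ₂)
  have hgb : genericPoint C ∈ C.basicOpen b := genericPoint_mem_basicOpen _ hb0
  obtain ⟨v, hv⟩ : ∃ v : Γ(C, C.basicOpen b),
      C.presheaf.map (homOfLE (C.basicOpen_le b)).op b * v = 1 :=
    (C.toRingedSpace.isUnit_res_basicOpen b).exists_right_inv
  set K := C.functionField
  let y : K := algebraMap _ K L.y
  let X' : K := toFunctionField L.V hgV (L.φ Polynomial.X)
  let c (θ : k) : K := toFunctionField L.V hgV (constMap f L.V θ)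
  have hyX : y * X' = 1 := L.y_mul
  have hφ (θ : k) : toFunctionField L.V hgV (L.φ (Polynomial.X - Polynomial.C θ)) = X' - c θ := by
    rw [map_sub, L.φ_C, map_sub]
  have hunit : IsUnit (1 - stalkConst f (closedPt x₀) θ₂ * L.y) := by
    refine (IsLocalRing.notMem_maximalIdeal).1 fun h => ?_
    have h1 := Ideal.add_mem _ h (Ideal.mul_mem_left _ (stalkConst f (closedPt x₀) θ₂) L.y_mem)
    rw [sub_add_cancel] at h1
    exact (IsLocalRing.maximalIdeal.isMaximal _).ne_top ((Ideal.eq_top_iff_one _).2 h1)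
  obtain ⟨w, hw⟩ := hunit.exists_right_inv
  have hw' : (1 - c θ₂ * y) * algebraMap _ K w = 1 := by
    have h1 := congrArg (algebraMap _ K) hw
    rwa [map_mul, map_sub, map_mul, map_one, algebraMap_stalkConst f _ hgV] at h1
  let s : Γ(C, C.basicOpen b) := C.presheaf.map (homOfLE (C.basicOpen_le b)).op a * v
  have hsv : toFunctionField _ hgb s * (X' - c θ₂) = X' - c θ₁ := by
    have h1 := congrArg (toFunctionField _ hgb) hv
    rw [map_mul, map_one] at h1
    have h2 : toFunctionField _ hgb (C.presheaf.map (homOfLE (C.basicOpen_le b)).op b) =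
      X' - c θ₂ := (toFunctionField_map (C.basicOpen_le b) hgb b).trans (hφ θ₂)
    have h3 : toFunctionField _ hgb (C.presheaf.map (homOfLE (C.basicOpen_le b)).op a) =
      X' - c θ₁ := (toFunctionField_map (C.basicOpen_le b) hgb a).trans (hφ θ₁)
    have h4 : (X' - c θ₂) * toFunctionField _ hgb v = 1 := by rw [← h2]; exact h1
    rw [map_mul, h3]
    linear_combination (X' - c θ₁) * h4
  have hne : X' - c θ₂ ≠ 0 := by
    rw [← hφ]
    exact (map_ne_zero_iff _ (toFunctionField_injective _ hgV)).2 hb0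
  have hr : algebraMap _ K ((1 - stalkConst f (closedPt x₀) θ₁ * L.y) * w) =
      toFunctionField _ hgb s := by
    refine mul_right_cancel₀ hne ?_
    rw [hsv, map_mul, map_sub, map_mul, map_one, algebraMap_stalkConst f _ hgV]
    change (1 - c θ₁ * y) * algebraMap _ K w * (X' - c θ₂) = X' - c θ₁
    linear_combination (1 - c θ₁ * y) * X' * hw' +
      ((1 - c θ₁ * y) * algebraMap _ K w * c θ₂ - c θ₁) * hyX
  obtain ⟨Φ, hΦ⟩ := exists_extension hT hgb hgT s _ hr
  refine ⟨Φ, fun τ h => ?_⟩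
  have hgTV : genericPoint C ∈ T ⊓ L.V := ⟨hgT, hgV⟩
  have hmul : C.presheaf.map (homOfLE (inf_le_left : T ⊓ L.V ≤ T)).op Φ *
      C.presheaf.map (homOfLE (inf_le_right : T ⊓ L.V ≤ L.V)).op b =
      C.presheaf.map (homOfLE (inf_le_right : T ⊓ L.V ≤ L.V)).op a := by
    refine toFunctionField_injective _ hgTV ?_
    have e₁ : toFunctionField L.V hgV a = X' - c θ₁ := hφ θ₁
    have e₂ : toFunctionField L.V hgV b = X' - c θ₂ := hφ θ₂
    rw [map_mul, toFunctionField_map, toFunctionField_map, toFunctionField_map, hΦ, e₁, e₂, hsv]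
  have hle : ⊤ ≤ (L.ratPt τ) ⁻¹ᵁ (T ⊓ L.V) := fun p hp => ⟨h hp, L.le_preimage_pt _ hp⟩
  have h1 := congrArg (evalAt (L.ratPt τ) _ hle) hmul
  rw [map_mul, evalAt_res, evalAt_res, evalAt_res, ha, hb, evalAt_ratPt, evalAt_ratPt] at h1
  simpa using h1

end LineChart

end

lemma eq_of_closedPt_eq {k : Type u} [Field k] {C : Scheme.{u}} {f : C ⟶ Spec (CommRingCat.of k)}
    {x x' : Spec (CommRingCat.of k) ⟶ C} (hx : x ≫ f = 𝟙 _) (hx' : x' ≫ f = 𝟙 _)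
    (h : closedPt x = closedPt x') : x = x' := by
  obtain ⟨U, hU, hxU, -⟩ := exists_isAffineOpen_mem_and_subset (U := ⊤)
    (TopologicalSpace.Opens.mem_top (closedPt x))
  have hle := le_preimage_of_closedPt_mem x hxU
  have hle' := le_preimage_of_closedPt_mem x' (h ▸ hxU)
  refine hom_ext_of_evalAt (R := CommRingCat.of k) hU hle hle' (RingHom.ext fun s => ?_)
  by_contra hne
  have h1 : closedPt x' ∈ C.basicOpen (s - constMap f U (evalAt x U hle s)) := by
    rw [closedPt_mem_basicOpen_iff x' hle', map_sub, evalAt_constMap_self f x' hx', sub_ne_zero]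
    exact Ne.symm hne
  rw [← h, closedPt_mem_basicOpen_iff x hle, map_sub, evalAt_constMap_self f x hx, sub_self] at h1
  exact h1 rfl

section

variable {O k : Type u} [CommRing O] [IsDomain O] [Field k] [Algebra O k] [IsFractionRing O k]
  {M C : Scheme.{u}} {g : M ⟶ Spec (CommRingCat.of O)} {f : C ⟶ Spec (CommRingCat.of k)} {ι : C ⟶ M}

omit [IsDomain O] [IsFractionRing O k] in
lemma IntegralPoints.toFieldPoint_comp {Z : Set M}
    (hι : IsPullback ι f g (Spec.map (CommRingCat.ofHom (algebraMap O k)))) (F : Type u) [Field F]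
    [Algebra k F] (P : IntegralPoints g Z) : (P.toFieldPoint hι F).1 ≫ ι =
      Spec.map (CommRingCat.ofHom ((algebraMap k F).comp (algebraMap O k))) ≫ P.1 :=
  hι.lift_fst _ _ _

/-- An integral point is determined by its generic point. -/
lemma IntegralPoints.toFieldPoint_injective [IsSeparated g] {Z : Set M}
    (hι : IsPullback ι f g (Spec.map (CommRingCat.ofHom (algebraMap O k)))) (F : Type u) [Field F]
    [Algebra k F] :
    Function.Injective (IntegralPoints.toFieldPoint (Z := Z) hι F) := by
  intro P P' h
  let ψ : O →+* F := (algebraMap k F).comp (algebraMap O k)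
  have hψ : Function.Injective ψ := (algebraMap k F).injective.comp (IsFractionRing.injective O k)
  have h1 : Spec.map (CommRingCat.ofHom ψ) ≫ P.1 = Spec.map (CommRingCat.ofHom ψ) ≫ P'.1 := by
    have h2 := congrArg (fun x => x.1 ≫ ι) h
    rwa [toFieldPoint_comp, toFieldPoint_comp] at h2
  have : IsDominant (Spec.map (CommRingCat.ofHom ψ)) := by
    refine ⟨(PrimeSpectrum.denseRange_comap_iff_ker_le_nilRadical _).2 ?_⟩
    exact ((RingHom.injective_iff_ker_eq_bot _).1 hψ).le.trans bot_le
  exact Subtype.ext (ext_of_isDominant_of_isSeparated g (P.2.1.trans P'.2.1.symm) _ h1)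

/-- If `W` is a quasi-compact open of the model on whose generic fibre `(X - θ₁) / (X - θ₂)` is
regular, the values of this function at the integral points of `W` have a common denominator. -/
lemma LineChart.exists_common_denominator [IsIntegral C] {x₀ : Spec (CommRingCat.of k) ⟶ C}
    (L : LineChart f x₀) (hι : IsPullback ι f g (Spec.map (CommRingCat.ofHom (algebraMap O k))))
    {W : M.Opens} (hW : IsCompact (W : Set M)) (hgW : genericPoint C ∈ ι ⁻¹ᵁ W)
    {θ₁ θ₂ : k} (hθ : θ₁ ≠ θ₂) (hT : ∀ y ∈ ι ⁻¹ᵁ W, y ≠ closedPt x₀ →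
      y ∈ C.basicOpen (L.φ (Polynomial.X - Polynomial.C θ₂))) :
    ∃ N : O, N ≠ 0 ∧ ∀ (s : Spec (CommRingCat.of O) ⟶ M), (∀ p, s p ∈ W) → ∀ τ : k,
      Spec.map (CommRingCat.ofHom (algebraMap O k)) ≫ s = L.ratPt τ ≫ ι →
      τ ≠ θ₂ ∧ ∃ o : O, algebraMap O k o = algebraMap O k N * ((τ - θ₁) / (τ - θ₂)) := by
  obtain ⟨Φ, hΦ⟩ := L.exists_ratio θ₁ θ₂ hgW hT
  obtain ⟨t, ht⟩ := hW.elim_finite_subcover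
    (fun U : {U : M.affineOpens // U.1 ≤ W} => (U.1.1 : Set M)) (fun U => U.1.1.isOpen) (by
      intro x hx
      obtain ⟨U, hU, hxU, hUW⟩ := exists_isAffineOpen_mem_and_subset (U := W) hx
      exact Set.mem_iUnion.2 ⟨⟨⟨U, hU⟩, hUW⟩, hxU⟩)
  have hle (U : {U : M.affineOpens // U.1 ≤ W}) : ι ⁻¹ᵁ U.1.1 ≤ ι ⁻¹ᵁ W := fun _ hx => U.2 hx
  choose N m hN hm using fun U : {U : M.affineOpens // U.1 ≤ W} =>
    exists_constMap_mul_eq_app hι U.1.2 (C.presheaf.map (homOfLE (hle U)).op Φ)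
  obtain ⟨N₀, hN₀, hdvd⟩ := exists_common_multiple t N fun U _ => hN U
  refine ⟨N₀, hN₀, fun s hs τ hτ => ?_⟩
  have hleW : ⊤ ≤ (L.ratPt τ) ⁻¹ᵁ (ι ⁻¹ᵁ W) := by
    intro p _
    change (L.ratPt τ ≫ ι) p ∈ W
    rw [← hτ]
    exact hs _
  have hval := hΦ τ hleW
  have hne : τ ≠ θ₂ := by
    rintro rfl
    rw [sub_self, mul_zero] at hval
    exact hθ (sub_eq_zero.1 hval.symm).symm
  rw [← eq_div_iff (sub_ne_zero.2 hne)] at hval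
  refine ⟨hne, mem_range_of_forall_localSubring fun p => ?_⟩
  obtain ⟨U, hUt, hpU⟩ : ∃ U ∈ t, s p ∈ U.1.1 := by
    have h1 := ht (hs p)
    simpa using h1
  have h : ⊤ ≤ (L.ratPt τ ≫ ι) ⁻¹ᵁ U.1.1 := by
    intro y _
    rw [← hτ]
    have h2 : (Spec.map (CommRingCat.ofHom (algebraMap O k)) y) ⤳ (p : Spec (CommRingCat.of O)) := by
      refine (PrimeSpectrum.le_iff_specializes _ _).1 fun a ha => ?_
      have h3 : algebraMap O k a ∈ y.asIdeal := ha
      rw [(Ideal.eq_bot_or_top y.asIdeal).resolve_right y.isPrime.ne_top, Ideal.mem_bot,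
        FaithfulSMul.algebraMap_eq_zero_iff] at h3
      exact h3 ▸ Ideal.zero_mem _
    exact (h2.map s.continuous).mem_open U.1.1.isOpen hpU
  have h1 := evalAt_mem_localSubring hpU (hτ ▸ h) (m U)
  have h2 := congrArg (fun z => z (m U)) (evalAt_congr hτ U.1.1 (hτ ▸ h))
  have h3 := evalAt_comp (L.ratPt τ) ι U.1.1 h (m U)
  have h' : ⊤ ≤ (L.ratPt τ) ⁻¹ᵁ (ι ⁻¹ᵁ U.1.1) := h
  have h4 : evalAt (L.ratPt τ) (ι ⁻¹ᵁ U.1.1) h' (ι.app U.1.1 (m U)) =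
      algebraMap O k (N U) * ((τ - θ₁) / (τ - θ₂)) := by
    rw [← hm, map_mul, evalAt_constMap_self f _ (L.ratPt_comp_self τ), evalAt_res, hval]
  obtain ⟨c, hc⟩ := hdvd U hUt
  rw [hc, map_mul, mul_right_comm, ← h4, ← h3]
  exact mul_mem ((congrArg (· ∈ localSubring k p.asIdeal) h2).mp h1) (Subalgebra.algebraMap_mem _ c)

end

section

variable {O k : Type u} [CommRing O] [Field k] [Algebra O k] [IsFractionRing O k]
  {M C : Scheme.{u}} {g : M ⟶ Spec (CommRingCat.of O)} {f : C ⟶ Spec (CommRingCat.of k)} {ι : C ⟶ M}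

/-- If the projective line over a Dedekind domain minus two sections, or a model thereof, has
infinitely many integral points, then there are infinitely many units. -/
theorem LineChart.infinite_units [IsDedekindDomain O] [IsProper g] [IsIntegral C]
    {x₀ : Spec (CommRingCat.of k) ⟶ C}
    (L : LineChart f x₀) (hι : IsPullback ι f g (Spec.map (CommRingCat.ofHom (algebraMap O k))))
    {Z : Set M} [Infinite (IntegralPoints g Z)] (hgZ : ι (genericPoint C) ∉ closure Z)
    {θ₁ θ₂ : k} (hθ : θ₁ ≠ θ₂) (hT : ∀ y, ι y ∉ closure Z → y ≠ closedPt x₀ →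
      y ∈ C.basicOpen (L.φ ((Polynomial.X - Polynomial.C θ₁) *
        (Polynomial.X - Polynomial.C θ₂)))) : Infinite Oˣ := by
  let W : M.Opens := ⟨(closure Z)ᶜ, isClosed_closure.isOpen_compl⟩
  have hWc : IsCompact (W : Set M) := by
    have : IsLocallyNoetherian M := LocallyOfFiniteType.isLocallyNoetherian g
    have : CompactSpace M := QuasiCompact.compactSpace_of_compactSpace g
    have : IsNoetherian M := { }
    exact NoetherianSpace.isCompact _
  obtain ⟨N, hN, H⟩ := L.exists_common_denominator hι hWc hgZ hθ fun y hy hne => by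
    have h1 := hT y hy hne
    rw [map_mul, Scheme.basicOpen_mul] at h1
    exact h1.2
  obtain ⟨N', hN', H'⟩ := L.exists_common_denominator hι hWc hgZ hθ.symm fun y hy hne => by
    have h1 := hT y hy hne
    rw [map_mul, Scheme.basicOpen_mul] at h1
    exact h1.1
  let A : Set k := {τ | ∃ P : IntegralPoints g Z,
    Spec.map (CommRingCat.ofHom (algebraMap O k)) ≫ P.1 = L.ratPt τ ≫ ι}
  have hA : A.Infinite := by
    intro hfin
    refine Set.infinite_range_of_injective
      (IntegralPoints.toFieldPoint_injective (g := g) (Z := Z) hι k) ?_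
    refine ((hfin.image (L.fieldPt k)).union
      (Set.Subsingleton.finite (s := {x : FieldPoints f k | closedPt x.1 = closedPt x₀}) ?_)).subset
      ?_
    · intro x hx x' hx'
      have hid : Spec.map (CommRingCat.ofHom (algebraMap k k)) = 𝟙 _ := Spec.map_id _
      exact Subtype.ext (eq_of_closedPt_eq (x.2.trans hid) (x'.2.trans hid) (hx.trans hx'.symm))
    · rintro _ ⟨P, rfl⟩
      by_cases h : closedPt (P.toFieldPoint hι k).1 = closedPt x₀
      · exact Or.inr h
      · obtain ⟨τ, hτ, -⟩ := L.exists_eq_fieldPt (P.toFieldPoint hι k)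
          (le_preimage_of_closedPt_mem _ ((L.mem_iff _).2 h))
        refine Or.inl ⟨τ, ⟨P, ?_⟩, hτ.symm⟩
        have h1 := P.toFieldPoint_comp hι k
        have h2 : (P.toFieldPoint hι k).1 = L.ratPt τ := congrArg Subtype.val hτ
        rw [← h2]
        exact h1.symm
  have hex : ∀ τ ∈ A, τ ≠ θ₂ ∧ ∃ o : O, algebraMap O k o =
      algebraMap O k N * ((τ - θ₁) / (τ - θ₂)) ∧ o ∣ N * N' := by
    rintro τ ⟨P, hP⟩
    obtain ⟨h₂, o, ho⟩ := H P.1 P.2.2 τ hP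
    obtain ⟨h₁, o', ho'⟩ := H' P.1 P.2.2 τ hP
    refine ⟨h₂, o, ho, o', IsFractionRing.injective O k ?_⟩
    rw [map_mul, map_mul, ho, ho']
    have := sub_ne_zero.2 h₁
    have := sub_ne_zero.2 h₂
    field_simp
  choose! ho₂ o ho hdvd using hex
  refine IsDedekindDomain.infinite_units_of_infinite_dvd (mul_ne_zero hN hN')
    ((hA.image (f := o) ?_).mono ?_)
  · intro τ hτ τ' hτ' h
    have h1 := ho τ hτ
    rw [h, ho τ' hτ'] at h1
    have h2 := mul_left_cancel₀ (algebraMap_ne_zero_of_ne_zero hN) h1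
    have h3 := sub_ne_zero.2 (ho₂ τ hτ)
    have h4 := sub_ne_zero.2 (ho₂ τ' hτ')
    rw [div_eq_div_iff h4 h3] at h2
    refine mul_left_cancel₀ (sub_ne_zero.2 hθ) ?_
    linear_combination -h2
  · rintro _ ⟨τ, hτ, rfl⟩
    exact hdvd τ hτ

end

end AlgebraicGeometry

open Topology

/-! ### Points near the divisor -/

/-- Without finite places in `S`, the `S`-integers are the algebraic integers. -/
lemma SIntegers.isDedekindDomain {k : Type u} [Field k] [NumberField k] {S : Set (NFPlace k)}
    (hS : ∀ p, NFPlace.finite p ∉ S) : IsDedekindDomain (SIntegers k S) := by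
  have : IsIntegralClosure (SIntegers k S) ℤ k := by
    refine ⟨Subtype.val_injective, fun {x} => ⟨fun hx => ?_, ?_⟩⟩
    · exact ⟨⟨x, SIntegers.mem_of_isIntegral S hx.tower_top⟩, rfl⟩
    · rintro ⟨y, rfl⟩
      obtain ⟨z, hz⟩ :=
        HeightOneSpectrum.mem_integers_of_valuation_le_one k (y : k) fun p => y.2 p (hS p)
      have h1 : (z : k) = algebraMap (SIntegers k S) k y := hz
      rw [← h1]
      exact RingOfIntegers.isIntegral_coe z
  exact IsIntegralClosure.isDedekindDomain ℤ ℚ k (SIntegers k S)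

namespace AlgebraicGeometry

lemma LineChart.fieldPt_algebraMap {k : Type u} [Field k] {C : Scheme.{u}} [IsIntegral C]
    {f : C ⟶ Spec (CommRingCat.of k)} {x₀ : Spec (CommRingCat.of k) ⟶ C} (L : LineChart f x₀)
    (F : Type u) [Field F] [Algebra k F] (τ : k) :
    (L.fieldPt F (algebraMap k F τ)).1 =
      Spec.map (CommRingCat.ofHom (algebraMap k F)) ≫ L.ratPt τ := by
  have h : Polynomial.eval₂RingHom (algebraMap k F) (algebraMap k F τ) =
      (algebraMap k F).comp (Polynomial.evalRingHom τ) := by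
    ext <;> simp
  have h1 : (L.fieldPt F (algebraMap k F τ)).1 =
      L.pt (R := CommRingCat.of F) ((algebraMap k F).comp (Polynomial.evalRingHom τ)) :=
    congrArg (fun z => L.pt (R := CommRingCat.of F) z) h
  rw [h1, ratPt, pt, pt, pointOf, pointOf, ← Category.assoc, ← Spec.map_comp]
  rfl

variable {O k : Type u} [CommRing O] [Field k] [Algebra O k] [IsFractionRing O k]
  {M C D : Scheme.{u}} {g : M ⟶ Spec (CommRingCat.of O)} {f : C ⟶ Spec (CommRingCat.of k)}
  {ι : C ⟶ M}

/-- The generic fibre is a subspace of the model, so the closure of a closed subset of it has the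
same points in the generic fibre. -/
lemma apply_mem_closure_iff
    (hι : IsPullback ι f g (Spec.map (CommRingCat.ofHom (algebraMap O k))))
    (i : D ⟶ C) [IsClosedImmersion i] (y : C) :
    ι y ∈ closure (Set.range (i ≫ ι)) ↔ y ∈ Set.range i := by
  have h1 : IsPreimmersion (Spec.map (CommRingCat.ofHom (algebraMap O k))) :=
    IsPreimmersion.of_isLocalization (nonZeroDivisors O)
  have h2 : IsPreimmersion ι := MorphismProperty.of_isPullback hι.flip h1
  have h3 : Set.range (i ≫ ι) = ι '' Set.range i := by
    rw [← Set.range_comp]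
    rfl
  rw [h3, ← Set.mem_preimage, ← ι.isEmbedding.closure_eq_preimage_closure_image,
    i.isClosedEmbedding.isClosed_range.closure_eq]

omit [IsFractionRing O k] in
lemma IntegralPoints.toFieldPoint_eq_fieldPt [IsIntegral C] {x₀ : Spec (CommRingCat.of k) ⟶ C}
    (L : LineChart f x₀) (hι : IsPullback ι f g (Spec.map (CommRingCat.ofHom (algebraMap O k))))
    {Z : Set M} (P : IntegralPoints g Z) {τ : k}
    (hP : Spec.map (CommRingCat.ofHom (algebraMap O k)) ≫ P.1 = L.ratPt τ ≫ ι)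
    (F : Type u) [Field F] [Algebra k F] :
    P.toFieldPoint hι F = L.fieldPt F (algebraMap k F τ) := by
  refine Subtype.ext (hι.hom_ext ?_ ((P.toFieldPoint hι F).2.trans (L.fieldPt F _).2.symm))
  rw [toFieldPoint_comp, LineChart.fieldPt_algebraMap, Category.assoc, ← hP,
    CommRingCat.ofHom_comp, Spec.map_comp, Category.assoc]

end AlgebraicGeometry

end

theorem proposition2
    {k : Type u} [Field k] [NumberField k]
    (S : Set (NFPlace k)) (hSfin : S.Finite)
    (hSinf : ∀ w : InfinitePlace k, NFPlace.infinite w ∈ S)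
    -- a smooth projective curve `C` of genus zero over `k`
    (C : Scheme.{u}) [IsIntegral C] (f : C ⟶ Spec (CommRingCat.of k))
    (hproj : IsProjectiveOver f) (hsmooth : SmoothOfRelativeDimension 1 f)
    (hgenus : HasGenusZero C)
    -- a reduced divisor `D` on `C` of degree at most two
    (D : Scheme.{u}) [IsReduced D] (i : D ⟶ C) [IsClosedImmersion i] [IsFinite (i ≫ f)]
    (hdeg : degreeOver (i ≫ f) ≤ 2)
    -- a normal projective model `M` of `C` over the `S`-integers
    (M : Scheme.{u}) (g : M ⟶ Spec (CommRingCat.of (SIntegers k S)))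
    [Flat g] (hMproj : IsProjectiveOver g) (hMnormal : IsNormalScheme M)
    (ι : C ⟶ M)
    (hι : IsPullback ι f g (Spec.map (CommRingCat.ofHom (algebraMap (SIntegers k S) k))))
    -- there are infinitely many integral points on `M` minus the closure of `D`
    (hinf : Infinite (IntegralPoints g (Set.range (i ≫ ι))))
    -- a place `v` in `S` with `D(k_v)` nonempty, and an open neighbourhood of `D(k_v)` in `C(k_v)`
    (v : NFPlace k) (hv : v ∈ S) (hDv : Nonempty (FieldPoints (i ≫ f) v.Completion))
    (W : Set (FieldPoints f v.Completion)) (hW : IsOpen W)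
    (hDW : Set.range (FieldPoints.map (f := f) (F := v.Completion) i) ⊆ W) :
    (Set.range (fun P : IntegralPoints g (Set.range (i ≫ ι)) =>
      P.toFieldPoint hι v.Completion) ∩ W).Infinite := by
  obtain ⟨P₀⟩ : Nonempty (IntegralPoints g (Set.range (i ≫ ι))) := inferInstance
  have := hproj.isProper
  have := hMproj.isProper
  set F := v.Completion
  have hid : Spec.map (CommRingCat.ofHom (algebraMap k k)) = 𝟙 _ := Spec.map_id _
  let x₀ : Spec (CommRingCat.of k) ⟶ C := (P₀.toFieldPoint hι k).1
  have hx₀ : x₀ ≫ f = 𝟙 _ := (P₀.toFieldPoint hι k).2.trans hid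
  have hs : x₀ ≫ ι = Spec.map (CommRingCat.ofHom (algebraMap (SIntegers k S) k)) ≫ P₀.1 :=
    P₀.toFieldPoint_comp hι k
  -- the generic point of an integral point serves as the point at infinity
  obtain ⟨L⟩ := nonempty_lineChart f hgenus x₀ hx₀
  have hcl := apply_mem_closure_iff hι i
  have hx₀D : closedPt x₀ ∉ Set.range i := by
    rw [← hcl]
    have h1 : ι (closedPt x₀) = P₀.1 (Spec.map (CommRingCat.ofHom (algebraMap (SIntegers k S) k))
        (IsLocalRing.closedPoint k)) :=
      congrArg (fun z => z (IsLocalRing.closedPoint k)) hs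
    rw [h1]
    exact P₀.2.2 _
  have hD (x : D) : i x ∈ L.V := (L.mem_iff _).2 fun h => hx₀D ⟨x, h⟩
  obtain ⟨q, hqm, hqs, hqd, hq, hq0⟩ := L.exists_polynomial i hD
  have hgq : genericPoint C ∈ C.basicOpen (L.φ q) :=
    genericPoint_mem_basicOpen _ ((map_ne_zero_iff _ L.φ.injective).2 hqm.ne_zero)
  have hle (y : C) (hy : y ∈ C.basicOpen (L.φ q)) : ι y ∉ closure (Set.range (i ≫ ι)) := by
    rw [hcl]
    exact (hq y (C.basicOpen_le _ hy)).1 hy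
  -- the point of `D(k_v)` to be approximated
  obtain ⟨d⟩ := hDv
  obtain ⟨θ, hθ, hdθ⟩ := L.exists_root i hD hq0 d
  have hq1 : 0 < q.natDegree := by
    by_contra h
    rw [Polynomial.eq_one_of_monic_natDegree_zero hqm (by omega), Polynomial.eval₂_one] at hθ
    exact one_ne_zero hθ
  obtain ⟨N, hN, hext⟩ := L.exists_section hι hx₀ hs
    (W := ⟨(closure (Set.range (i ≫ ι)))ᶜ, isClosed_closure.isOpen_compl⟩) P₀.2.2 hqm hq1 hle
  -- in the split case without finite places, the units come from the integral points
  have hunits (θ₁ θ₂ : k)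
      (hsplit : q = (Polynomial.X - Polynomial.C θ₁) * (Polynomial.X - Polynomial.C θ₂))
      (hS : ∀ p, NFPlace.finite p ∉ S) : Infinite (SIntegers k S)ˣ := by
    have := SIntegers.isDedekindDomain hS
    refine L.infinite_units hι (hle _ hgq) (θ₁ := θ₁) (θ₂ := θ₂) ?_ ?_
    · rintro rfl
      exact Polynomial.not_isUnit_X_sub_C θ₁ (hqs _ (hsplit ▸ dvd_rfl))
    · intro y hy hne
      rw [← hsplit]
      exact (hq y ((L.mem_iff y).2 hne)).2 ((hcl y).not.1 hy)
  -- a finite set of integral points in `W` could be removed from `W`, except for `θ` itself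
  intro hfin
  have hT : (L.fieldPt F ⁻¹' (Set.range (fun P : IntegralPoints g (Set.range (i ≫ ι)) =>
      P.toFieldPoint hι F) ∩ W)).Finite :=
    hfin.preimage (L.fieldPt_injective F).injOn
  have hΩ : L.fieldPt F ⁻¹' W ∩ (L.fieldPt F ⁻¹' (Set.range
      (fun P : IntegralPoints g (Set.range (i ≫ ι)) => P.toFieldPoint hι F) ∩ W) \ {θ})ᶜ ∈ nhds θ := by
    refine ((hW.preimage (L.continuous_fieldPt F)).inter
      (hT.subset Set.sdiff_subset).isClosed.isOpen_compl).mem_nhds ⟨?_, fun h => h.2 rfl⟩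
    rw [Set.mem_preimage, ← hdθ]
    exact hDW ⟨d, rfl⟩
  obtain ⟨a, b, hb, hNb, hu, ⟨hτW, hτ⟩, hτθ⟩ :=
    SIntegers.exists_div_mem hv hqm hqs (hqd.trans_le hdeg) hunits hθ hN hΩ
  obtain ⟨s, hsg, hsW, hsτ⟩ := hext a b hb hNb hu
  let P : IntegralPoints g (Set.range (i ≫ ι)) := ⟨s, hsg, hsW⟩
  exact hτ ⟨⟨⟨P, P.toFieldPoint_eq_fieldPt L hι hsτ F⟩, hτW⟩, hτθ⟩
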